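/- \textbf{Machine model.} Algorithms are deterministic multi-tape Turing machines with a read-only input tape (with endmarkers), finitely many work tapes and a one-way write-only output tape; space means the number of cells used on each work tape, and $|x|$ is the length of the encoded instance $x$. "Polynomial time" means at most $p(|x|)$ steps for some polynomial $p$. A polylogarithmic function is a function $\ell(n)=p(\log_2 n)$, where $p$ is a polynomial with nonnegative integer coefficients and $\log_2 0:=0$. \textbf{Hypothesis.} An instance of $\mathrm{2SAT}_3$ is a nonempty 2CNF formula $x$ (each clause has one or two literals) in which each variable occurs, positively or negatively, at most $3$ times; the question is whether $x$ is satisfiable, and $m_{vbl}(x)$ is the number of variables appearing in $x$. The \emph{linear space hypothesis} (LSH) for $\mathrm{2SAT}_3$ says: for every $\varepsilon\in(0,1)$ and every polylogarithmic function $\ell$, no deterministic Turing machine solves $\mathrm{2SAT}_3$ simultaneously in polynomial time and using at most $m_{vbl}(x)^{\varepsilon}\,\ell(|x|)$ space on all instances $x$. \textbf{Search problem.} An instance of Search-1NFA is a pair $y=(M,1^n)$, where $M=(Q,\Sigma,\delta,q_0,F)$ is a one-way nondeterministic finite automaton without $\lambda$-moves, with a nonempty alphabet $\Sigma$, and $n\in\mathbb{N}$.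 A solution is a string $w\in\Sigma^n$ accepted by $M$ in the sense that some computation of $M$ on $w$ enters a state of $F$ before or on reading the last symbol of $w$ (i.e. after some, possibly empty, prefix of $w$). A machine solves the problem if on each instance $y$ it outputs a solution if there is one, and the designated symbol $\bot$ otherwise. The size parameter is $m_{nfa}(y)=|Q|\,|\Sigma|\,n$. \textbf{Theorem.} Assume LSH for $\mathrm{2SAT}_3$. Then for every $\varepsilon\in(0,1/2)$ there is no function $s$ with $s(m)=O(m^{1/2-\varepsilon})$ as $m\to\infty$ such that some deterministic Turing machine solves Search-1NFA in polynomial time using at most $s(m_{nfa}(y))$ space on every instance $y$. -/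

import Mathlib

/-! ### Deterministic multi-tape Turing machines with read-only input and write-only output -/

/-- What the input head sees: the left endmarker, an input symbol, or the right endmarker. -/
inductive InputSymbol (α : Type) : Type
  | leftEnd : InputSymbol α
  | symbol (a : α) : InputSymbol α
  | rightEnd : InputSymbol α

/-- Head movements. -/
inductive HeadMove : Type
  | left : HeadMove
  | stay : HeadMove
  | right : HeadMove

/-- One instruction of a machine: the new state, the movement of the input head, for each work
tape the symbol to write and the movement of its head, and possibly one symbol to be appended to
the contents of the write-only output tape. -/
structure TMAction (State Γ β : Type) (k : ℕ) : Type where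
  nextState : State
  inputMove : HeadMove
  workWrite : Fin k → Γ
  workMove : Fin k → HeadMove
  emit : Option β

/-- A deterministic Turing machine with a read-only input tape over `α` (with endmarkers), a
finite number of read-write work tapes over a finite alphabet, and a one-way write-only output
tape over `β`.  The machine halts when its transition function is undefined (`none`). -/
structure MultiTapeTM (α β : Type) : Type 1 where
  State : Type
  finite_state : Finite State
  WorkSymbol : Type
  finite_workSymbol : Finite WorkSymbol
  blank : WorkSymbol
  numTapes : ℕ
  start : State
  accepting : Set State
  transition : State → InputSymbol α → (Fin numTapes → WorkSymbol) →
    Option (TMAction State WorkSymbol β numTapes)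

namespace MultiTapeTM

variable {α β : Type}

/-- A configuration.  Position `0` of the input head is the left endmarker, positions
`1, …, |x|` are the symbols of the input `x`, position `|x| + 1` is the right endmarker.
Work tapes are infinite in both directions. -/
structure Cfg (M : MultiTapeTM α β) : Type where
  state : M.State
  inputHead : ℕ
  work : Fin M.numTapes → ℤ → M.WorkSymbol
  workHead : Fin M.numTapes → ℤ
  output : List β

/-- The symbol at a position of the input tape that holds `x` between endmarkers. -/
def readInput (x : List α) : ℕ → InputSymbol α
  | 0 => InputSymbol.leftEnd
  | i + 1 =>
    match x[i]? with
    | some a => InputSymbol.symbol a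
    | none => InputSymbol.rightEnd

/-- Movement of the input head; the head cannot leave the part between the endmarkers. -/
def moveInput (x : List α) : HeadMove → ℕ → ℕ
  | HeadMove.left, i => i - 1
  | HeadMove.stay, i => i
  | HeadMove.right, i => min (i + 1) (x.length + 1)

/-- Movement of a work-tape head. -/
def moveWork : HeadMove → ℤ → ℤ
  | HeadMove.left, i => i - 1
  | HeadMove.stay, i => i
  | HeadMove.right, i => i + 1

/-- The initial configuration: all work tapes are blank and the output is empty. -/
def init (M : MultiTapeTM α β) : M.Cfg where
  state := M.start
  inputHead := 0
  work := fun _ _ => M.blank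
  workHead := fun _ => 0
  output := []

/-- The configuration after carrying out one instruction. -/
def applyAction (M : MultiTapeTM α β) (x : List α) (c : M.Cfg)
    (a : TMAction M.State M.WorkSymbol β M.numTapes) : M.Cfg where
  state := a.nextState
  inputHead := moveInput x a.inputMove c.inputHead
  work := fun i => Function.update (c.work i) (c.workHead i) (a.workWrite i)
  workHead := fun i => moveWork (a.workMove i) (c.workHead i)
  output := c.output ++ a.emit.toList

/-- The instruction to be carried out in a configuration, `none` if the machine has halted. -/
def instruction (M : MultiTapeTM α β) (x : List α) (c : M.Cfg) :
    Option (TMAction M.State M.WorkSymbol β M.numTapes) :=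
  M.transition c.state (readInput x c.inputHead) (fun i => c.work i (c.workHead i))

/-- The machine has halted. -/
def Halted (M : MultiTapeTM α β) (x : List α) (c : M.Cfg) : Prop :=
  M.instruction x c = none

/-- One step on input `x`; a halted configuration does not change any more. -/
def next (M : MultiTapeTM α β) (x : List α) (c : M.Cfg) : M.Cfg :=
  match M.instruction x c with
  | some a => M.applyAction x c a
  | none => c

/-- The configuration after `t` steps on input `x`. -/
def config (M : MultiTapeTM α β) (x : List α) (t : ℕ) : M.Cfg :=
  (M.next x)^[t] M.init

/-- The number of cells of the `i`-th work tape that are scanned in the first `t` steps. -/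
def cellsUsed (M : MultiTapeTM α β) (x : List α) (t : ℕ) (i : Fin M.numTapes) : ℕ :=
  ((Finset.range (t + 1)).image (fun s => (M.config x s).workHead i)).card

/-- On input `x` the machine halts after at most `T` steps in a configuration satisfying `P`,
having used at most `S` cells of each of its work tapes. -/
def HaltsWithin (M : MultiTapeTM α β) (x : List α) (T : ℕ) (S : ℝ) (P : M.Cfg → Prop) : Prop :=
  ∃ t ≤ T, M.Halted x (M.config x t) ∧ P (M.config x t) ∧
    ∀ i : Fin M.numTapes, (M.cellsUsed x t i : ℝ) ≤ S

end MultiTapeTM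

/-! ### Solving problems in polynomial time with bounded space -/

/-- The decision problem with instances `I`, encoded as words by `enc`, and yes-instances `yes`
is solved by a deterministic machine in time polynomial in the length of the encoded instance,
using on each instance `y` at most `space y` cells of each work tape. -/
def DecidableInPolyTimeSpace {I α : Type} (enc : I → List α) (yes : I → Prop)
    (space : I → ℝ) : Prop :=
  ∃ (M : MultiTapeTM α Empty) (p : Polynomial ℕ), ∀ y : I,
    M.HaltsWithin (enc y) (p.eval (enc y).length) (space y)
      (fun c => c.state ∈ M.accepting ↔ yes y)

/-- The search problem with instances `I`, encoded as words by `enc`, and solution sets `sol`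
is solved by a deterministic machine in time polynomial in the length of the encoded instance,
using on each instance `y` at most `space y` cells of each work tape.  The machine writes a
solution of `y` if there is one, and the single symbol `⊥` otherwise. -/
def SearchableInPolyTimeSpace {I α β : Type} (enc : I → List α) (sol : I → Set (List β))
    (space : I → ℝ) : Prop :=
  ∃ (M : MultiTapeTM α (WithBot β)) (p : Polynomial ℕ), ∀ y : I,
    M.HaltsWithin (enc y) (p.eval (enc y).length) (space y)
      (fun c => (∃ w ∈ sol y, c.output = w.map (fun b => (b : WithBot β))) ∨
        (sol y = ∅ ∧ c.output = [⊥]))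

/-- Polylogarithmic functions: `ℓ n = p (log₂ n)` with `p` a polynomial with coefficients
in `ℕ`; here `log₂ 0 = 0`. -/
def IsPolylog (ℓ : ℕ → ℝ) : Prop :=
  ∃ p : Polynomial ℕ, ∀ n : ℕ, ℓ n = Polynomial.aeval (Real.logb 2 (n : ℝ)) p

/-- The alphabet `{0, 1, #}` in which instances and solutions are written. -/
inductive CodeSymbol : Type
  | zero : CodeSymbol
  | one : CodeSymbol
  | hash : CodeSymbol
  deriving DecidableEq

/-- A bit as a symbol. -/
def CodeSymbol.ofBool : Bool → CodeSymbol
  | false => CodeSymbol.zero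
  | true => CodeSymbol.one

/-- The binary representation of a natural number (least significant bit first). -/
def encodeNat (v : ℕ) : List CodeSymbol :=
  v.bits.map CodeSymbol.ofBool

/-! ### The problem 2SAT with at most three occurrences of each variable, and the hypothesis -/

/-- A literal: a variable and its sign (`true` for positive). -/
abbrev SatLiteral : Type := ℕ × Bool

/-- A formula in conjunctive normal form: a list of clauses, which are lists of literals. -/
abbrev CNFFormula : Type := List (List SatLiteral)

namespace CNFFormula

/-- The variables of all literal occurrences in the formula, with multiplicity. -/
def varOccurrences (φ : CNFFormula) : List ℕ :=
  φ.flatten.map Prod.fst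

/-- The number `m_vbl` of variables that appear in the formula. -/
def numVars (φ : CNFFormula) : ℕ :=
  φ.varOccurrences.toFinset.card

/-- The formula is satisfied by some truth assignment. -/
def Satisfiable (φ : CNFFormula) : Prop :=
  ∃ ν : ℕ → Bool, ∀ C ∈ φ, ∃ l ∈ C, ν l.1 = l.2

/-- Each literal is written as its sign bit, the binary name of its variable, and `#`;
each clause ends with a further `#`. -/
def encode (φ : CNFFormula) : List CodeSymbol :=
  φ.flatMap fun C =>
    (C.flatMap fun l => CodeSymbol.ofBool l.2 :: (encodeNat l.1 ++ [CodeSymbol.hash])) ++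
      [CodeSymbol.hash]

end CNFFormula

/-- The instances of `2SAT₃`: nonempty 2CNF formulas (each clause has one or two literals)
in which each variable occurs, positively or negatively, at most three times. -/
structure TwoSat3Instance : Type where
  formula : CNFFormula
  formula_ne_nil : formula ≠ []
  clause_length : ∀ C ∈ formula, 1 ≤ C.length ∧ C.length ≤ 2
  occurrences : ∀ v : ℕ, formula.varOccurrences.count v ≤ 3

/-- The linear space hypothesis for `2SAT₃`: for no `ε ∈ (0,1)` and no polylogarithmic `ℓ` is
`2SAT₃` solvable in polynomial time using `m_vbl(x)^ε · ℓ(|x|)` space. -/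
def LinearSpaceHypothesis : Prop :=
  ∀ ε : ℝ, 0 < ε → ε < 1 → ∀ ℓ : ℕ → ℝ, IsPolylog ℓ →
    ¬ DecidableInPolyTimeSpace
        (fun x : TwoSat3Instance => x.formula.encode)
        (fun x => x.formula.Satisfiable)
        (fun x => (x.formula.numVars : ℝ) ^ ε * ℓ x.formula.encode.length)

/-! ### The search problem for one-way nondeterministic finite automata -/

/-- A one-way nondeterministic finite automaton `(Q, Σ, δ, q₀, F)` without `λ`-moves, with
`Q = {0, …, numStates - 1}` and nonempty alphabet `Σ = {0, …, numLetters - 1}`. -/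
structure OneNFA : Type where
  numStates : ℕ
  numLetters : ℕ
  numLetters_pos : 0 < numLetters
  trans : Fin numStates → Fin numLetters → Finset (Fin numStates)
  start : Fin numStates
  final : Finset (Fin numStates)

namespace OneNFA

/-- The automaton as an `NFA` of Mathlib (which has no `λ`-moves). -/
def toNFA (N : OneNFA) : NFA (Fin N.numLetters) (Fin N.numStates) where
  step q a := (N.trans q a : Set (Fin N.numStates))
  start := {N.start}
  accept := (N.final : Set (Fin N.numStates))

/-- `N` accepts `w`: some computation of `N` on `w` enters a final state before or on reading the
last symbol of `w`, that is, after reading some prefix `u` of `w`. -/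
def Accepts (N : OneNFA) (w : List (Fin N.numLetters)) : Prop :=
  ∃ u, u <+: w ∧ u ∈ N.toNFA.accepts

/-- Each state `q` is written as one bit telling whether `q` is the initial state, one bit telling
whether `q` is final, for each letter `a` the symbol `#` and the row of bits telling which states
belong to `δ(q, a)`, and finally `##`. -/
def encode (N : OneNFA) : List CodeSymbol :=
  (List.finRange N.numStates).flatMap fun q =>
    [CodeSymbol.ofBool (decide (q = N.start)), CodeSymbol.ofBool (decide (q ∈ N.final))] ++
    ((List.finRange N.numLetters).flatMap fun a =>
      CodeSymbol.hash :: (List.finRange N.numStates).map fun q' =>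
        CodeSymbol.ofBool (decide (q' ∈ N.trans q a))) ++
    [CodeSymbol.hash, CodeSymbol.hash]

/-- A word over `Σ` is written by the binary names of its letters, each followed by `#`. -/
def encodeWord {k : ℕ} (w : List (Fin k)) : List CodeSymbol :=
  w.flatMap fun a => encodeNat a ++ [CodeSymbol.hash]

end OneNFA

/-- An instance `(N, 1ⁿ)` of Search-1NFA. -/
structure Search1NFAInstance : Type where
  nfa : OneNFA
  n : ℕ

namespace Search1NFAInstance

/-- The instance is written as `1ⁿ # ` followed by the code of the automaton. -/
def encode (y : Search1NFAInstance) : List CodeSymbol :=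
  List.replicate y.n CodeSymbol.one ++ [CodeSymbol.hash] ++ y.nfa.encode

/-- The size parameter `m_nfa = |Q| |Σ| n`. -/
def size (y : Search1NFAInstance) : ℕ :=
  y.nfa.numStates * y.nfa.numLetters * y.n

/-- The solutions: the codes of the words of length `n` that are accepted by the automaton. -/
def solutions (y : Search1NFAInstance) : Set (List CodeSymbol) :=
  {z | ∃ w : List (Fin y.nfa.numLetters),
    w.length = y.n ∧ y.nfa.Accepts w ∧ z = OneNFA.encodeWord w}

end Search1NFAInstance

/-! The proof is a Turing reduction from 2SAT₃ to Search-1NFA that needs very little space of its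
own. Let `K` be the number of literal occurrences of a formula; since a variable occurs at most
three times, `K ≤ 3 * m_vbl` (`length_occs_le`). For each occurrence `s` there is a one-letter
automaton whose states are the `K` occurrences (`queryNFA`). Being in state `o` means that the
literal at `o` is assumed false; then the other literal of the clause is true, and the automaton
moves to any occurrence of the complement of that literal. It starts in `s` and accepts at
occurrences of the complement of the literal at `s`: the assumption has refuted itself, and the
literal at `s` is forced. By the implication graph criterion, a formula is unsatisfiable if and only
if two occurrences with complementary literals are both forced (`satisfiable_iff`). Acceptance looks
at prefixes and paths can be shortened to at most `K` steps, so words of length `K` suffice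
(`solutions_queryInstance_nonempty_iff`) and the size parameter of a query is `K * 1 * K`.

A search machine with space `O(m ^ (1/2 - ε))` therefore spends `O(K ^ (1 - 2ε))`, that is `O(m_vbl
^ (1 - 2ε))`, on a query. Everything else is logarithmic. A query is quadratically long and is never
stored: whenever the simulated machine reads an input symbol, the whole query is generated anew from
the formula, and a countdown picks out the symbol under the virtual head (`runs_genQuery`,
`runs_fetch`). Of the output only one bit is kept, namely whether `⊥` was written. After each query
the work tapes are cleaned and reused (`runs_cleanTapes`, `runs_runQuery`). Altogether 2SAT₃ is
decided in polynomial time and space `m_vbl ^ (1 - 2ε)` times a polylogarithm, which contradicts the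
hypothesis, as `1 - 2ε` lies in `(0,1)`.

The reduction has to be an actual Turing machine. It is written as a structured program with
counters and compiled in two stages (`Prog.Exec.compile`, `Prog.Exec.haltsWithin`, combined in
`exists_turingMachine`). If no loop is iterated more than `N` times, the running time is polynomial
in `N`; a counter grows by at most one per step, so its digits take logarithmic space; and a guard
that keeps all heads within distance `b` of their origin bounds the cells by `2 * b + 1`. -/

/-! ### Structured programs -/

/-- Structured programs over atomic actions `A` and tests `T`. -/
inductive Prog (A T : Type) : Type
  | act (a : A) : Prog A T
  | seq (P Q : Prog A T) : Prog A T
  | ite (b : T) (P Q : Prog A T) : Prog A T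
  | loop (b : T) (P : Prog A T) : Prog A T

/-- The meaning of actions and tests on stores `S`, with a condition that has to hold after each
action. -/
structure Sem (A T S : Type) where
  op : A → S → S
  test : T → S → Bool
  guard : S → Prop

namespace Prog

variable {A T S : Type}

/-- `P.Exec m σ t σ'`: started in `σ`, the program `P` ends in `σ'` after `t` steps. -/
inductive Exec (m : Sem A T S) : Prog A T → S → ℕ → S → Prop
  | act {a σ} (h : m.guard (m.op a σ)) : Exec m (act a) σ 1 (m.op a σ)
  | seq {P Q σ t σ' t' σ''} (h : Exec m P σ t σ') (h' : Exec m Q σ' t' σ'') :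
      Exec m (seq P Q) σ (t + t') σ''
  | iteTrue {b P Q σ t σ'} (hb : m.test b σ = true) (h : Exec m P σ t σ') :
      Exec m (ite b P Q) σ (t + 1) σ'
  | iteFalse {b P Q σ t σ'} (hb : m.test b σ = false) (h : Exec m Q σ t σ') :
      Exec m (ite b P Q) σ (t + 1) σ'
  | loopFalse {b P σ} (hb : m.test b σ = false) : Exec m (loop b P) σ 1 σ
  | loopTrue {b P σ t σ' t' σ''} (hb : m.test b σ = true) (h : Exec m P σ t σ')
      (h' : Exec m (loop b P) σ' t' σ'') : Exec m (loop b P) σ (t + t' + 1) σ''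

/-! #### Control points -/

/-- The control points of a program. -/
def PC : Prog A T → Type
  | act _ => Unit
  | seq P Q => P.PC ⊕ Q.PC
  | ite _ P Q => Option (P.PC ⊕ Q.PC)
  | loop _ P => Option P.PC

theorem finite_PC : ∀ P : Prog A T, Finite P.PC
  | act _ => inferInstanceAs (Finite Unit)
  | seq P Q => by
      have := finite_PC P
      have := finite_PC Q
      exact inferInstanceAs (Finite (P.PC ⊕ Q.PC))
  | ite _ P Q => by
      have := finite_PC P
      have := finite_PC Q
      exact inferInstanceAs (Finite (Option (P.PC ⊕ Q.PC)))
  | loop _ P => by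
      have := finite_PC P
      exact inferInstanceAs (Finite (Option P.PC))

/-- The control point at which the execution of a program starts. -/
def entry : (P : Prog A T) → P.PC
  | act _ => ()
  | seq P _ => Sum.inl P.entry
  | ite _ _ _ => none
  | loop _ _ => none

/-- What is done at a control point, and where the execution continues; `none` is the exit. -/
inductive Node (A T X : Type) : Type
  | act (a : A) (next : Option X) : Node A T X
  | test (b : T) (yes no : Option X) : Node A T X

/-- Redirection of the continuations. -/
def Node.map {X Y : Type} (f : Option X → Option Y) : Node A T X → Node A T Y
  | .act a next => .act a (f next)
  | .test b yes no => .test b (f yes) (f no)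

/-- The continuation in a larger program of a part with the given exit. -/
def cont {X Y : Type} (g : X → Y) (exit : Option Y) : Option X → Option Y
  | some q => some (g q)
  | none => exit

/-- The flow chart of a program. -/
def node : (P : Prog A T) → P.PC → Node A T P.PC
  | act a, _ => .act a none
  | seq P Q, .inl q => (P.node q).map (cont Sum.inl (some (Sum.inr Q.entry)))
  | seq _ Q, .inr q => (Q.node q).map (cont Sum.inr none)
  | ite b P Q, none => .test b (some (some (.inl P.entry))) (some (some (.inr Q.entry)))
  | ite _ P _, some (.inl q) => (P.node q).map (cont (fun q => some (Sum.inl q)) none)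
  | ite _ _ Q, some (.inr q) => (Q.node q).map (cont (fun q => some (Sum.inr q)) none)
  | loop b P, none => .test b (some (some P.entry)) none
  | loop _ P, some q => (P.node q).map (cont some (some none))

/-- One step of a flow chart. -/
def Node.step {X : Type} (m : Sem A T S) : Node A T X → S → Option X × S
  | .act a next, σ => (next, m.op a σ)
  | .test b yes no, σ => (if m.test b σ then yes else no, σ)

theorem Node.step_map {X Y : Type} (m : Sem A T S) (f : Option X → Option Y) (n : Node A T X)
    (σ : S) : (n.map f).step m σ = (f (n.step m σ).1, (n.step m σ).2) := by
  cases n with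
  | act a next => rfl
  | test b yes no => simp only [Node.map, Node.step]; split <;> rfl

/-- The flow chart of `P` leads from the control point `q` and store `σ` to the exit
and `σ'` in `t` steps. -/
inductive Flow (m : Sem A T S) (P : Prog A T) : P.PC → S → ℕ → S → Prop
  | last {q σ σ'} (h : (P.node q).step m σ = (none, σ')) (hg : m.guard σ') : Flow m P q σ 1 σ'
  | more {q q' σ σ₁ t σ'} (h : (P.node q).step m σ = (some q', σ₁)) (hg : m.guard σ₁)
      (h' : Flow m P q' σ₁ t σ') : Flow m P q σ (t + 1) σ'

/-- A part whose exit is also the exit of the larger program runs inside it step for step; only the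
control points are renamed. -/
theorem Flow.lift {m : Sem A T S} {P Q : Prog A T} {g : P.PC → Q.PC}
    (hn : ∀ q, Q.node (g q) = (P.node q).map (cont g none)) {q σ t σ'}
    (h : Flow m P q σ t σ') : Flow m Q (g q) σ t σ' := by
  induction h with
  | last h hg => exact .last (by rw [hn, Node.step_map, h]; rfl) hg
  | more h hg _ ih => exact .more (by rw [hn, Node.step_map, h]; rfl) hg ih

/-- Here the exit of the part is redirected to `e`. Its last step becomes an ordinary step to `e`,
so nothing is added to the time. -/
theorem Flow.lift_append {m : Sem A T S} {P Q : Prog A T} {g : P.PC → Q.PC} {e : Q.PC}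
    (hn : ∀ q, Q.node (g q) = (P.node q).map (cont g (some e))) {q σ t σ' t' σ''}
    (h : Flow m P q σ t σ') (h' : Flow m Q e σ' t' σ'') : Flow m Q (g q) σ (t + t') σ'' := by
  induction h with
  | last h hg =>
    rw [Nat.add_comm]
    exact .more (by rw [hn, Node.step_map, h]; rfl) hg h'
  | more h hg _ ih =>
    rw [Nat.add_right_comm]
    exact .more (by rw [hn, Node.step_map, h]; rfl) hg (ih h')

/-- `Exec` checks the guard only after actions, `Flow` after tests too. Tests do not change the
store, so it is enough to have the guard at the start. -/
theorem Exec.flow {m : Sem A T S} {P : Prog A T} {σ t σ'} (h : Exec m P σ t σ')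
    (hg : m.guard σ) : Flow m P P.entry σ t σ' ∧ m.guard σ' := by
  induction h with
  | act h => exact ⟨.last rfl h, h⟩
  | seq _ _ ih ih' =>
    obtain ⟨f, hg₁⟩ := ih hg
    obtain ⟨f', hg₂⟩ := ih' hg₁
    exact ⟨f.lift_append (Q := Prog.seq _ _) (g := Sum.inl) (fun _ => rfl)
      (f'.lift (Q := Prog.seq _ _) (g := Sum.inr) (fun _ => rfl)), hg₂⟩
  | iteTrue hb _ ih =>
    obtain ⟨f, hg₁⟩ := ih hg
    exact ⟨.more (by simp only [entry, node, Node.step, hb]; rfl) hg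
      (f.lift (Q := ite _ _ _) (g := fun q => some (Sum.inl q)) (fun _ => rfl)), hg₁⟩
  | iteFalse hb _ ih =>
    obtain ⟨f, hg₁⟩ := ih hg
    exact ⟨.more (by simp only [entry, node, Node.step, hb]; rfl) hg
      (f.lift (Q := ite _ _ _) (g := fun q => some (Sum.inr q)) (fun _ => rfl)), hg₁⟩
  | loopFalse hb => exact ⟨.last (by simp only [entry, node, Node.step, hb]; rfl) hg, hg⟩
  | loopTrue hb _ _ ih ih' =>
    obtain ⟨f, hg₁⟩ := ih hg
    obtain ⟨f', hg₂⟩ := ih' hg₁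
    exact ⟨.more (by simp only [entry, node, Node.step, hb]; rfl) hg
      (f.lift_append (Q := loop _ _) (g := some) (fun _ => rfl) f'), hg₂⟩

/-! #### Executions with bounded loops -/

/-- A bound for the number of steps if no loop is iterated more than `N` times. -/
noncomputable def cost : Prog A T → Polynomial ℕ
  | act _ => 1
  | seq P Q => P.cost + Q.cost
  | ite _ P Q => P.cost + Q.cost + 1
  | loop _ P => (Polynomial.X + 1) * (P.cost + 1)

/-- `P` leads from `σ` to `σ'` with loops of at most `N` iterations. -/
def Runs (m : Sem A T S) (N : ℕ) (P : Prog A T) (σ σ' : S) : Prop :=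
  ∃ t ≤ P.cost.eval N, Exec m P σ t σ'

variable {m : Sem A T S} {N : ℕ} {P Q : Prog A T} {b : T} {σ σ' σ'' : S}

theorem Runs.from_eq {τ : S} (h : Runs m N P σ σ') (e : τ = σ) : Runs m N P τ σ' := e ▸ h

theorem Runs.to_eq {τ : S} (h : Runs m N P σ σ') (e : σ' = τ) : Runs m N P σ τ := e ▸ h

theorem Runs.act {a : A} (h : m.guard (m.op a σ)) : Runs m N (act a) σ (m.op a σ) :=
  ⟨1, by simp [cost], .act h⟩

theorem Runs.seq (h : Runs m N P σ σ') (h' : Runs m N Q σ' σ'') : Runs m N (seq P Q) σ σ'' := by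
  obtain ⟨t, ht, h⟩ := h
  obtain ⟨t', ht', h'⟩ := h'
  exact ⟨t + t', by simp only [cost, Polynomial.eval_add]; omega, .seq h h'⟩

theorem Runs.iteTrue (hb : m.test b σ = true) (h : Runs m N P σ σ') :
    Runs m N (ite b P Q) σ σ' := by
  obtain ⟨t, ht, h⟩ := h
  exact ⟨t + 1, by simp only [cost, Polynomial.eval_add, Polynomial.eval_one]; omega,
    .iteTrue hb h⟩

theorem Runs.iteFalse (hb : m.test b σ = false) (h : Runs m N Q σ σ') :
    Runs m N (ite b P Q) σ σ' := by
  obtain ⟨t, ht, h⟩ := h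
  exact ⟨t + 1, by simp only [cost, Polynomial.eval_add, Polynomial.eval_one]; omega,
    .iteFalse hb h⟩

/-- A loop that is iterated `n` times and passes through the stores `f 0, …, f n`. -/
theorem Runs.loop {f : ℕ → S} {n : ℕ} (hn : n ≤ N)
    (h : ∀ i < n, m.test b (f i) = true ∧ Runs m N P (f i) (f (i + 1)))
    (hb : m.test b (f n) = false) : Runs m N (loop b P) (f 0) (f n) := by
  -- Induction on the number `j` of iterations that remain, as `Exec.loopTrue` adds an iteration in
  -- front. Each one costs its body and a test; the final test accounts for the factor `X + 1` in
  -- `cost`.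
  suffices H : ∀ j ≤ n, ∃ t ≤ j * (P.cost.eval N + 1) + 1,
      Exec m (Prog.loop b P) (f (n - j)) t (f n) by
    obtain ⟨t, ht, H⟩ := H n le_rfl
    rw [Nat.sub_self] at H
    refine ⟨t, ht.trans ?_, H⟩
    simp only [cost, Polynomial.eval_mul, Polynomial.eval_add, Polynomial.eval_X,
      Polynomial.eval_one]
    nlinarith
  intro j
  induction j with
  | zero => exact fun _ => ⟨1, by omega, .loopFalse hb⟩
  | succ j ih =>
    intro hj
    obtain ⟨t', ht', h'⟩ := ih (by omega)
    obtain ⟨hb, t, ht, h⟩ := h (n - (j + 1)) (by omega)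
    rw [show n - (j + 1) + 1 = n - j by omega] at h
    exact ⟨t + t' + 1, by rw [Nat.succ_mul]; omega, .loopTrue hb h h'⟩

/-- A loop with an invariant that counts the iterations. -/
theorem Runs.loop_inv {I : ℕ → S → Prop} {n : ℕ} (hn : n ≤ N) (h0 : I 0 σ)
    (h : ∀ i < n, ∀ τ, I i τ → m.test b τ = true ∧ ∃ τ', Runs m N P τ τ' ∧ I (i + 1) τ')
    (hb : ∀ τ, I n τ → m.test b τ = false) : ∃ σ', Runs m N (Prog.loop b P) σ σ' ∧ I n σ' := by
  classical
  -- The invariant does not determine the stores, so a sequence of stores is selected by choice.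
  let f : ℕ → S := fun i => Nat.rec σ (fun i τ =>
    if H : ∃ τ', Runs m N P τ τ' ∧ I (i + 1) τ' then H.choose else τ) i
  have hs : ∀ i < n, I i (f i) → Runs m N P (f i) (f (i + 1)) ∧ I (i + 1) (f (i + 1)) := by
    intro i hi hI
    have H := (h i hi _ hI).2
    have : f (i + 1) = H.choose := dif_pos H
    rw [this]
    exact H.choose_spec
  have hI : ∀ i ≤ n, I i (f i) := by
    intro i
    induction i with
    | zero => exact fun _ => h0
    | succ i ih => exact fun hi => (hs i (by omega) (ih (by omega))).2
  exact ⟨f n, Runs.loop hn (fun i hi => ⟨(h i hi _ (hI i hi.le)).1, (hs i hi (hI i hi.le)).1⟩)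
    (hb _ (hI n le_rfl)), hI n le_rfl⟩

end Prog

/-! ### Structured programs as Turing machines -/

/-- The store of a Turing machine: a register in the finite control, the position of the input
head, and the work tapes. -/
@[ext]
structure TapeStore (R W : Type) (n : ℕ) : Type where
  reg : R
  ih : ℕ
  work : Fin n → ℤ → W
  head : Fin n → ℤ

/-- An instruction: depending on the register and the symbols that are read, the new contents of
the register, the movement of the input head, the symbols to be written, and the movements of the
heads. -/
abbrev TapeOp (α R W : Type) (n : ℕ) : Type :=
  R → InputSymbol α → (Fin n → W) → R × HeadMove × (Fin n → W) × (Fin n → HeadMove)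

/-- A test that depends on the register and the symbols that are read. -/
abbrev TapeTest (α R W : Type) (n : ℕ) : Type :=
  R → InputSymbol α → (Fin n → W) → Bool

open MultiTapeTM in
/-- The meaning of instructions and tests on input `x`, with the work heads kept at distance at
most `b` from their initial positions. -/
def tapeSem {α R W : Type} {n : ℕ} (x : List α) (b : ℕ) :
    Sem (TapeOp α R W n) (TapeTest α R W n) (TapeStore R W n) where
  op a σ :=
    let v := a σ.reg (readInput x σ.ih) (fun i => σ.work i (σ.head i))
    { reg := v.1
      ih := moveInput x v.2.1 σ.ih
      work := fun i => Function.update (σ.work i) (σ.head i) (v.2.2.1 i)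
      head := fun i => moveWork (v.2.2.2 i) (σ.head i) }
  test c σ := c σ.reg (readInput x σ.ih) (fun i => σ.work i (σ.head i))
  guard σ := ∀ i, |σ.head i| ≤ b

namespace Prog

variable {α R W : Type} {n : ℕ}

/-- The Turing machine that executes a program. -/
def toTM [Finite R] [Finite W] (P : Prog (TapeOp α R W n) (TapeTest α R W n)) (blank : W) (r : R)
    (acc : Set R) : MultiTapeTM α Empty where
  State := Option P.PC × R
  finite_state := by
    have := P.finite_PC
    infer_instance
  WorkSymbol := W
  finite_workSymbol := inferInstance
  blank := blank
  numTapes := n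
  start := (some P.entry, r)
  accepting := {q | q.2 ∈ acc}
  transition q s v :=
    match q with
    | (none, _) => none
    | (some q, r) =>
      match P.node q with
      | .act a next =>
        some ⟨(next, (a r s v).1), (a r s v).2.1, (a r s v).2.2.1, (a r s v).2.2.2, none⟩
      | .test c yes no =>
        some ⟨(if c r s v then yes else no, r), .stay, v, fun _ => .stay, none⟩

variable [Finite R] [Finite W]

/-- The configuration of the machine at a control point. -/
def toCfg (P : Prog (TapeOp α R W n) (TapeTest α R W n)) (blank : W) (r : R) (acc : Set R)
    (q : Option P.PC) (σ : TapeStore R W n) : (P.toTM blank r acc).Cfg :=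
  ⟨(q, σ.reg), σ.ih, σ.work, σ.head, []⟩

variable {P : Prog (TapeOp α R W n) (TapeTest α R W n)} {blank : W} {r : R} {acc : Set R}

theorem next_toCfg (x : List α) (b : ℕ) (q : P.PC) (σ : TapeStore R W n) :
    (P.toTM blank r acc).next x (P.toCfg blank r acc (some q) σ) =
      P.toCfg blank r acc ((P.node q).step (tapeSem x b) σ).1
        ((P.node q).step (tapeSem x b) σ).2 := by
  rcases h : P.node q with ⟨a, nx⟩ | ⟨c, yes, no⟩
  · simp [MultiTapeTM.next, MultiTapeTM.instruction, toTM, toCfg, h, Node.step,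
      MultiTapeTM.applyAction, tapeSem]
  · simp [MultiTapeTM.next, MultiTapeTM.instruction, toTM, toCfg, h, Node.step,
      MultiTapeTM.applyAction, tapeSem, MultiTapeTM.moveInput, MultiTapeTM.moveWork]

/-- The head positions at all intermediate times are recorded as well, because `cellsUsed` counts
every cell that was ever scanned. -/
theorem Flow.iterate {x : List α} {b : ℕ} {q : P.PC} {σ t σ'} (h : Flow (tapeSem x b) P q σ t σ')
    (hg : (tapeSem (α := α) x b).guard σ) :
    ((P.toTM blank r acc).next x)^[t] (P.toCfg blank r acc (some q) σ) =
      P.toCfg blank r acc none σ' ∧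
    ∀ s ≤ t, ∀ i, |((((P.toTM blank r acc).next x)^[s]
      (P.toCfg blank r acc (some q) σ)).workHead i : ℤ)| ≤ b := by
  induction h with
  | @last q σ σ' h hg' =>
    have h1 : (P.toTM blank r acc).next x (P.toCfg blank r acc (some q) σ) =
      P.toCfg blank r acc none σ' := by rw [next_toCfg x b, h]
    refine ⟨h1, fun s hs i => ?_⟩
    interval_cases s
    · exact hg i
    · rw [Function.iterate_one, h1]
      exact hg' i
  | @more q q' σ σ₁ t σ' h hg' h' ih =>
    have h1 : (P.toTM blank r acc).next x (P.toCfg blank r acc (some q) σ) =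
      P.toCfg blank r acc (some q') σ₁ := by rw [next_toCfg x b, h]
    obtain ⟨ih1, ih2⟩ := ih hg'
    refine ⟨by rw [Function.iterate_succ_apply, h1, ih1], fun s hs i => ?_⟩
    cases s with
    | zero => exact hg i
    | succ s =>
      rw [Function.iterate_succ_apply, h1]
      exact ih2 s (by omega) i

/-- The store in which a Turing machine starts. -/
def _root_.TapeStore.init (n : ℕ) (blank : W) (r : R) : TapeStore R W n :=
  ⟨r, 0, fun _ _ => blank, fun _ => 0⟩

theorem Exec.haltsWithin {x : List α} {b t T : ℕ} {σ'}
    (h : Exec (tapeSem x b) P (TapeStore.init n blank r) t σ') (ht : t ≤ T) :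
    (P.toTM blank r acc).HaltsWithin x T (2 * b + 1 : ℕ)
      (fun c => c.state ∈ (P.toTM blank r acc).accepting ↔ σ'.reg ∈ acc) := by
  have hg : (tapeSem (α := α) x b).guard (TapeStore.init n blank r) := by
    intro i
    simp [TapeStore.init]
  obtain ⟨h1, h2⟩ := (h.flow hg).1.iterate (blank := blank) (r := r) (acc := acc) hg
  have hc : (P.toTM blank r acc).config x t = P.toCfg blank r acc none σ' := h1
  refine ⟨t, ht, ?_, ?_, fun i => ?_⟩
  · rw [hc]; rfl
  · rw [hc]; rfl
  · refine Nat.cast_le.mpr ?_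
    -- All scanned cells lie between `-b` and `b`.
    have : (Finset.range (t + 1)).image (fun s => ((P.toTM blank r acc).config x s).workHead i) ⊆
        Finset.Icc (-(b : ℤ)) b := by
      intro z hz
      obtain ⟨s, hs, rfl⟩ := Finset.mem_image.mp hz
      exact Finset.mem_Icc.mpr (abs_le.mp (h2 s (by simpa [Nat.lt_succ_iff] using hs) i))
    refine (Finset.card_le_card this).trans ?_
    rw [Int.card_Icc]
    omega

end Prog

/-! ### Counters on work tapes -/

/-- The number with the given bijective binary digits, least significant first; `false` is the
digit one and `true` the digit two. -/
def digitsVal : List Bool → ℕ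
  | [] => 0
  | d :: ds => (bif d then 2 else 1) + 2 * digitsVal ds

/-- This is the advantage of bijective digits: zero is represented by the empty string only, so a
counter is tested for zero by looking at its initial cell. -/
theorem digitsVal_eq_zero {ds : List Bool} : digitsVal ds = 0 ↔ ds = [] := by
  cases ds with
  | nil => simp [digitsVal]
  | cons d ds => cases d <;> simp [digitsVal]

/-- Among strings of a given length the least value belongs to the one in which all digits are one.
-/
theorem two_pow_length_le_digitsVal (ds : List Bool) : 2 ^ ds.length ≤ digitsVal ds + 1 := by
  induction ds with
  | nil => simp [digitsVal]
  | cons d ds ih =>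
    cases d <;> simp only [digitsVal, List.length_cons, pow_succ, cond_true, cond_false] <;> omega

theorem length_le_log {ds : List Bool} {V : ℕ} (h : digitsVal ds ≤ V) :
    ds.length ≤ Nat.log 2 (V + 1) :=
  Nat.le_log_of_pow_le (by norm_num) ((two_pow_length_le_digitsVal ds).trans (by omega))

theorem length_le_digitsVal {ds : List Bool} : ds.length ≤ digitsVal ds := by
  have := two_pow_length_le_digitsVal ds
  have := Nat.lt_two_pow_self (n := ds.length)
  omega

section DigitTape

variable {Γ : Type} (bl : Γ)

/-- A work tape that holds a digit string from its initial position on. -/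
def digitTape (ds : List Bool) (z : ℤ) : Γ × Option Bool :=
  (bl, if z < 0 then none else ds[z.toNat]?)

theorem digitTape_append (pre rest : List Bool) :
    digitTape bl (pre ++ rest) pre.length = (bl, rest.head?) := by
  have : ¬ (pre.length : ℤ) < 0 := by omega
  simp [digitTape, this, List.head?_eq_getElem?, List.getElem?_append]

theorem digitTape_length (ds : List Bool) : digitTape bl ds ds.length = (bl, none) := by
  simpa using digitTape_append bl ds []

theorem digitTape_neg (ds : List Bool) : digitTape bl ds (-1) = (bl, none) := by
  simp [digitTape]

theorem digitTape_ne_none {ds : List Bool} {z : ℤ} (h0 : 0 ≤ z) (h : z < ds.length) :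
    (digitTape bl ds z).2 ≠ none := by
  have : z.toNat < ds.length := by omega
  simp [digitTape, not_lt.mpr h0, this]

theorem digitTape_fst (ds : List Bool) (z : ℤ) : (digitTape bl ds z).1 = bl := rfl

theorem update_digitTape (pre rest : List Bool) (d d' : Bool) :
    Function.update (digitTape bl (pre ++ d :: rest)) pre.length (bl, some d') =
      digitTape bl (pre ++ d' :: rest) := by
  funext z
  by_cases hz : z = pre.length
  · subst hz
    rw [Function.update_self, digitTape_append]
    rfl
  · rw [Function.update_of_ne hz]
    by_cases h : z < 0
    · simp [digitTape, h]
    · lift z to ℕ using not_lt.mp h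
      have : z ≠ pre.length := fun h => hz (by rw [h])
      simp only [digitTape, h, if_false, Int.toNat_natCast, Prod.mk.injEq, true_and]
      rw [List.getElem?_append, List.getElem?_append]
      split
      · rfl
      · obtain ⟨m, hm⟩ : ∃ m, z - pre.length = m + 1 := ⟨z - pre.length - 1, by omega⟩
        rw [hm, List.getElem?_cons_succ, List.getElem?_cons_succ]

theorem update_digitTape_concat (pre : List Bool) (d : Bool) :
    Function.update (digitTape bl pre) pre.length (bl, some d) = digitTape bl (pre ++ [d]) := by
  funext z
  by_cases hz : z = pre.length
  · subst hz
    rw [Function.update_self, digitTape_append]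
    rfl
  · rw [Function.update_of_ne hz]
    by_cases h : z < 0
    · simp [digitTape, h]
    · lift z to ℕ using not_lt.mp h
      have : z ≠ pre.length := fun h => hz (by rw [h])
      simp only [digitTape, h, if_false, Int.toNat_natCast, Prod.mk.injEq, true_and]
      rw [List.getElem?_append]
      split
      · rfl
      · rw [List.getElem?_eq_none (by omega), List.getElem?_eq_none]
        simp only [List.length_singleton]
        omega

theorem update_digitTape_dropLast (pre : List Bool) (d : Bool) :
    Function.update (digitTape bl (pre ++ [d])) pre.length (bl, none) = digitTape bl pre := by
  rw [← update_digitTape_concat, Function.update_idem, Function.update_eq_self_iff]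
  have := digitTape_append bl pre []
  rw [List.append_nil] at this
  rw [this]
  rfl

end DigitTape

namespace TapeStore

variable {α R W : Type} {n : ℕ}

/-- Replacement of one work tape and the position of its head. -/
def setTape (σ : TapeStore R W n) (j : Fin n) (τ : ℤ → W) (h : ℤ) : TapeStore R W n :=
  { σ with work := Function.update σ.work j τ, head := Function.update σ.head j h }

theorem guard_setTape {x : List α} {b : ℕ} {σ : TapeStore R W n}
    (hg : (tapeSem (α := α) x b).guard σ) {j : Fin n} {τ : ℤ → W} {h : ℤ} (h1 : -b ≤ h)
    (h2 : h ≤ b) : (tapeSem (α := α) x b).guard (σ.setTape j τ h) := by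
  intro i
  by_cases hi : i = j
  · subst hi
    simpa [setTape] using abs_le.mpr ⟨h1, h2⟩
  · simpa [setTape, hi] using hg i

end TapeStore

section CounterPrograms

variable {α R Γ : Type} {n : ℕ} (j : Fin n)

/-- Write to a single tape and move its head. -/
def digitOp (f : Option Bool → Option Bool) (mv : HeadMove) : TapeOp α R (Γ × Option Bool) n :=
  fun r _ v => (r, .stay, Function.update v j ((v j).1, f (v j).2),
    Function.update (fun _ => .stay) j mv)

/-- Test the symbol on a single tape. -/
def digitTest (g : Option Bool → Bool) : TapeTest α R (Γ × Option Bool) n :=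
  fun _ _ v => g (v j).2

/-- Return to the initial position of a tape that holds a digit string. -/
def rewindProg : Prog (TapeOp α R (Γ × Option Bool) n) (TapeTest α R (Γ × Option Bool) n) :=
  .seq (.loop (digitTest j Option.isSome) (.act (digitOp j id .left))) (.act (digitOp j id .right))

/-- Add one to a counter. -/
def incProg : Prog (TapeOp α R (Γ × Option Bool) n) (TapeTest α R (Γ × Option Bool) n) :=
  .seq (.loop (digitTest j (· = some true)) (.act (digitOp j (fun _ => some false) .right)))
    (.seq (.act (digitOp j (fun d => some d.isSome) .left)) (rewindProg j))

/-- Subtract one from a counter that is not zero. -/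
def decProg : Prog (TapeOp α R (Γ × Option Bool) n) (TapeTest α R (Γ × Option Bool) n) :=
  .ite (digitTest j Option.isNone) (.act (digitOp j id .stay))
    (.seq (.loop (digitTest j (· = some false)) (.act (digitOp j (fun _ => some true) .right)))
      (.seq (.ite (digitTest j Option.isNone)
          (.seq (.act (digitOp j id .left)) (.act (digitOp j (fun _ => none) .left)))
          (.act (digitOp j (fun _ => some false) .left)))
        (rewindProg j)))

variable {j} {x : List α} {b : ℕ} {σ : TapeStore R (Γ × Option Bool) n} {bl : Γ}

theorem op_digitOp (f : Option Bool → Option Bool) (mv : HeadMove) (τ : ℤ → Γ × Option Bool)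
    (h : ℤ) : (tapeSem (α := α) x b).op (digitOp j f mv) (σ.setTape j τ h) =
      σ.setTape j (Function.update τ h ((τ h).1, f (τ h).2)) (MultiTapeTM.moveWork mv h) := by
  refine TapeStore.ext rfl rfl (funext fun i => ?_) (funext fun i => ?_)
  · by_cases hi : i = j
    · subst hi
      simp [tapeSem, digitOp, TapeStore.setTape]
    · simp [tapeSem, digitOp, TapeStore.setTape, hi]
  · by_cases hi : i = j
    · subst hi
      simp [tapeSem, digitOp, TapeStore.setTape]
    · simp [tapeSem, digitOp, TapeStore.setTape, hi, MultiTapeTM.moveWork]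

theorem test_digitTest (g : Option Bool → Bool) (τ : ℤ → Γ × Option Bool) (h : ℤ) :
    (tapeSem (α := α) x b).test (digitTest j g) (σ.setTape j τ h) = g (τ h).2 := by
  simp [tapeSem, digitTest, TapeStore.setTape]

theorem exec_digitOp (hg : (tapeSem (α := α) x b).guard σ) {f : Option Bool → Option Bool}
    {mv : HeadMove} {τ τ' : ℤ → Γ × Option Bool} {h h' : ℤ}
    (hτ : Function.update τ h ((τ h).1, f (τ h).2) = τ') (hh : MultiTapeTM.moveWork mv h = h')
    (h1 : -b ≤ h') (h2 : h' ≤ b) :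
    Prog.Exec (tapeSem (α := α) x b) (.act (digitOp j f mv)) (σ.setTape j τ h) 1
      (σ.setTape j τ' h') := by
  have := op_digitOp (x := x) (b := b) (σ := σ) (j := j) f mv τ h
  rw [hτ, hh] at this
  rw [← this]
  refine .act ?_
  rw [this]
  exact TapeStore.guard_setTape hg h1 h2

/-- The loop runs to the blank cell `-1`, where the head may already be if `m = 0`; the final action
returns to `0`. -/
theorem exec_rewindProg (hg : (tapeSem (α := α) x b).guard σ) (hb : 1 ≤ b) (ds : List Bool)
    (m : ℕ) (hm : m ≤ ds.length) (hm' : m ≤ b) :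
    Prog.Exec (tapeSem (α := α) x b) (rewindProg j)
      (σ.setTape j (digitTape bl ds) (m - 1 : ℤ)) (2 * m + 2)
      (σ.setTape j (digitTape bl ds) 0) := by
  have key : Prog.Exec (tapeSem (α := α) x b)
      (.loop (digitTest j Option.isSome) (.act (digitOp j id .left)))
      (σ.setTape j (digitTape bl ds) (m - 1 : ℤ)) (2 * m + 1)
      (σ.setTape j (digitTape bl ds) (-1)) := by
    induction m with
    | zero =>
      refine .loopFalse ?_
      rw [test_digitTest, Nat.cast_zero, zero_sub, digitTape_neg]
      rfl
    | succ m ih =>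
      have h1 : Prog.Exec (tapeSem (α := α) x b) (.act (digitOp j id .left))
          (σ.setTape j (digitTape bl ds) ((m + 1 : ℕ) - 1 : ℤ)) 1
          (σ.setTape j (digitTape bl ds) (m - 1 : ℤ)) :=
        exec_digitOp hg (by simp) (by simp [MultiTapeTM.moveWork]) (by omega) (by omega)
      have := Prog.Exec.loopTrue (b := digitTest j Option.isSome) (by
        rw [test_digitTest, Option.isSome_iff_ne_none]
        exact digitTape_ne_none bl (by omega) (by omega)) h1 (ih (by omega) (by omega))
      rwa [show 1 + (2 * m + 1) + 1 = 2 * (m + 1) + 1 by ring] at this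
  exact key.seq (exec_digitOp (h' := 0) hg (by simp) rfl (by omega) (by omega))

/-- Adding one turns a digit two into a one with a carry, as `2 + 1 = 1 + 2 * 1`. The loop does this
to the initial run of twos, which becomes `mid`, and thereby reduces the task to adding one to
`rest`, which is empty or begins with a one. -/
theorem exec_inc_loop (hg : (tapeSem (α := α) x b).guard σ) (ds : List Bool) :
    ∀ pre : List Bool, pre.length + ds.length ≤ b → ∃ mid rest, rest.head? ≠ some true ∧
      mid.length + rest.length = ds.length ∧
      (∀ rest', digitsVal rest' = digitsVal rest + 1 →
        digitsVal (mid ++ rest') = digitsVal ds + 1) ∧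
      ∃ t ≤ 2 * ds.length + 1, Prog.Exec (tapeSem (α := α) x b)
        (.loop (digitTest j (· = some true)) (.act (digitOp j (fun _ => some false) .right)))
        (σ.setTape j (digitTape bl (pre ++ ds)) pre.length) t
        (σ.setTape j (digitTape bl (pre ++ mid ++ rest)) (pre ++ mid).length) := by
  induction ds with
  | nil =>
    intro pre _
    refine ⟨[], [], by simp, rfl, by simp, 1, by simp, ?_⟩
    rw [List.append_nil, List.append_nil]
    refine .loopFalse ?_
    rw [test_digitTest, digitTape_length]
    rfl
  | cons d ds ih =>
    intro pre hpre
    rw [List.length_cons] at hpre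
    cases d with
    | false =>
      refine ⟨[], false :: ds, by simp, by simp, by simp, 1, by simp, ?_⟩
      rw [List.append_nil]
      refine .loopFalse ?_
      rw [test_digitTest, digitTape_append]
      rfl
    | true =>
      obtain ⟨mid, rest, h1, h2, h3, t, ht, h⟩ := ih (pre ++ [false]) (by simp; omega)
      refine ⟨false :: mid, rest, h1, by simp; omega, fun rest' hr => ?_, 1 + t + 1, by simp; omega,
        .loopTrue (by rw [test_digitTest, digitTape_append]; rfl)
          (exec_digitOp (h' := (pre ++ [false]).length) hg rfl (by simp [MultiTapeTM.moveWork])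
            (by omega) (by simp; omega)) ?_⟩
      · simp only [List.cons_append, digitsVal, h3 rest' hr, cond_true, cond_false]
        omega
      · rw [digitTape_fst, update_digitTape]
        simpa using h

theorem exec_incProg (hg : (tapeSem (α := α) x b).guard σ) (hb : 1 ≤ b) (ds : List Bool)
    (hds : ds.length + 1 ≤ b) : ∃ ds', digitsVal ds' = digitsVal ds + 1 ∧
      ∃ t ≤ 4 * ds.length + 8, Prog.Exec (tapeSem (α := α) x b) (incProg j)
        (σ.setTape j (digitTape bl ds) 0) t (σ.setTape j (digitTape bl ds') 0) := by
  obtain ⟨mid, rest, h1, h2, h3, t, ht, h⟩ :=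
    exec_inc_loop (bl := bl) (j := j) hg ds [] (by simp; omega)
  simp only [List.nil_append, List.length_nil, Nat.cast_zero] at h
  -- Writing `some d.isSome` appends a new digit one at the end of the string and turns a digit one
  -- into a two.
  suffices H : ∃ d ds', digitsVal (d :: ds') = digitsVal rest + 1 ∧
      Function.update (digitTape bl (mid ++ rest)) mid.length
        ((digitTape bl (mid ++ rest) mid.length).1,
          some (digitTape bl (mid ++ rest) mid.length).2.isSome) =
        digitTape bl (mid ++ d :: ds') by
    obtain ⟨d, ds', hv, hu⟩ := H
    refine ⟨mid ++ d :: ds', h3 _ hv, t + (1 + (2 * mid.length + 2)), by omega, .seq h (.seq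
      (exec_digitOp (h' := (mid.length - 1 : ℤ)) hg hu rfl (by omega) (by omega))
      (exec_rewindProg hg hb _ _ (by simp) (by omega)))⟩
  rw [digitTape_append]
  match rest with
  | [] => exact ⟨false, [], by simp [digitsVal], by
      rw [List.append_nil]; exact update_digitTape_concat ..⟩
  | false :: ds' => exact ⟨true, ds', by simp [digitsVal]; omega, update_digitTape ..⟩
  | true :: ds' => simp at h1

/-- Subtracting one turns a digit one into a two with a borrow, as `1 - 1 = 2 - 2 * 1`. The loop
does this to the initial run of ones. If the whole string consists of `n` ones, there is nothing to
borrow from; its value `2 ^ n - 1` has to become `2 ^ n - 2`, which is written with `n - 1` twos, so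
the last digit is dropped. -/
theorem exec_dec_loop (hg : (tapeSem (α := α) x b).guard σ) (ds : List Bool) :
    ∀ pre : List Bool, pre.length + ds.length ≤ b → ∃ mid rest, rest.head? ≠ some false ∧
      mid.length + rest.length = ds.length ∧
      (∀ rest', digitsVal rest' + 1 = digitsVal rest →
        digitsVal (mid ++ rest') + 1 = digitsVal ds) ∧
      (rest = [] → ds ≠ [] → digitsVal mid.dropLast + 1 = digitsVal ds) ∧
      ∃ t ≤ 2 * ds.length + 1, Prog.Exec (tapeSem (α := α) x b)
        (.loop (digitTest j (· = some false)) (.act (digitOp j (fun _ => some true) .right)))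
        (σ.setTape j (digitTape bl (pre ++ ds)) pre.length) t
        (σ.setTape j (digitTape bl (pre ++ mid ++ rest)) (pre ++ mid).length) := by
  induction ds with
  | nil =>
    intro pre _
    refine ⟨[], [], by simp, rfl, by simp, by simp, 1, by simp, ?_⟩
    rw [List.append_nil, List.append_nil]
    refine .loopFalse ?_
    rw [test_digitTest, digitTape_length]
    rfl
  | cons d ds ih =>
    intro pre hpre
    rw [List.length_cons] at hpre
    cases d with
    | true =>
      refine ⟨[], true :: ds, by simp, by simp, by simp, by simp, 1, by simp, ?_⟩
      rw [List.append_nil]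
      refine .loopFalse ?_
      rw [test_digitTest, digitTape_append]
      rfl
    | false =>
      obtain ⟨mid, rest, h1, h2, h3, h4, t, ht, h⟩ := ih (pre ++ [true]) (by simp; omega)
      refine ⟨true :: mid, rest, h1, by simp; omega, fun rest' hr => ?_, fun hr _ => ?_,
        1 + t + 1, by simp; omega,
        .loopTrue (by rw [test_digitTest, digitTape_append]; rfl)
          (exec_digitOp (h' := (pre ++ [true]).length) hg rfl (by simp [MultiTapeTM.moveWork])
            (by omega) (by simp; omega)) ?_⟩
      · have := h3 rest' hr
        simp only [List.cons_append, digitsVal, cond_true, cond_false]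
        omega
      · rcases ds with _ | ⟨e, ds⟩
        · have : mid = [] := List.length_eq_zero_iff.mp (by rw [List.length_nil] at h2; omega)
          subst this
          simp [digitsVal]
        · have hm : mid ≠ [] := by
            rintro rfl
            subst hr
            simp at h2
          have := h4 hr (by simp)
          rw [List.dropLast_cons_of_ne_nil hm]
          simp only [digitsVal, cond_true, cond_false] at this ⊢
          omega
      · rw [digitTape_fst, update_digitTape]
        simpa using h

theorem exec_decProg (hg : (tapeSem (α := α) x b).guard σ) (hb : 1 ≤ b) (ds : List Bool)
    (hds : ds.length ≤ b) : ∃ ds', digitsVal ds' = digitsVal ds - 1 ∧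
      ∃ t ≤ 4 * ds.length + 12, Prog.Exec (tapeSem (α := α) x b) (decProg j)
        (σ.setTape j (digitTape bl ds) 0) t (σ.setTape j (digitTape bl ds') 0) := by
  rcases eq_or_ne ds [] with rfl | hne
  · refine ⟨[], rfl, 2, by simp, .iteTrue ?_ (exec_digitOp hg (by simp) rfl (by omega) (by omega))⟩
    rw [test_digitTest]
    rfl
  have hpos : 0 < digitsVal ds := Nat.pos_of_ne_zero fun h => hne (digitsVal_eq_zero.mp h)
  have htest : (tapeSem (α := α) x b).test (digitTest j Option.isNone)
      (σ.setTape j (digitTape bl ds) 0) = false := by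
    have := digitTape_ne_none bl (ds := ds) le_rfl (by
      have := List.length_pos_of_ne_nil hne
      omega)
    rw [test_digitTest]
    simpa [← Option.ne_none_iff_isSome] using this
  obtain ⟨mid, rest, h1, h2, h3, h4, t, ht, h⟩ :=
    exec_dec_loop (bl := bl) (j := j) hg ds [] (by simp; omega)
  simp only [List.nil_append, List.length_nil, Nat.cast_zero] at h
  match rest with
  | false :: ds' => simp at h1
  | true :: ds' =>
    refine ⟨mid ++ false :: ds', ?_, t + (1 + 1 + (2 * mid.length + 2)) + 1, ?_,
      .iteFalse htest (.seq h (.seq (.iteFalse ?_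
        (exec_digitOp (h' := (mid.length - 1 : ℤ)) hg rfl rfl (by omega) ?_)) ?_))⟩
    · have := h3 (false :: ds') (by simp [digitsVal]; omega)
      omega
    · simp at h2
      omega
    · rw [test_digitTest, digitTape_append]
      rfl
    · simp at h2
      omega
    · rw [digitTape_append, update_digitTape]
      simp at h2
      exact exec_rewindProg hg hb _ _ (by simp) (by omega)
  | [] =>
    have hm : mid ≠ [] := by
      rintro rfl
      simp only [List.length_nil, Nat.add_zero] at h2
      exact hne (List.length_eq_zero_iff.mp h2.symm)
    have h4 := h4 rfl hne
    obtain ⟨mid', d, rfl⟩ : ∃ mid' d, mid = mid' ++ [d] :=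
      ⟨_, _, (List.dropLast_append_getLast hm).symm⟩
    simp only [List.dropLast_concat, List.append_nil, List.length_append, List.length_singleton,
      List.length_nil, Nat.add_zero] at h4 h h2
    -- The head is on the blank behind the digits: it goes back one cell, erases the last digit, and
    -- rewinds.
    refine ⟨mid', by omega, t + (1 + 1 + 1 + (2 * mid'.length + 2)) + 1, by omega,
      .iteFalse htest (.seq h (.seq (.iteTrue ?_ (.seq
        (exec_digitOp (h' := (mid'.length : ℤ)) hg (by simp; rfl) (by simp [MultiTapeTM.moveWork])
          (by omega) (by omega))
        (exec_digitOp (h' := (mid'.length - 1 : ℤ)) hg rfl rfl (by omega) (by omega)))) ?_))⟩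
    · have := digitTape_length bl (mid' ++ [d])
      rw [List.length_append, List.length_singleton] at this
      rw [test_digitTest, this]
      rfl
    · rw [digitTape_fst, update_digitTape_dropLast]
      exact exec_rewindProg hg hb _ _ le_rfl (by omega)

end CounterPrograms

/-! ### Machines with counters -/

/-- The store of a machine with a register, counters indexed by `ι`, a read-only input tape and
`k` work tapes. -/
@[ext]
structure CounterStore (R Γ ι : Type) (k : ℕ) : Type where
  reg : R
  ctr : ι → ℕ
  ih : ℕ
  tape : Fin k → ℤ → Γ
  thead : Fin k → ℤ

/-- The instructions of a machine with counters. The last kind may depend on the register, the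
input symbol, the set of counters that are zero, and the symbols read on the work tapes. -/
inductive CounterOp (α R Γ ι : Type) (k : ℕ) : Type
  | inc (c : ι) : CounterOp α R Γ ι k
  | dec (c : ι) : CounterOp α R Γ ι k
  | act (f : R → InputSymbol α → (ι → Bool) → (Fin k → Γ) →
      R × HeadMove × (Fin k → Γ) × (Fin k → HeadMove)) : CounterOp α R Γ ι k

/-- Tests depend on the register and on the set of counters that are zero. -/
abbrev CounterTest (R ι : Type) : Type := R → (ι → Bool) → Bool

/-- Programs of machines with counters. -/
abbrev CounterProg (α R Γ ι : Type) (k : ℕ) : Type :=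
  Prog (CounterOp α R Γ ι k) (CounterTest R ι)

section

variable {α R Γ ι : Type} {k n : ℕ} [DecidableEq ι]

open MultiTapeTM in
/-- The meaning of the instructions and tests on input `x`, with the work heads kept at distance
at most `b` from their initial positions. -/
def counterSem (x : List α) (b : ℕ) :
    Sem (CounterOp α R Γ ι k) (CounterTest R ι) (CounterStore R Γ ι k) where
  op a σ :=
    match a with
    | .inc c => { σ with ctr := Function.update σ.ctr c (σ.ctr c + 1) }
    | .dec c => { σ with ctr := Function.update σ.ctr c (σ.ctr c - 1) }
    | .act f =>
      let v := f σ.reg (readInput x σ.ih) (fun c => decide (σ.ctr c = 0))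
        (fun i => σ.tape i (σ.thead i))
      { σ with
        reg := v.1
        ih := moveInput x v.2.1 σ.ih
        tape := fun i => Function.update (σ.tape i) (σ.thead i) (v.2.2.1 i)
        thead := fun i => moveWork (v.2.2.2 i) (σ.thead i) }
  test t σ := t σ.reg (fun c => decide (σ.ctr c = 0))
  guard σ := ∀ i, |σ.thead i| ≤ b

/-- A bound for the running time thus bounds all counters, and by `length_le_log` the space for
their digits is logarithmic in it. -/
theorem counterSem_ctr_le {x : List α} {b : ℕ} {P : CounterProg α R Γ ι k}
    {σ σ' : CounterStore R Γ ι k} {t : ℕ} (h : Prog.Exec (counterSem x b) P σ t σ') (c : ι) :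
    σ'.ctr c ≤ σ.ctr c + t := by
  induction h with
  | @act a σ h =>
    cases a with
    | inc d =>
      by_cases hd : c = d
      · subst hd; simp [counterSem]
      · simp [counterSem, hd]
    | dec d =>
      by_cases hd : c = d
      · subst hd; simp [counterSem]; omega
      · simp [counterSem, hd]
    | act f => simp [counterSem]
  | seq _ _ ih ih' => omega
  | iteTrue _ _ ih => omega
  | iteFalse _ _ ih => omega
  | loopFalse => omega
  | loopTrue _ _ _ ih ih' => omega

/-- Implementation with counters on work tapes. -/
def CounterOp.compile (e : Fin k ⊕ ι ≃ Fin n) :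
    CounterOp α R Γ ι k → Prog (TapeOp α R (Γ × Option Bool) n) (TapeTest α R (Γ × Option Bool) n)
  | .inc c => incProg (e (.inr c))
  | .dec c => decProg (e (.inr c))
  | .act f => .act fun r s v =>
      let u := f r s (fun c => (v (e (.inr c))).2.isNone) (fun j => (v (e (.inl j))).1)
      (u.1, u.2.1,
        fun i => Sum.elim (fun j => (u.2.2.1 j, none)) (fun _ => v i) (e.symm i),
        fun i => Sum.elim u.2.2.2 (fun _ => .stay) (e.symm i))

/-- Implementation of tests. -/
def compileTest (e : Fin k ⊕ ι ≃ Fin n) (t : CounterTest R ι) :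
    TapeTest α R (Γ × Option Bool) n :=
  fun r _ v => t r (fun c => (v (e (.inr c))).2.isNone)

/-- Implementation of programs with counters on work tapes. -/
def Prog.compile (e : Fin k ⊕ ι ≃ Fin n) :
    CounterProg α R Γ ι k → Prog (TapeOp α R (Γ × Option Bool) n) (TapeTest α R (Γ × Option Bool) n)
  | .act a => a.compile e
  | .seq P Q => .seq (P.compile e) (Q.compile e)
  | .ite t P Q => .ite (compileTest e t) (P.compile e) (Q.compile e)
  | .loop t P => .loop (compileTest e t) (P.compile e)

/-- The representation of a store with the given digit strings for the counters. -/
def CounterStore.toTape (e : Fin k ⊕ ι ≃ Fin n) (bl : Γ) (σ : CounterStore R Γ ι k)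
    (dss : ι → List Bool) : TapeStore R (Γ × Option Bool) n where
  reg := σ.reg
  ih := σ.ih
  work i := Sum.elim (fun j z => (σ.tape j z, none)) (fun c => digitTape bl (dss c)) (e.symm i)
  head i := Sum.elim σ.thead (fun _ => 0) (e.symm i)

variable {e : Fin k ⊕ ι ≃ Fin n} {bl : Γ} {σ : CounterStore R Γ ι k} {dss : ι → List Bool}
  {x : List α} {b : ℕ}

theorem toTape_setTape (c : ι) (ds : List Bool) (v : ℕ) :
    (σ.toTape e bl dss).setTape (e (.inr c)) (digitTape bl ds) 0 =
      CounterStore.toTape e bl { σ with ctr := Function.update σ.ctr c v }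
        (Function.update dss c ds) := by
  refine TapeStore.ext rfl rfl (funext fun i => ?_) (funext fun i => ?_)
  all_goals
    obtain ⟨i, rfl⟩ := e.surjective i
    rcases i with j | d
    · simp [CounterStore.toTape, TapeStore.setTape]
    · by_cases hd : d = c
      · subst hd; simp [CounterStore.toTape, TapeStore.setTape]
      · simp [CounterStore.toTape, TapeStore.setTape, hd]

theorem isNone_digitTape_zero (ds : List Bool) :
    (digitTape bl ds 0).2.isNone = decide (digitsVal ds = 0) := by
  rw [Bool.eq_iff_iff, decide_eq_true_iff, digitsVal_eq_zero]
  cases ds <;> simp [digitTape]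

omit [DecidableEq ι] in
theorem toTape_flags (hv : ∀ c, digitsVal (dss c) = σ.ctr c) (c : ι) :
    (((σ.toTape e bl dss).work (e (.inr c)) ((σ.toTape e bl dss).head (e (.inr c)))).2.isNone) =
      decide (σ.ctr c = 0) := by
  simp [CounterStore.toTape, isNone_digitTape_zero, hv]

theorem test_compileTest (hv : ∀ c, digitsVal (dss c) = σ.ctr c) (t : CounterTest R ι) :
    (tapeSem x b).test (compileTest e t) (σ.toTape e bl dss) = (counterSem x b).test t σ := by
  simp only [tapeSem, compileTest, counterSem, toTape_flags hv]
  rfl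

theorem toTape_act (hv : ∀ c, digitsVal (dss c) = σ.ctr c)
    (f : R → InputSymbol α → (ι → Bool) → (Fin k → Γ) →
      R × HeadMove × (Fin k → Γ) × (Fin k → HeadMove)) (a : TapeOp α R (Γ × Option Bool) n)
    (ha : (CounterOp.act f).compile e = .act a) :
    (tapeSem x b).op a (σ.toTape e bl dss) =
      ((counterSem x b).op (.act f) σ).toTape e bl dss := by
  cases ha
  refine TapeStore.ext ?_ ?_ (funext fun i => ?_) (funext fun i => ?_)
  · simp only [tapeSem, counterSem, toTape_flags hv]
    simp [CounterStore.toTape]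
  · simp only [tapeSem, counterSem, toTape_flags hv]
    simp [CounterStore.toTape]
  · obtain ⟨i, rfl⟩ := e.surjective i
    simp only [tapeSem, counterSem, toTape_flags hv]
    rcases i with j | d
    · funext z
      by_cases hz : z = σ.thead j
      · subst hz
        simp only [CounterStore.toTape]
        rw [Equiv.symm_apply_apply]
        simp
      · simp [CounterStore.toTape, hz]
    · simp [CounterStore.toTape]
  · obtain ⟨i, rfl⟩ := e.surjective i
    simp only [tapeSem, counterSem, toTape_flags hv]
    rcases i with j | d
    · simp [CounterStore.toTape]
    · simp [CounterStore.toTape, MultiTapeTM.moveWork]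

theorem guard_toTape : (tapeSem (α := α) x b).guard (σ.toTape e bl dss) ↔
    (counterSem (α := α) x b).guard σ := by
  constructor
  · intro h j
    simpa [CounterStore.toTape] using h (e (.inl j))
  · intro h i
    obtain ⟨i, rfl⟩ := e.surjective i
    rcases i with j | c
    · simpa [CounterStore.toTape] using h j
    · simp [CounterStore.toTape]

/-- The time that remains is part of `hV`, so `V` bounds the counters throughout. It enters the
space only through its logarithm. For the time the crude estimate `length_le_digitsVal` is enough:
an increment or decrement takes at most `4 * V + 12` steps. -/
theorem Prog.Exec.compile {P : CounterProg α R Γ ι k} {σ' : CounterStore R Γ ι k} {t V : ℕ}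
    (h : Prog.Exec (counterSem x b) P σ t σ') (hV : ∀ c, σ.ctr c + t ≤ V)
    (hb : Nat.log 2 (V + 1) + 1 ≤ b) (hg : (counterSem (α := α) x b).guard σ)
    (hv : ∀ c, digitsVal (dss c) = σ.ctr c) :
    ∃ dss' : ι → List Bool, (∀ c, digitsVal (dss' c) = σ'.ctr c) ∧
      ∃ t' ≤ t * (4 * V + 13), Prog.Exec (tapeSem x b) (P.compile e) (σ.toTape e bl dss) t'
        (σ'.toTape e bl dss') := by
  induction h generalizing dss with
  | @act a σ h =>
    have hself : ∀ c, σ.toTape e bl dss =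
        (σ.toTape e bl dss).setTape (e (.inr c)) (digitTape bl (dss c)) 0 := by
      intro c
      rw [toTape_setTape c (dss c) (σ.ctr c)]
      simp
    have hlen : ∀ c, (dss c).length + 1 ≤ b := fun c =>
      (Nat.add_le_add_right (length_le_log (hv c ▸ (Nat.le_add_right _ _).trans (hV c))) 1).trans hb
    have hlen' : ∀ c, (dss c).length ≤ V := fun c =>
      length_le_digitsVal.trans (hv c ▸ (Nat.le_add_right _ _).trans (hV c))
    cases a with
    | inc c =>
      obtain ⟨ds', hds, t, ht, hE⟩ := exec_incProg (j := e (.inr c)) (bl := bl)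
        (guard_toTape.mpr hg) (by omega) (dss c) (hlen c)
      rw [← hself, toTape_setTape c ds' (σ.ctr c + 1)] at hE
      refine ⟨Function.update dss c ds', fun d => ?_, t, by have := hlen' c; omega, hE⟩
      by_cases hd : d = c
      · subst hd; simp [counterSem, hds, hv]
      · simp [counterSem, hd, hv]
    | dec c =>
      obtain ⟨ds', hds, t, ht, hE⟩ := exec_decProg (j := e (.inr c)) (bl := bl)
        (guard_toTape.mpr hg) (by omega) (dss c) (by have := hlen c; omega)
      rw [← hself, toTape_setTape c ds' (σ.ctr c - 1)] at hE
      refine ⟨Function.update dss c ds', fun d => ?_, t, by have := hlen' c; omega, hE⟩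
      by_cases hd : d = c
      · subst hd; simp [counterSem, hds, hv]
      · simp [counterSem, hd, hv]
    | act f =>
      refine ⟨dss, hv, 1, by omega, ?_⟩
      rw [← toTape_act hv f _ rfl]
      refine .act ?_
      rw [toTape_act hv f _ rfl]
      exact guard_toTape.mpr h
  | @seq P Q σ t σ' t' σ'' h h' ih ih' =>
    obtain ⟨dss₁, hv₁, s, hs, hE⟩ := ih (fun c => by have := hV c; omega) hg hv
    obtain ⟨dss₂, hv₂, s', hs', hE'⟩ := ih' (fun c => by
      have := hV c
      have := counterSem_ctr_le h c
      omega) (h.flow hg).2 hv₁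
    exact ⟨dss₂, hv₂, s + s', by rw [Nat.add_mul]; omega, .seq hE hE'⟩
  | iteTrue htest h ih =>
    obtain ⟨dss₁, hv₁, s, hs, hE⟩ := ih (fun c => by have := hV c; omega) hg hv
    exact ⟨dss₁, hv₁, s + 1, by rw [Nat.add_mul]; omega,
      .iteTrue (by rw [test_compileTest hv, htest]) hE⟩
  | iteFalse htest h ih =>
    obtain ⟨dss₁, hv₁, s, hs, hE⟩ := ih (fun c => by have := hV c; omega) hg hv
    exact ⟨dss₁, hv₁, s + 1, by rw [Nat.add_mul]; omega,
      .iteFalse (by rw [test_compileTest hv, htest]) hE⟩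
  | loopFalse htest =>
    exact ⟨dss, hv, 1, by omega, .loopFalse (by rw [test_compileTest hv, htest])⟩
  | @loopTrue c P σ t σ' t' σ'' htest h h' ih ih' =>
    obtain ⟨dss₁, hv₁, s, hs, hE⟩ := ih (fun c => by have := hV c; omega) hg hv
    obtain ⟨dss₂, hv₂, s', hs', hE'⟩ := ih' (fun c => by
      have := hV c
      have := counterSem_ctr_le h c
      omega) (h.flow hg).2 hv₁
    exact ⟨dss₂, hv₂, s + s' + 1, by rw [Nat.add_mul, Nat.add_mul]; omega,
      .loopTrue (by rw [test_compileTest hv, htest]) hE hE'⟩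

/-- The initial store. -/
def CounterStore.init (k : ℕ) (bl : Γ) (r : R) : CounterStore R Γ ι k :=
  ⟨r, fun _ => 0, 0, fun _ _ => bl, fun _ => 0⟩

/-- Programs with counters are executed by Turing machines that use logarithmic space for the
counters. -/
theorem exists_turingMachine [Finite R] [Finite Γ] [Finite ι] (P : CounterProg α R Γ ι k) (bl : Γ)
    (r : R) (acc : Set R) : ∃ M : MultiTapeTM α Empty, ∀ (x : List α) (b N : ℕ)
      (σ' : CounterStore R Γ ι k),
      Prog.Runs (counterSem x b) N P (CounterStore.init k bl r) σ' →
      Nat.log 2 (P.cost.eval N + 1) + 1 ≤ b →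
      M.HaltsWithin x (P.cost.eval N * (4 * P.cost.eval N + 13)) (2 * b + 1 : ℕ)
        (fun c => c.state ∈ M.accepting ↔ σ'.reg ∈ acc) := by
  let e := Finite.equivFin (Fin k ⊕ ι)
  refine ⟨(P.compile e).toTM (bl, none) r acc, fun x b N σ' h hb => ?_⟩
  obtain ⟨t, ht, h⟩ := h
  -- All counters start at zero, so the bound for the running time can serve as `V`.
  obtain ⟨dss', -, t', ht', hE⟩ := h.compile (e := e) (bl := bl) (dss := fun _ => [])
    (V := P.cost.eval N) (fun c => by simpa [CounterStore.init] using ht) hb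
    (by intro i; simp [CounterStore.init]) (by simp [digitsVal, CounterStore.init])
  have hinit : (CounterStore.init k bl r : CounterStore R Γ ι k).toTape e bl (fun _ => []) =
      TapeStore.init _ (bl, none) r := by
    refine TapeStore.ext rfl rfl (funext fun i => ?_) (funext fun i => ?_)
    all_goals
      obtain ⟨i, rfl⟩ := e.surjective i
      rcases i with j | c
      · simp [CounterStore.toTape, CounterStore.init, TapeStore.init]
      · try funext z
        simp [CounterStore.toTape, CounterStore.init, TapeStore.init, digitTape]
  rw [hinit] at hE
  exact hE.haltsWithin (ht'.trans (Nat.mul_le_mul_right _ ht))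

end

/-! ### Basic programs with counters -/

/-- The register of the machine that decides satisfiability, where `Q` is the set of states of a
machine that is simulated. -/
@[ext]
structure Reg (Q : Type) : Type where
  sym : InputSymbol CodeSymbol
  sym' : InputSymbol CodeSymbol
  fetched : Option (InputSymbol CodeSymbol)
  flag : Bool
  state : Q
  move : HeadMove
  halted : Bool
  bot : Bool
  res : Bool
  res' : Bool
  unsat : Bool

/-- The counters: temporary values `t`, `u`, `v`; the position `h` of a virtual input head and a
countdown `cnt` to this position; pointers to literals. -/
inductive Ctr : Type
  | t | u | v | cnt | h | s | o | o' | i | i' | q | q' | w | w'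
  deriving DecidableEq

instance : Fintype Ctr where
  elems := {.t, .u, .v, .cnt, .h, .s, .o, .o', .i, .i', .q, .q', .w, .w'}
  complete c := by cases c <;> simp

instance : Fintype CodeSymbol where
  elems := {.zero, .one, .hash}
  complete c := by cases c <;> simp

instance : DecidableEq HeadMove := fun a b => by
  cases a <;> cases b <;> first | exact isTrue rfl | exact isFalse (by simp)

instance : Fintype HeadMove where
  elems := {HeadMove.left, HeadMove.stay, HeadMove.right}
  complete c := by cases c <;> simp

/-- An input symbol as an element of an iterated option type. -/
def InputSymbol.toOption {α : Type} : InputSymbol α → Option (Option α)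
  | leftEnd => none
  | rightEnd => some none
  | symbol a => some (some a)

theorem InputSymbol.toOption_injective {α : Type} :
    Function.Injective (InputSymbol.toOption (α := α)) := by
  intro a b h
  cases a <;> cases b <;> simp_all [toOption]

instance {α : Type} [Finite α] : Finite (InputSymbol α) :=
  Finite.of_injective _ InputSymbol.toOption_injective

instance {α : Type} [DecidableEq α] : DecidableEq (InputSymbol α) :=
  InputSymbol.toOption_injective.decidableEq

instance {Q : Type} [Finite Q] : Finite (Reg Q) :=
  Finite.of_injective (fun r : Reg Q => (r.sym, r.sym', r.fetched, r.flag, r.state, r.move,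
    r.halted, r.bot, r.res, r.res', r.unsat)) (by
      intro r r' h
      simp only [Prod.mk.injEq] at h
      obtain ⟨h1, h2, h3, h4, h5, h6, h7, h8, h9, h10, h11⟩ := h
      exact Reg.ext h1 h2 h3 h4 h5 h6 h7 h8 h9 h10 h11)

/-- The stores of the machine that decides satisfiability. -/
abbrev SatStore (Q Γ : Type) (k : ℕ) : Type := CounterStore (Reg Q) Γ Ctr k

/-- The programs of the machine that decides satisfiability. -/
abbrev SatProg (Q Γ : Type) (k : ℕ) : Type := CounterProg CodeSymbol (Reg Q) Γ Ctr k

section Basic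

variable {Q Γ : Type} {k : ℕ}

namespace CounterStore

/-- Assignment to a counter. -/
def setC (σ : SatStore Q Γ k) (c : Ctr) (v : ℕ) : SatStore Q Γ k :=
  { σ with ctr := Function.update σ.ctr c v }

/-- Change of the register. -/
def setR (σ : SatStore Q Γ k) (f : Reg Q → Reg Q) : SatStore Q Γ k :=
  { σ with reg := f σ.reg }

variable (σ : SatStore Q Γ k) (c d : Ctr) (v w : ℕ) (f g : Reg Q → Reg Q)

@[simp] theorem setC_ctr : (σ.setC c v).ctr d = if d = c then v else σ.ctr d := by
  simp [setC, Function.update_apply]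
@[simp] theorem setC_reg : (σ.setC c v).reg = σ.reg := rfl
@[simp] theorem setC_ih : (σ.setC c v).ih = σ.ih := rfl
@[simp] theorem setC_tape : (σ.setC c v).tape = σ.tape := rfl
@[simp] theorem setC_thead : (σ.setC c v).thead = σ.thead := rfl
@[simp] theorem setR_ctr : (σ.setR f).ctr = σ.ctr := rfl
@[simp] theorem setR_reg : (σ.setR f).reg = f σ.reg := rfl
@[simp] theorem setR_ih : (σ.setR f).ih = σ.ih := rfl
@[simp] theorem setR_tape : (σ.setR f).tape = σ.tape := rfl
@[simp] theorem setR_thead : (σ.setR f).thead = σ.thead := rfl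
theorem setR_setR : (σ.setR f).setR g = σ.setR (fun r => g (f r)) := rfl
theorem setR_setC : (σ.setR f).setC c v = (σ.setC c v).setR f := rfl
theorem setC_setC : (σ.setC c v).setC c w = σ.setC c w := by simp [setC]
theorem setC_self : σ.setC c (σ.ctr c) = σ := by simp [setC]

end CounterStore

/-- Change the register. -/
def regOp (f : Reg Q → InputSymbol CodeSymbol → (Ctr → Bool) → Reg Q) : SatProg Q Γ k :=
  .act (.act fun r s z v => (f r s z, .stay, v, fun _ => .stay))

/-- Move the input head. -/
def inputOp (mv : HeadMove) : SatProg Q Γ k :=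
  .act (.act fun r _ _ v => (r, mv, v, fun _ => .stay))

variable {x : List CodeSymbol} {b N : ℕ} {σ : SatStore Q Γ k}

/-- The guard looks at the work heads only, which changes of counters and register leave alone by
definition. So `by assumption` also proves it for the modified stores in chains of programs. -/
theorem runs_inc (c : Ctr)
    (hg : (counterSem (α := CodeSymbol) x b).guard σ := by assumption) :
    Prog.Runs (counterSem x b) N (.act (.inc c)) σ (σ.setC c (σ.ctr c + 1)) :=
  Prog.Runs.act (m := counterSem x b) (a := .inc c) hg

theorem runs_dec (c : Ctr)
    (hg : (counterSem (α := CodeSymbol) x b).guard σ := by assumption) :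
    Prog.Runs (counterSem x b) N (.act (.dec c)) σ (σ.setC c (σ.ctr c - 1)) :=
  Prog.Runs.act (m := counterSem x b) (a := .dec c) hg

theorem runs_regOp (f : Reg Q → InputSymbol CodeSymbol → (Ctr → Bool) → Reg Q)
    (hg : (counterSem (α := CodeSymbol) x b).guard σ := by assumption) :
    Prog.Runs (counterSem x b) N (regOp f) σ (σ.setR fun r =>
      f r (MultiTapeTM.readInput x σ.ih) (fun c => decide (σ.ctr c = 0))) := by
  have : (counterSem x b).op (.act fun r s z v => (f r s z, .stay, v, fun _ => .stay)) σ =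
      (σ.setR fun r => f r (MultiTapeTM.readInput x σ.ih) (fun c => decide (σ.ctr c = 0))) := by
    simp [counterSem, CounterStore.setR, MultiTapeTM.moveInput, MultiTapeTM.moveWork]
  rw [← this]
  refine Prog.Runs.act ?_
  rw [this]
  exact hg

theorem runs_inputOp (mv : HeadMove)
    (hg : (counterSem (α := CodeSymbol) x b).guard σ := by assumption) :
    Prog.Runs (counterSem x b) N (inputOp mv) σ
      { σ with ih := MultiTapeTM.moveInput x mv σ.ih } := by
  have : (counterSem x b).op (.act fun r _ _ v => (r, mv, v, fun _ => .stay)) σ =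
      { σ with ih := MultiTapeTM.moveInput x mv σ.ih } := by
    simp [counterSem, MultiTapeTM.moveWork]
  rw [← this]
  refine Prog.Runs.act ?_
  rw [this]
  exact hg

/-- Set a counter to zero. -/
def clear (c : Ctr) : SatProg Q Γ k := .loop (fun _ z => !z c) (.act (.dec c))

theorem runs_clear {c : Ctr} (hc : σ.ctr c ≤ N)
    (hg : (counterSem (α := CodeSymbol) x b).guard σ := by assumption) :
    Prog.Runs (counterSem x b) N (clear c) σ (σ.setC c 0) := by
  have := Prog.Runs.loop (m := counterSem x b) (b := fun _ z => !z c) (P := .act (.dec c))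
    (f := fun i => σ.setC c (σ.ctr c - i)) hc (fun i hi => ⟨?_, ?_⟩) ?_
  · unfold clear
    simpa [CounterStore.setC_self] using this
  · simp [counterSem]
    omega
  · convert runs_dec (x := x) (b := b) (N := N) (σ := σ.setC c (σ.ctr c - i)) c using 1
    rw [CounterStore.setC_setC]
    simp [Nat.sub_sub]
  · simp [counterSem]

/-- Add one counter to another. -/
def addTo (d c : Ctr) : SatProg Q Γ k :=
  .seq (.loop (fun _ z => !z c) (.seq (.act (.dec c)) (.act (.inc .t))))
    (.loop (fun _ z => !z .t) (.seq (.act (.dec .t)) (.seq (.act (.inc c)) (.act (.inc d)))))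

/-- A counter can be read only by counting it down; it is moved to `t` and restored from there while
`d` grows. -/
theorem runs_addTo {c d : Ctr} (hc : σ.ctr c ≤ N)
    (ht : σ.ctr .t = 0) (hct : c ≠ .t) (hdt : d ≠ .t) (hcd : c ≠ d)
    (hg : (counterSem (α := CodeSymbol) x b).guard σ := by assumption) :
    Prog.Runs (counterSem x b) N (addTo d c) σ (σ.setC d (σ.ctr d + σ.ctr c)) := by
  have h1 := Prog.Runs.loop (m := counterSem x b) (b := fun _ z => !z c)
    (P := .seq (.act (.dec c)) (.act (.inc .t)))
    (f := fun i => (σ.setC c (σ.ctr c - i)).setC .t i) hc (fun i hi => ⟨?_, ?_⟩) ?_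
  · have h2 := Prog.Runs.loop (m := counterSem x b) (b := fun _ z => !z .t)
      (P := .seq (.act (.dec .t)) (.seq (.act (.inc c)) (.act (.inc d))))
      (f := fun i => ((σ.setC c i).setC .t (σ.ctr c - i)).setC d (σ.ctr d + i)) hc
      (fun i hi => ⟨?_, ?_⟩) ?_
    · have e1 : (σ.setC c (σ.ctr c - 0)).setC .t 0 = σ := by
        ext e <;> simp
        grind
      have e2 : ((σ.setC c (σ.ctr c)).setC .t (σ.ctr c - σ.ctr c)).setC d (σ.ctr d + σ.ctr c) =
          σ.setC d (σ.ctr d + σ.ctr c) := by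
        ext e <;> simp
        grind
      have e3 : (σ.setC c (σ.ctr c - σ.ctr c)).setC .t (σ.ctr c) =
          ((σ.setC c 0).setC .t (σ.ctr c - 0)).setC d (σ.ctr d + 0) := by
        ext e <;> simp
        grind
      rw [e1, e3] at h1
      rw [e2] at h2
      exact h1.seq h2
    · simp [counterSem, hdt.symm]
      omega
    · have := ((runs_dec (x := x) (b := b) (N := N)
        (σ := ((σ.setC c i).setC .t (σ.ctr c - i)).setC d (σ.ctr d + i)) .t).seq
          ((runs_inc c).seq (runs_inc d)))
      convert this using 1
      ext e <;> simp
      grind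
    · simp [counterSem, hdt.symm]
  · simp [counterSem, hct]
    omega
  · have := ((runs_dec (x := x) (b := b) (N := N)
      (σ := (σ.setC c (σ.ctr c - i)).setC .t i) c).seq (runs_inc .t))
    convert this using 1
    ext e <;> simp
    grind
  · simp [counterSem, hct]

/-- Read the symbol of the input to which a counter points. -/
def load (c : Ctr) : SatProg Q Γ k :=
  .seq (.loop (fun _ z => !z c)
      (.seq (.act (.dec c)) (.seq (.act (.inc .t)) (inputOp .right))))
    (.seq (regOp fun r s _ => { r with sym := s })
      (.loop (fun _ z => !z .t) (.seq (.act (.dec .t)) (.seq (.act (.inc c)) (inputOp .left)))))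

/-- The input head rests at position `0` between programs, so the counter alone determines where it
reads. The bound on the counter ensures that the right endmarker does not stop it early. -/
theorem runs_load {c : Ctr} (hc : σ.ctr c ≤ x.length + 1)
    (hN : x.length + 1 ≤ N) (ht : σ.ctr .t = 0) (hct : c ≠ .t) (hih : σ.ih = 0)
    (hg : (counterSem (α := CodeSymbol) x b).guard σ := by assumption) :
    Prog.Runs (counterSem x b) N (load c) σ
      (σ.setR fun r => { r with sym := MultiTapeTM.readInput x (σ.ctr c) }) := by
  have h1 := Prog.Runs.loop (m := counterSem x b) (b := fun _ z => !z c)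
    (P := .seq (.act (.dec c)) (.seq (.act (.inc .t)) (inputOp .right)))
    (f := fun i => { (σ.setC c (σ.ctr c - i)).setC .t i with ih := i }) (hc.trans hN)
    (fun i hi => ⟨?_, ?_⟩) ?_
  · have h2 := Prog.Runs.loop (m := counterSem x b) (b := fun _ z => !z .t)
      (P := .seq (.act (.dec .t)) (.seq (.act (.inc c)) (inputOp .left)))
      (f := fun i => { ((σ.setC c i).setC .t (σ.ctr c - i)).setR (fun r =>
        { r with sym := MultiTapeTM.readInput x (σ.ctr c) }) with ih := σ.ctr c - i })
      (hc.trans hN) (fun i hi => ⟨?_, ?_⟩) ?_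
    · have e1 : { (σ.setC c (σ.ctr c - 0)).setC .t 0 with ih := 0 } = σ := by
        ext e <;> simp
        · grind
        · exact hih.symm
      have e2 : { ((σ.setC c (σ.ctr c)).setC .t (σ.ctr c - σ.ctr c)).setR (fun r =>
          { r with sym := MultiTapeTM.readInput x (σ.ctr c) }) with ih := σ.ctr c - σ.ctr c } =
          (σ.setR fun r => { r with sym := MultiTapeTM.readInput x (σ.ctr c) }) := by
        ext e <;> simp
        · grind
        · exact hih.symm
      rw [e1] at h1
      rw [e2] at h2
      refine h1.seq (Prog.Runs.seq (runs_regOp _) ?_)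
      convert h2 using 1
      ext e <;> simp
    · simp [counterSem]
      omega
    · have := ((runs_dec (x := x) (b := b) (N := N)
        (σ := { ((σ.setC c i).setC .t (σ.ctr c - i)).setR (fun r =>
          { r with sym := MultiTapeTM.readInput x (σ.ctr c) }) with ih := σ.ctr c - i }) .t).seq
          ((runs_inc c).seq (runs_inputOp .left)))
      convert this using 1
      ext e <;> simp
      · grind
      · simp [MultiTapeTM.moveInput]
        omega
    · simp [counterSem]
  · simp [counterSem, hct]
    omega
  · have := ((runs_dec (x := x) (b := b) (N := N)
      (σ := { (σ.setC c (σ.ctr c - i)).setC .t i with ih := i }) c).seq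
        ((runs_inc .t).seq (runs_inputOp .right)))
    convert this using 1
    ext e <;> simp
    · grind
    · simp [MultiTapeTM.moveInput]
      omega
  · simp [counterSem, hct]

/-- Test whether two counters are equal. -/
def eqCtr (c d : Ctr) : SatProg Q Γ k :=
  .seq (.loop (fun _ z => !z c && !z d)
      (.seq (.act (.dec c)) (.seq (.act (.dec d)) (.act (.inc .t)))))
    (.seq (regOp fun r _ z => { r with flag := z c && z d })
      (.loop (fun _ z => !z .t)
        (.seq (.act (.dec .t)) (.seq (.act (.inc c)) (.act (.inc d))))))

/-- Both counters are counted down together until one of them is zero; they are equal if the other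
one is zero too. The number of rounds is kept in `t` for the restoration. -/
theorem runs_eqCtr {c d : Ctr} (hc : σ.ctr c ≤ N)
    (ht : σ.ctr .t = 0) (hct : c ≠ .t) (hdt : d ≠ .t) (hcd : c ≠ d)
    (hg : (counterSem (α := CodeSymbol) x b).guard σ := by assumption) :
    Prog.Runs (counterSem x b) N (eqCtr c d) σ
      (σ.setR fun r => { r with flag := decide (σ.ctr c = σ.ctr d) }) := by
  have hm : min (σ.ctr c) (σ.ctr d) ≤ N := (min_le_left _ _).trans hc
  have h1 := Prog.Runs.loop (m := counterSem x b) (b := fun _ z => !z c && !z d)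
    (P := .seq (.act (.dec c)) (.seq (.act (.dec d)) (.act (.inc .t))))
    (f := fun i => ((σ.setC c (σ.ctr c - i)).setC d (σ.ctr d - i)).setC .t i) hm
    (fun i hi => ⟨?_, ?_⟩) ?_
  · have h2 := Prog.Runs.loop (m := counterSem x b) (b := fun _ z => !z .t)
      (P := .seq (.act (.dec .t)) (.seq (.act (.inc c)) (.act (.inc d))))
      (f := fun i => (((σ.setC c (σ.ctr c - min (σ.ctr c) (σ.ctr d) + i)).setC d
        (σ.ctr d - min (σ.ctr c) (σ.ctr d) + i)).setC .t (min (σ.ctr c) (σ.ctr d) - i)).setR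
          fun r => { r with flag := decide (σ.ctr c = σ.ctr d) }) hm
      (fun i hi => ⟨?_, ?_⟩) ?_
    · have e1 : ((σ.setC c (σ.ctr c - 0)).setC d (σ.ctr d - 0)).setC .t 0 = σ := by
        ext e <;> simp
        grind
      have e2 : (((σ.setC c (σ.ctr c - min (σ.ctr c) (σ.ctr d) + min (σ.ctr c) (σ.ctr d))).setC d
          (σ.ctr d - min (σ.ctr c) (σ.ctr d) + min (σ.ctr c) (σ.ctr d))).setC .t
            (min (σ.ctr c) (σ.ctr d) - min (σ.ctr c) (σ.ctr d))).setR
          (fun r => { r with flag := decide (σ.ctr c = σ.ctr d) }) =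
          (σ.setR fun r => { r with flag := decide (σ.ctr c = σ.ctr d) }) := by
        ext e <;> simp
        grind
      rw [e1] at h1
      rw [e2] at h2
      refine h1.seq (Prog.Runs.seq (runs_regOp _) ?_)
      convert h2 using 1
      ext e <;> simp [hct, hdt, hcd]
      all_goals rw [Bool.eq_iff_iff]; simp; omega
    · simp [counterSem]
      omega
    · have := ((runs_dec (x := x) (b := b) (N := N)
        (σ := (((σ.setC c (σ.ctr c - min (σ.ctr c) (σ.ctr d) + i)).setC d
        (σ.ctr d - min (σ.ctr c) (σ.ctr d) + i)).setC .t (min (σ.ctr c) (σ.ctr d) - i)).setR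
          fun r => { r with flag := decide (σ.ctr c = σ.ctr d) }) .t).seq
          ((runs_inc c).seq (runs_inc d)))
      convert this using 1
      ext e <;> simp
      grind
    · simp [counterSem]
  · simp [counterSem, hct, hdt, hcd]
    omega
  · have := ((runs_dec (x := x) (b := b) (N := N)
      (σ := ((σ.setC c (σ.ctr c - i)).setC d (σ.ctr d - i)).setC .t i) c).seq
        ((runs_dec d).seq (runs_inc .t)))
    convert this using 1
    ext e <;> simp
    grind
  · simp [counterSem, hct, hdt, hcd]
    omega

end Basic

/-! ### Programs that handle literals in the code of a formula -/

/-- The bits by which a literal is written. -/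
def litBits (l : SatLiteral) : List Bool := l.2 :: l.1.bits

/-- The code of a literal. -/
def encLit (l : SatLiteral) : List CodeSymbol :=
  (litBits l).map CodeSymbol.ofBool ++ [CodeSymbol.hash]

theorem length_encLit (l : SatLiteral) : (encLit l).length = (litBits l).length + 1 := by
  simp [encLit]

/-- The literal `l` is written in `x` from position `c` of the input tape on. -/
def LitAt (x : List CodeSymbol) (c : ℕ) (l : SatLiteral) : Prop :=
  ∃ pre suf, x = pre ++ encLit l ++ suf ∧ c = pre.length + 1

open MultiTapeTM in
theorem readInput_append {α : Type} {pre mid suf : List α} {i : ℕ} (h : i < mid.length) :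
    readInput (pre ++ mid ++ suf) (pre.length + 1 + i) = InputSymbol.symbol mid[i] := by
  rw [show pre.length + 1 + i = (pre.length + i) + 1 by omega]
  have : (pre ++ mid ++ suf)[pre.length + i]? = some mid[i] := by
    rw [List.getElem?_append_left (by simp; omega), List.getElem?_append_right (by omega)]
    simp
  simp only [readInput, this]

open MultiTapeTM in
theorem readInput_length {α : Type} (x : List α) :
    readInput x (x.length + 1) = InputSymbol.rightEnd := by
  simp [readInput]

namespace LitAt

open MultiTapeTM

variable {x : List CodeSymbol} {c : ℕ} {l : SatLiteral}

theorem le (h : LitAt x c l) : c + (encLit l).length ≤ x.length + 1 := by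
  obtain ⟨pre, suf, rfl, rfl⟩ := h
  simp
  omega

theorem readInput_bit (h : LitAt x c l) {i : ℕ} (hi : i < (litBits l).length) :
    readInput x (c + i) = .symbol (.ofBool (litBits l)[i]) := by
  obtain ⟨pre, suf, rfl, rfl⟩ := h
  rw [readInput_append (by rw [length_encLit]; omega)]
  simp [encLit, hi]

theorem readInput_hash (h : LitAt x c l) :
    readInput x (c + (litBits l).length) = .symbol .hash := by
  obtain ⟨pre, suf, rfl, rfl⟩ := h
  rw [readInput_append (by rw [length_encLit]; omega)]
  simp [encLit]

end LitAt

theorem ofBool_ne_hash (d : Bool) : CodeSymbol.ofBool d ≠ CodeSymbol.hash := by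
  cases d <;> simp [CodeSymbol.ofBool]

theorem ofBool_injective : Function.Injective CodeSymbol.ofBool := by
  intro a b h
  cases a <;> cases b <;> simp_all [CodeSymbol.ofBool]

/-- Two bit strings, each followed by `#`, agree up to the end of the shorter one only if they are
equal. -/
theorem exists_first_difference (A : List Bool) : ∀ (B : List Bool)
    (a b : ℕ → InputSymbol CodeSymbol),
    (∀ (i) (h : i < A.length), a i = .symbol (.ofBool A[i])) → a A.length = .symbol .hash →
    (∀ (i) (h : i < B.length), b i = .symbol (.ofBool B[i])) → b B.length = .symbol .hash →
    ∃ n ≤ A.length, n ≤ B.length ∧ (∀ i < n, b i = a i ∧ b i ≠ .symbol .hash) ∧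
      ¬ (b n = a n ∧ b n ≠ .symbol .hash) ∧ (b n = a n ↔ A = B) := by
  induction A with
  | nil =>
    intro B a b _ ha' hb hb'
    refine ⟨0, by simp, by simp, by simp, ?_, ?_⟩
    · rintro ⟨h, h'⟩
      exact h' (h.trans ha')
    · rw [show a 0 = _ from ha']
      rcases B with _ | ⟨d, B⟩
      · exact ⟨fun _ => rfl, fun _ => hb'⟩
      · rw [hb 0 (by simp)]
        simp [ofBool_ne_hash]
  | cons e A ih =>
    intro B a b ha ha' hb hb'
    have ha0 : a 0 = .symbol (.ofBool e) := ha 0 (by simp)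
    rcases B with _ | ⟨d, B⟩
    · have hb0 : b 0 = .symbol .hash := hb'
      refine ⟨0, by simp, by simp, by simp, fun h => h.2 hb0, ?_⟩
      simp [ha0, hb0, (ofBool_ne_hash e).symm]
    · have hb0 : b 0 = .symbol (.ofBool d) := hb 0 (by simp)
      by_cases hde : d = e
      · subst hde
        obtain ⟨n, h1, h2, h3, h4, h5⟩ := ih B (fun i => a (i + 1)) (fun i => b (i + 1))
          (fun i hi => ha (i + 1) (by simpa using hi)) ha'
          (fun i hi => hb (i + 1) (by simpa using hi)) hb'
        refine ⟨n + 1, by simpa using h1, by simpa using h2, fun i hi => ?_, h4, by simpa using h5⟩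
        rcases i with _ | i
        · exact ⟨hb0.trans ha0.symm, by simp [hb0, ofBool_ne_hash]⟩
        · exact h3 i (by omega)
      · have hne : b 0 ≠ a 0 := by
          rw [ha0, hb0]
          simpa using fun h => hde (ofBool_injective h)
        refine ⟨0, by simp, by simp, by simp, fun h => hne h.1, ?_⟩
        simp [hne, Ne.symm hde]

section LiteralPrograms

open MultiTapeTM

variable {Q Γ : Type} {k : ℕ} {x : List CodeSymbol} {b N : ℕ} {σ : SatStore Q Γ k}

/-- Advance a pointer to the end of a literal. -/
def skipLit (p : Ctr) : SatProg Q Γ k :=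
  .seq (load p) (.seq (.loop (fun r _ => r.sym != .symbol .hash)
    (.seq (.act (.inc p)) (load p))) (.seq (.act (.inc p))
      (regOp fun r _ _ => { r with sym := .leftEnd })))

theorem runs_skipLit {p : Ctr} {l : SatLiteral} (hp : LitAt x (σ.ctr p) l)
    (hN : x.length + 1 ≤ N) (ht : σ.ctr .t = 0) (hpt : p ≠ .t) (hih : σ.ih = 0)
    (hg : (counterSem (α := CodeSymbol) x b).guard σ := by assumption) :
    Prog.Runs (counterSem x b) N (skipLit p) σ
      ((σ.setC p (σ.ctr p + (encLit l).length)).setR fun r => { r with sym := .leftEnd }) := by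
  have hle := hp.le
  rw [length_encLit] at hle
  have hl := Prog.Runs.loop (m := counterSem x b) (N := N)
    (b := fun r _ => r.sym != .symbol .hash) (P := .seq (.act (.inc p)) (load p))
    (f := fun i => (σ.setC p (σ.ctr p + i)).setR fun r =>
      { r with sym := readInput x (σ.ctr p + i) })
    (n := (litBits l).length) (by omega) (fun i hi => ⟨?_, ?_⟩) ?_
  · refine (runs_load (c := p) (by omega) hN ht hpt hih).seq (Prog.Runs.seq (hl.from_eq ?_)
      ((runs_inc p).seq ((runs_regOp _).to_eq ?_)))
    · ext e <;> simp
      grind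
    · ext e <;> simp
      rw [length_encLit]
      grind
  · simp [counterSem, hp.readInput_bit hi, ofBool_ne_hash]
  · refine (runs_inc p).seq ((runs_load (c := p) (by simp; omega) hN (by simp [hpt.symm, ht]) hpt
      (by simp [hih])).to_eq ?_)
    ext e <;> simp
    · rw [Nat.add_assoc]
    · grind
  · simp [counterSem, hp.readInput_hash]

/-- Read the symbols to which the counters `u` and `v` point. -/
def loadPair : SatProg Q Γ k :=
  .seq (load .u) (.seq (regOp fun r _ _ => { r with sym' := r.sym }) (load .v))

theorem runs_loadPair (hu : σ.ctr .u ≤ x.length + 1) (hv : σ.ctr .v ≤ x.length + 1)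
    (hN : x.length + 1 ≤ N) (ht : σ.ctr .t = 0) (hih : σ.ih = 0)
    (hg : (counterSem (α := CodeSymbol) x b).guard σ := by assumption) :
    Prog.Runs (counterSem x b) N loadPair σ (σ.setR fun r =>
      { r with sym' := readInput x (σ.ctr .u), sym := readInput x (σ.ctr .v) }) := by
  exact (runs_load (c := .u) hu hN ht (by simp) hih).seq ((runs_regOp _).seq
    ((runs_load (c := .v) (by simpa using hv) hN (by simpa using ht) (by simp)
      (by simpa using hih)).to_eq (by simp [CounterStore.setR_setR])))

/-- Test whether two counters point to complementary literals. -/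
def cmpLit (c d : Ctr) : SatProg Q Γ k :=
  .seq (addTo .u c) (.seq (addTo .v d) (.seq loadPair
    (.seq (regOp fun r _ _ => { r with flag := (r.sym != r.sym') })
    (.seq (.act (.inc .u)) (.seq (.act (.inc .v)) (.seq loadPair
    (.seq (.loop (fun r _ => (r.sym == r.sym') && r.sym != .symbol .hash)
      (.seq (.act (.inc .u)) (.seq (.act (.inc .v)) loadPair)))
    (.seq (regOp fun r _ _ => { r with
      flag := r.flag && (r.sym == r.sym')
      sym := .leftEnd
      sym' := .leftEnd })
    (.seq (clear .u) (clear .v))))))))))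

/-- The temporary values of a store have their initial values. -/
structure Idle (x : List CodeSymbol) (b : ℕ) (σ : SatStore Q Γ k) : Prop where
  guard : (counterSem (α := CodeSymbol) x b).guard σ
  t : σ.ctr .t = 0
  u : σ.ctr .u = 0
  v : σ.ctr .v = 0
  ih : σ.ih = 0
  sym : σ.reg.sym = .leftEnd
  sym' : σ.reg.sym' = .leftEnd
  flag : σ.reg.flag = false

/-- The counter is not used for temporary values. -/
def Ctr.IsPtr (c : Ctr) : Prop := c ≠ .t ∧ c ≠ .u ∧ c ≠ .v

/-- The sign bits are compared first. The names are then compared symbol by symbol, on copies `u`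
and `v` of the pointers, up to a difference or a `#`. By `exists_first_difference` the number of
rounds is at most the length of the shorter name, and the symbols at which the loop stops agree
exactly if the names do. -/
theorem runs_cmpLit {c d : Ctr} {l l' : SatLiteral} (hσ : Idle x b σ) (hN : x.length + 1 ≤ N)
    (hc : LitAt x (σ.ctr c) l) (hd : LitAt x (σ.ctr d) l') (hc' : c.IsPtr) (hd' : d.IsPtr) :
    Prog.Runs (counterSem x b) N (cmpLit c d) σ
      (σ.setR fun r => { r with flag := decide (l' = (l.1, !l.2)) }) := by
  have hg := hσ.guard
  have hlc := hc.le
  have hld := hd.le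
  rw [length_encLit, litBits, List.length_cons] at hlc hld
  obtain ⟨n, hn1, hn2, h1, h2, h3⟩ := exists_first_difference l.1.bits l'.1.bits
    (fun i => readInput x (σ.ctr c + 1 + i)) (fun i => readInput x (σ.ctr d + 1 + i))
    (fun i hi => by
      rw [show σ.ctr c + 1 + i = σ.ctr c + (i + 1) by ring,
        hc.readInput_bit (by simpa [litBits] using hi)]
      simp [litBits])
    (by
      have := hc.readInput_hash
      rwa [litBits, List.length_cons, add_comm _ 1, ← add_assoc] at this)
    (fun i hi => by
      rw [show σ.ctr d + 1 + i = σ.ctr d + (i + 1) by ring,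
        hd.readInput_bit (by simpa [litBits] using hi)]
      simp [litBits])
    (by
      have := hd.readInput_hash
      rwa [litBits, List.length_cons, add_comm _ 1, ← add_assoc] at this)
  have hs : (readInput x (σ.ctr d) != readInput x (σ.ctr c)) = decide (l'.2 = !l.2) := by
    have e1 := hc.readInput_bit (i := 0) (by simp [litBits])
    have e2 := hd.readInput_bit (i := 0) (by simp [litBits])
    rw [add_zero] at e1 e2
    rw [e1, e2]
    rcases l with ⟨_, _ | _⟩ <;> rcases l' with ⟨_, _ | _⟩ <;> simp [litBits, CodeSymbol.ofBool]
  have hf : (decide (l'.2 = !l.2) &&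
      (readInput x (σ.ctr d + 1 + n) == readInput x (σ.ctr c + 1 + n))) =
      decide (l' = (l.1, !l.2)) := by
    have hbits : l.1.bits = l'.1.bits ↔ l'.1 = l.1 := by
      refine ⟨fun h => ?_, fun h => by rw [h]⟩
      have := congrArg (fun L => Nat.ofDigits 2 (L.map fun b => cond b 1 0)) h
      simpa [← Nat.digits_two_eq_bits, Nat.ofDigits_digits] using this.symm
    rw [Bool.eq_iff_iff]
    simp only [Bool.and_eq_true, decide_eq_true_eq, beq_iff_eq, h3, hbits, Prod.ext_iff]
    tauto
  have hl := Prog.Runs.loop (m := counterSem x b) (N := N)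
    (b := fun r _ => (r.sym == r.sym') && r.sym != .symbol .hash)
    (P := .seq (.act (.inc .u)) (.seq (.act (.inc .v)) loadPair))
    (f := fun i => ((σ.setC .u (σ.ctr c + 1 + i)).setC .v (σ.ctr d + 1 + i)).setR fun r =>
      { r with
        sym' := readInput x (σ.ctr c + 1 + i)
        sym := readInput x (σ.ctr d + 1 + i)
        flag := (readInput x (σ.ctr d) != readInput x (σ.ctr c)) })
    (n := n) (by omega) (fun i hi => ⟨?_, ?_⟩) ?_
  · obtain ⟨hc1, hc2, hc3⟩ := hc'
    obtain ⟨hd1, hd2, hd3⟩ := hd'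
    refine (runs_addTo (c := c) (d := .u) (by omega) hσ.t hc1 (by simp) hc2).seq
      ((runs_addTo (c := d) (d := .v) (by simp [hd2]; omega) (by simp [hσ.t]) hd1 (by simp)
        hd3).seq
      ((runs_loadPair (by simp [hσ.u]; omega) (by simp [hσ.v, hd2]; omega) hN (by simp [hσ.t])
        (by simp [hσ.ih])).seq
      ((runs_regOp _).seq ((runs_inc .u).seq ((runs_inc .v).seq
      ((runs_loadPair (by simp [hσ.u]; omega) (by simp [hσ.v, hd2]; omega) hN (by simp [hσ.t])
        (by simp [hσ.ih])).seq (Prog.Runs.seq (hl.from_eq ?_)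
      ((runs_regOp _).seq ((runs_clear (by simp; omega)).seq
        ((runs_clear (by simp; omega)).to_eq ?_))))))))))
    · have := hσ.u
      have := hσ.v
      ext e <;> simp [hσ.u, hσ.v, hd2]
      split_ifs <;> rfl
    · have := hσ.u
      have := hσ.v
      ext e <;> simp
      · exact hσ.sym.symm
      · exact hσ.sym'.symm
      · rw [← hf, ← hs]
      · grind
  · simpa [counterSem] using h1 i hi
  · refine (runs_inc .u).seq ((runs_inc .v).seq ((runs_loadPair (by simp; omega) (by simp; omega)
      hN (by simp [hσ.t]) (by simp [hσ.ih])).to_eq ?_))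
    ext e <;> simp
    · rw [Nat.add_assoc]
    · rw [Nat.add_assoc]
    · grind
  · rw [← Bool.not_eq_true]
    simpa [counterSem] using h2

end LiteralPrograms

/-! ### Loops over the literal occurrences of a formula -/

/-- An occurrence of a literal in a formula: the literal, the other literal of the clause (the
literal itself if it is the only one), and the positions at which they are written. -/
structure Occ : Type where
  ptr : ℕ
  ptr' : ℕ
  lit : SatLiteral
  lit' : SatLiteral

/-- The code of a clause. -/
def encClause (C : List SatLiteral) : List CodeSymbol := C.flatMap encLit ++ [CodeSymbol.hash]

/-- The occurrences in a clause that is written from position `p` on. -/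
def clauseOccs (p : ℕ) : List SatLiteral → List Occ
  | [l] => [⟨p, p, l, l⟩]
  | [l, l'] => [⟨p, p + (encLit l).length, l, l'⟩, ⟨p + (encLit l).length, p, l', l⟩]
  | _ => []

/-- The occurrences in a formula that is written from position `p` on. -/
def occsFrom : ℕ → CNFFormula → List Occ
  | _, [] => []
  | p, C :: φ => clauseOccs p C ++ occsFrom (p + (encClause C).length) φ

theorem CNFFormula.encode_eq (φ : CNFFormula) : φ.encode = φ.flatMap encClause := by
  simp [encode, encodeNat]
  rfl

theorem occsFrom_append (φ ψ : CNFFormula) : ∀ p, occsFrom p (φ ++ ψ) =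
    occsFrom p φ ++ occsFrom (p + φ.encode.length) ψ := by
  induction φ with
  | nil => simp [occsFrom, CNFFormula.encode]
  | cons C φ ih =>
    intro p
    simp [occsFrom, ih, CNFFormula.encode_eq, add_assoc]

/-- The occurrences in a formula that is the input of a machine. -/
def CNFFormula.occs (φ : CNFFormula) : List Occ := occsFrom 1 φ

theorem length_clauseOccs {C : List SatLiteral} (h : 1 ≤ C.length ∧ C.length ≤ 2) (p : ℕ) :
    (clauseOccs p C).length = C.length := by
  match C with
  | [] => simp at h
  | [_] => rfl
  | [_, _] => rfl
  | _ :: _ :: _ :: _ => simp at h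

theorem litAt_of_mem_clauseOccs {pre suf : List CodeSymbol} {C : List SatLiteral} {o : Occ}
    (h : o ∈ clauseOccs (pre.length + 1) C) :
    LitAt (pre ++ encClause C ++ suf) o.ptr o.lit ∧
      LitAt (pre ++ encClause C ++ suf) o.ptr' o.lit' := by
  match C with
  | [] => simp [clauseOccs] at h
  | [l] =>
    simp only [clauseOccs, List.mem_singleton] at h
    subst h
    have : LitAt (pre ++ encClause [l] ++ suf) (pre.length + 1) l :=
      ⟨pre, [.hash] ++ suf, by simp [encClause], rfl⟩
    exact ⟨this, this⟩
  | [l, l'] =>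
    have h1 : LitAt (pre ++ encClause [l, l'] ++ suf) (pre.length + 1) l :=
      ⟨pre, encLit l' ++ [.hash] ++ suf, by simp [encClause], rfl⟩
    have h2 : LitAt (pre ++ encClause [l, l'] ++ suf) (pre.length + 1 + (encLit l).length) l' :=
      ⟨pre ++ encLit l, [.hash] ++ suf, by simp [encClause], by simp; omega⟩
    simp only [clauseOccs, List.mem_cons, List.not_mem_nil, or_false] at h
    rcases h with rfl | rfl
    · exact ⟨h1, h2⟩
    · exact ⟨h2, h1⟩
  | _ :: _ :: _ :: _ => simp [clauseOccs] at h

theorem litAt_of_mem_occsFrom (φ : CNFFormula) : ∀ (pre : List CodeSymbol) (o : Occ),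
    o ∈ occsFrom (pre.length + 1) φ →
    LitAt (pre ++ φ.encode) o.ptr o.lit ∧ LitAt (pre ++ φ.encode) o.ptr' o.lit' := by
  induction φ with
  | nil => simp [occsFrom]
  | cons C φ ih =>
    intro pre o h
    rw [CNFFormula.encode_eq, List.flatMap_cons, ← List.append_assoc, ← CNFFormula.encode_eq]
    rw [occsFrom, List.mem_append] at h
    rcases h with h | h
    · exact litAt_of_mem_clauseOccs h
    · refine ih (pre ++ encClause C) o ?_
      rwa [List.length_append, add_right_comm]

theorem litAt_of_mem_occs {φ : CNFFormula} {o : Occ} (h : o ∈ φ.occs) :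
    LitAt φ.encode o.ptr o.lit ∧ LitAt φ.encode o.ptr' o.lit' :=
  litAt_of_mem_occsFrom φ [] o h

theorem length_le_length_encode (φ : CNFFormula) : φ.length ≤ φ.encode.length := by
  induction φ with
  | nil => simp
  | cons C φ ih =>
    rw [CNFFormula.encode_eq, List.flatMap_cons, ← CNFFormula.encode_eq] at *
    simp [encClause]
    omega

section OccurrenceLoops

open MultiTapeTM

variable {Q Γ : Type} {k : ℕ} {b N : ℕ} {σ : SatStore Q Γ k}

/-- Forget the symbol that has been read. -/
def resetSym : SatProg Q Γ k := regOp fun r _ _ => { r with sym := .leftEnd }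

/-- Exchange two counters. -/
def swap (p p' : Ctr) : SatProg Q Γ k :=
  .seq (addTo .u p) (.seq (clear p) (.seq (addTo p p') (.seq (clear p') (.seq (addTo p' .u)
    (clear .u)))))

theorem runs_swap {x : List CodeSymbol} {p p' : Ctr} (hp : p.IsPtr) (hp' : p'.IsPtr)
    (hpp : p ≠ p') (h1 : σ.ctr p ≤ N) (h2 : σ.ctr p' ≤ N) (ht : σ.ctr .t = 0) (hu : σ.ctr .u = 0)
    (hg : (counterSem (α := CodeSymbol) x b).guard σ := by assumption) :
    Prog.Runs (counterSem x b) N (swap p p') σ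
      ((σ.setC p (σ.ctr p')).setC p' (σ.ctr p)) := by
  obtain ⟨a1, a2, a3⟩ := hp
  obtain ⟨b1, b2, b3⟩ := hp'
  refine (runs_addTo (c := p) (d := .u) h1 ht a1 (by simp) a2).seq
    ((runs_clear (by simpa [a2])).seq
    ((runs_addTo (c := p') (d := p) (by simpa [b2, hpp.symm]) (by simp [ht, a1.symm]) b1 a1
      hpp.symm).seq
    ((runs_clear (by simpa [b2, hpp.symm])).seq
    ((runs_addTo (c := .u) (d := p') (by simpa [a2.symm, b2.symm, hu])
      (by simp [a1.symm, b1.symm, ht]) (by simp) b1 b2.symm).seq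
    ((runs_clear (by simpa [a2.symm, b2.symm, hu])).to_eq ?_)))))
  ext e <;> simp [b2, hpp.symm, hu, a2.symm, b2.symm]
  grind

/-- Execute `body` for each occurrence of a literal, with pointers to the literal and to the other
literal of its clause. -/
def forOcc (p p' : Ctr) (body : SatProg Q Γ k) : SatProg Q Γ k :=
  .seq (.act (.inc p)) (.seq (load p) (.seq
    (.loop (fun r _ => r.sym != .rightEnd)
      (.seq (addTo p' p) (.seq (skipLit p') (.seq (load p') (.seq
        (.ite (fun r _ => r.sym == .symbol .hash)
          (.seq (clear p') (.seq (addTo p' p) (.seq resetSym body)))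
          (.seq resetSym (.seq body (.seq (swap p p') body))))
        (.seq (skipLit p) (.seq (.act (.inc p)) (.seq (clear p') (load p)))))))))
    (.seq resetSym (clear p))))

/-- `Inv L` describes the store after the occurrences in `L` have been treated, with both pointers
at zero; the pointers are inserted only around the body. Invariants need not mention positions in
the code, and loops can be nested. -/
theorem runs_forOcc {φ : CNFFormula} (hφ : ∀ C ∈ φ, 1 ≤ C.length ∧ C.length ≤ 2)
    (hN : φ.encode.length + 1 ≤ N) {p p' : Ctr} (hp : p.IsPtr) (hp' : p'.IsPtr) (hpp : p ≠ p')
    {body : SatProg Q Γ k} (Inv : List Occ → SatStore Q Γ k → Prop)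
    (hInv : ∀ L τ, Inv L τ → Idle φ.encode b τ ∧ τ.ctr p = 0 ∧ τ.ctr p' = 0)
    (hbody : ∀ L o L', φ.occs = L ++ o :: L' → ∀ τ, Inv L τ → ∃ τ',
      Prog.Runs (counterSem φ.encode b) N body ((τ.setC p o.ptr).setC p' o.ptr')
        ((τ'.setC p o.ptr).setC p' o.ptr') ∧ Inv (L ++ [o]) τ')
    (h0 : Inv [] σ) :
    ∃ σ', Prog.Runs (counterSem φ.encode b) N (forOcc p p' body) σ σ' ∧ Inv φ.occs σ' := by
  obtain ⟨hσ, hσp, hσp'⟩ := hInv _ _ h0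
  have hg := hσ.guard
  have hplt := hp.1
  have hplt' := hp'.1
  have hlen := length_le_length_encode φ
  let off : ℕ → ℕ := fun j => 1 + (CNFFormula.encode (φ.take j)).length
  have hoff : off φ.length = φ.encode.length + 1 := by simp [off, add_comm]
  -- One iteration treats one clause. Between iterations `p` points to the beginning of clause `j`
  -- and `sym` is the symbol there, which is the right endmarker exactly when no clause is left.
  have hloop := Prog.Runs.loop_inv (m := counterSem φ.encode b) (N := N)
    (σ := (σ.setC p 1).setR fun r => { r with sym := readInput φ.encode 1 })
    (b := fun r _ => r.sym != .rightEnd)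
    (P := .seq (addTo p' p) (.seq (skipLit p') (.seq (load p') (.seq
        (.ite (fun r _ => r.sym == .symbol .hash)
          (.seq (clear p') (.seq (addTo p' p) (.seq resetSym body)))
          (.seq resetSym (.seq body (.seq (swap p p') body))))
        (.seq (skipLit p) (.seq (.act (.inc p)) (.seq (clear p') (load p))))))))
    (I := fun j τ => ∃ τ₀, Inv (occsFrom 1 (φ.take j)) τ₀ ∧
      τ = (τ₀.setC p (off j)).setR fun r => { r with sym := readInput φ.encode (off j) })
    (n := φ.length) (by omega) ⟨σ, by simpa [occsFrom] using h0, by simp [off, CNFFormula.encode]⟩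
    ?_ ?_
  · obtain ⟨σ₁, h1, τ₀, hτ, rfl⟩ := hloop
    obtain ⟨hi, e1, e2⟩ := hInv _ _ hτ
    have hgi := hi.guard
    refine ⟨τ₀, (runs_inc p).seq ((runs_load (c := p) (by simp [hσp]) hN
      (by simp [hplt.symm, hσ.t]) hplt (by simp [hσ.ih])).seq (Prog.Runs.seq (h1.from_eq ?_)
        ((runs_regOp _).seq ((runs_clear ?_).to_eq ?_)))), by simpa [CNFFormula.occs] using hτ⟩
    · ext e <;> simp [hσp]
    · simp [hoff, hN]
    · ext e <;> simp
      · exact hi.sym.symm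
      · grind
  · rintro j hj τ ⟨τ₀, hτ, rfl⟩
    obtain ⟨hi, e1, e2⟩ := hInv _ _ hτ
    have hgi := hi.guard
    have hsplit : φ = φ.take j ++ φ[j] :: φ.drop (j + 1) := by
      rw [List.cons_getElem_drop_succ, List.take_append_drop]
    have hC := hφ φ[j] (List.getElem_mem hj)
    have henc : φ.encode = (CNFFormula.encode (φ.take j)) ++ encClause φ[j] ++
        (CNFFormula.encode (φ.drop (j + 1))) := by
      conv_lhs => rw [hsplit]
      simp only [CNFFormula.encode_eq, List.flatMap_append, List.flatMap_cons, List.append_assoc]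
    have hocc : φ.occs = occsFrom 1 (φ.take j) ++ clauseOccs (off j) φ[j] ++
        occsFrom (off j + (encClause φ[j]).length) (φ.drop (j + 1)) := by
      conv_lhs => rw [hsplit]
      rw [CNFFormula.occs, occsFrom_append, occsFrom, List.append_assoc]
    have hocc' : occsFrom 1 (φ.take (j + 1)) =
        occsFrom 1 (φ.take j) ++ clauseOccs (off j) φ[j] := by
      rw [← List.take_concat_get' φ j hj, occsFrom_append]
      simp [occsFrom, off]
    have hoff' : off (j + 1) = off j + (encClause φ[j]).length := by
      simp only [off]
      rw [← List.take_concat_get' φ j hj]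
      simp only [CNFFormula.encode_eq, List.flatMap_append, List.flatMap_cons, List.flatMap_nil,
        List.append_nil, List.length_append, add_assoc]
    have hend : off (j + 1) ≤ φ.encode.length + 1 := by
      rw [henc, hoff']
      simp [off]
      omega
    have hread : ∀ i (h : i < (encClause φ[j]).length),
        readInput φ.encode (off j + i) = .symbol (encClause φ[j])[i] := by
      intro i h
      rw [henc, show off j + i = (CNFFormula.encode (φ.take j)).length + 1 + i by
        simp only [off]; omega, readInput_append h]
    have hpos : 0 < (encClause φ[j]).length := by simp [encClause]
    have hlit : ∀ o ∈ clauseOccs (off j) φ[j], LitAt φ.encode o.ptr o.lit := fun o ho => by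
      rw [henc]
      refine (litAt_of_mem_clauseOccs ?_).1
      rwa [add_comm]
    refine ⟨by
      have := hread 0 hpos
      rw [add_zero] at this
      simp [counterSem, this], ?_⟩
    -- The common beginning of an iteration: `p'` is moved behind the first literal, where a `#`
    -- means that the clause has no second one.
    have hfirst : ∀ l, LitAt φ.encode (off j) l → ∀ P₂ τ', Prog.Runs (counterSem φ.encode b) N P₂
        (((τ₀.setC p (off j)).setC p' (off j + (encLit l).length)).setR fun r =>
          { r with sym := readInput φ.encode (off j + (encLit l).length) }) τ' →
        Prog.Runs (counterSem φ.encode b) N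
          (.seq (addTo p' p) (.seq (skipLit p') (.seq (load p') P₂)))
          ((τ₀.setC p (off j)).setR fun r => { r with sym := readInput φ.encode (off j) }) τ' := by
      intro l hl P₂ τ' h2
      have := hl.le
      refine (runs_addTo (c := p) (d := p') (by simp; omega) (by simp [hplt.symm, hi.t]) hplt hplt'
        hpp).seq ((runs_skipLit (p := p') (l := l) (by simpa [e2, hpp.symm]) hN
        (by simp [hplt.symm, hplt'.symm, hi.t]) hplt' (by simp [hi.ih])).seq
        ((runs_load (c := p') (by simpa [e2, hpp.symm]) hN
        (by simp [hplt.symm, hplt'.symm, hi.t]) hplt' (by simp [hi.ih])).seq (h2.from_eq ?_)))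
      ext e <;> simp [e2, hpp.symm]
      grind
    -- The common end of an iteration: `p` points to the last literal of the clause, in the case of
    -- two literals because the pointers were exchanged. Skipping it and the closing `#` leads to
    -- the next clause.
    have hlast : ∀ l q q' τ₁, LitAt φ.encode q l → q' ≤ N →
        q + (encLit l).length + 1 = off (j + 1) →
        Inv (occsFrom 1 (φ.take (j + 1))) τ₁ →
        Prog.Runs (counterSem φ.encode b) N
          (.seq (skipLit p) (.seq (.act (.inc p)) (.seq (clear p') (load p))))
          ((τ₁.setC p q).setC p' q')
          ((τ₁.setC p (off (j + 1))).setR fun r =>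
            { r with sym := readInput φ.encode (off (j + 1)) }) := by
      intro l q q' τ₁ hl hq' hq hτ₁
      obtain ⟨hi₁, d1, d2⟩ := hInv _ _ hτ₁
      have hg₁ := hi₁.guard
      refine (runs_skipLit (p := p) (l := l) (by simpa [hpp]) hN
        (by simp [hplt.symm, hplt'.symm, hi₁.t]) hplt (by simp [hi₁.ih])).seq
        ((runs_inc p).seq ((runs_clear (by simpa [hpp.symm])).seq
        ((runs_load (c := p) (by simp [hpp]; omega) hN
          (by simp [hplt.symm, hplt'.symm, hi₁.t]) hplt (by simp [hi₁.ih])).to_eq ?_)))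
      ext e <;> simp [hpp, hq]
      grind
    rw [hocc'] at hlast
    rw [hocc']
    generalize φ[j] = C at *
    match C with
    | [] => simp at hC
    | [l] =>
      have hl : LitAt φ.encode (off j) l :=
        hlit ⟨off j, off j, l, l⟩ (by simp [clauseOccs])
      have hle := hl.le
      obtain ⟨τ₁, hb₁, hI₁⟩ := hbody _ ⟨off j, off j, l, l⟩ _
        (by rw [hocc, List.append_assoc]; rfl) _ hτ
      simp only [encClause, List.flatMap_cons, List.flatMap_nil, List.append_nil,
        List.length_append, List.length_singleton] at hread hoff'
      refine ⟨_, hfirst l hl _ _ (Prog.Runs.seq (Prog.Runs.iteTrue ?_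
        ((runs_clear (by simp; omega)).seq ((runs_addTo (c := p) (d := p') (by simp [hpp]; omega)
          (by simp [hplt.symm, hplt'.symm, hi.t]) hplt hplt' hpp).seq
          ((runs_regOp _).seq (hb₁.from_eq ?_)))))
        (hlast l _ _ τ₁ hl (by simp; omega) (by simp [hoff']; omega) hI₁)), τ₁, hI₁, rfl⟩
      · have := hread (encLit l).length (by omega)
        simp [counterSem, this]
      · ext e <;> simp [hpp, hi.sym]
        grind
    | [l, l'] =>
      have hl : LitAt φ.encode (off j) l :=
        hlit ⟨off j, off j + (encLit l).length, l, l'⟩ (by simp [clauseOccs])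
      have hl' : LitAt φ.encode (off j + (encLit l).length) l' :=
        hlit ⟨off j + (encLit l).length, off j, l', l⟩ (by simp [clauseOccs])
      have hle := hl.le
      have hle' := hl'.le
      obtain ⟨τ₁, hb₁, hI₁⟩ := hbody _ ⟨off j, off j + (encLit l).length, l, l'⟩ _
        (by rw [hocc, List.append_assoc]; rfl) _ hτ
      obtain ⟨hi₁, d1, d2⟩ := hInv _ _ hI₁
      have hg₁ := hi₁.guard
      obtain ⟨τ₂, hb₂, hI₂⟩ := hbody _ ⟨off j + (encLit l).length, off j, l', l⟩ _
        (by rw [hocc, List.append_assoc, List.append_assoc]; rfl) _ hI₁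
      rw [List.append_assoc] at hI₂
      simp only [encClause, List.flatMap_cons, List.flatMap_nil, List.append_nil,
        List.length_append, List.length_singleton] at hread hoff'
      refine ⟨_, hfirst l hl _ _ (Prog.Runs.seq (Prog.Runs.iteFalse ?_
        ((runs_regOp _).seq (Prog.Runs.seq (hb₁.from_eq ?_) ((runs_swap hp hp' hpp
          (by simp [hpp]; omega) (by simp; omega) (by simp [hplt.symm, hplt'.symm, hi₁.t])
          (by simp [hp.2.1.symm, hp'.2.1.symm, hi₁.u])).seq (hb₂.from_eq ?_)))))
        (hlast l' _ _ τ₂ hl' (by simp; omega) (by simp [hoff']; omega) hI₂)), τ₂, hI₂, rfl⟩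
      · have := hl'.readInput_bit (i := 0) (by simp [litBits])
        rw [add_zero] at this
        simp [counterSem, this, ofBool_ne_hash]
      · ext e <;> simp [hi.sym]
      · ext e <;> simp [hpp]
        grind
    | _ :: _ :: _ :: _ => simp at hC
  · rintro τ ⟨τ₀, hτ, rfl⟩
    simp [counterSem, hoff, readInput_length]

end OccurrenceLoops

/-! ### The automata for satisfiability queries -/

/-- The complementary literal. -/
def litNeg (l : SatLiteral) : SatLiteral := (l.1, !l.2)

/-- The automaton whose states are the literal occurrences in `L`. A state stands for the
assumption that the literal is false; transitions lead to the assumptions implied by this, and a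
state is final if it contradicts the initial assumption. -/
def queryNFA (L : List Occ) (s : Fin L.length) : OneNFA where
  numStates := L.length
  numLetters := 1
  numLetters_pos := one_pos
  trans o _ := {o' | L[o'].lit = litNeg L[o].lit'}
  start := s
  final := {o | L[o].lit = litNeg L[s].lit}

/-- The instance of the search problem that asks for a word of length `|L|`. -/
def queryInstance (L : List Occ) (s : Fin L.length) : Search1NFAInstance := ⟨queryNFA L s, L.length⟩

/-- The code of a state of the query automaton. -/
def encRow (L : List Occ) (s o : Occ) : List CodeSymbol :=
  [.ofBool (decide (o.ptr = s.ptr)), .ofBool (decide (o.lit = litNeg s.lit)), .hash] ++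
    L.map (fun o' => .ofBool (decide (o'.lit = litNeg o.lit'))) ++ [.hash, .hash]

theorem finRange_map_getElem {α β : Type} (L : List α) (f : α → β) :
    (List.finRange L.length).map (fun i => f L[i]) = L.map f := by
  apply List.ext_getElem <;> simp

/-- In this form the code can be produced by nested loops over the occurrences: every variable bit
of a row is a comparison of two pointers or of two literals. The bit for the initial state compares
positions, which identify the occurrences by `hL`. -/
theorem encode_queryInstance (L : List Occ) (hL : (L.map Occ.ptr).Nodup) (s : Fin L.length) :
    (queryInstance L s).encode =
      L.flatMap (fun _ => [.one]) ++ .hash :: L.flatMap (encRow L L[s]) := by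
  have h1 : L.flatMap (fun _ => [CodeSymbol.one]) = List.replicate L.length .one := by
    clear hL s
    induction L with
    | nil => rfl
    | cons o L ih => rw [List.flatMap_cons, ih]; rfl
  have h2 : (queryNFA L s).encode = L.flatMap (encRow L L[s]) := by
    change ((List.finRange L.length).flatMap fun o =>
      [CodeSymbol.ofBool (decide (o = s)), CodeSymbol.ofBool (decide (o ∈
        ({o | L[o].lit = litNeg L[s].lit} : Finset (Fin L.length))))] ++
      ((List.finRange 1).flatMap fun _ => CodeSymbol.hash :: (List.finRange L.length).map fun o' =>
        CodeSymbol.ofBool (decide (o' ∈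
          ({o' | L[o'].lit = litNeg L[o].lit'} : Finset (Fin L.length))))) ++ [.hash, .hash]) = _
    rw [List.flatMap_def, List.flatMap_def, ← finRange_map_getElem L (encRow L L[s])]
    congr 1
    refine List.map_congr_left fun o _ => ?_
    have h3 : (decide (o = s) : Bool) = decide (L[o].ptr = L[s].ptr) := by
      rw [Bool.eq_iff_iff, decide_eq_true_iff, decide_eq_true_iff]
      refine ⟨fun h => by rw [h], fun h => ?_⟩
      have := (List.nodup_iff_injective_getElem.mp hL) (a₁ := ⟨o, by simp⟩) (a₂ := ⟨s, by simp⟩)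
        (by simpa using h)
      exact Fin.ext (by simpa using this)
    rw [encRow, ← finRange_map_getElem L
      (fun o' => CodeSymbol.ofBool (decide (o'.lit = litNeg L[o].lit'))), h3]
    simp [List.finRange_succ]
  rw [Search1NFAInstance.encode, show (queryInstance L s).nfa.encode = _ from h2, h1]
  simp [queryInstance]

theorem ptr_of_mem_clauseOccs {p : ℕ} {C : List SatLiteral} {o : Occ} (h : o ∈ clauseOccs p C) :
    p ≤ o.ptr ∧ o.ptr < p + (encClause C).length := by
  match C with
  | [] => simp [clauseOccs] at h
  | [l] =>
    simp only [clauseOccs, List.mem_singleton] at h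
    subst h
    simp [encClause]
  | [l, l'] =>
    simp only [clauseOccs, List.mem_cons, List.not_mem_nil, or_false] at h
    rcases h with rfl | rfl <;> simp [encClause]
  | _ :: _ :: _ :: _ => simp [clauseOccs] at h

theorem le_ptr_of_mem_occsFrom (φ : CNFFormula) : ∀ (p : ℕ) (o : Occ), o ∈ occsFrom p φ →
    p ≤ o.ptr := by
  induction φ with
  | nil => simp [occsFrom]
  | cons C φ ih =>
    intro p o h
    rw [occsFrom, List.mem_append] at h
    rcases h with h | h
    · exact (ptr_of_mem_clauseOccs h).1
    · exact (Nat.le_add_right _ _).trans (ih _ _ h)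

theorem nodup_ptr_occsFrom (φ : CNFFormula) : ∀ p, ((occsFrom p φ).map Occ.ptr).Nodup := by
  induction φ with
  | nil => simp [occsFrom]
  | cons C φ ih =>
    intro p
    rw [occsFrom, List.map_append, List.nodup_append]
    refine ⟨?_, ih _, ?_⟩
    · match C with
      | [] => simp [clauseOccs]
      | [l] => simp [clauseOccs]
      | [l, l'] => simp [clauseOccs, length_encLit]
      | _ :: _ :: _ :: _ => simp [clauseOccs]
    · intro a ha c hc
      obtain ⟨o, ho, rfl⟩ := List.mem_map.mp ha
      obtain ⟨o', ho', rfl⟩ := List.mem_map.mp hc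
      have := (ptr_of_mem_clauseOccs ho).2
      have := le_ptr_of_mem_occsFrom _ _ _ ho'
      omega

theorem nodup_ptr_occs (φ : CNFFormula) : (φ.occs.map Occ.ptr).Nodup := nodup_ptr_occsFrom φ 1

/-! ### Fetching symbols of a query -/

/-- Wait for the end of a countdown and keep the symbol that comes then. -/
def feed : ℕ × Option (InputSymbol CodeSymbol) → InputSymbol CodeSymbol →
    ℕ × Option (InputSymbol CodeSymbol)
  | (c, some a), _ => (c, some a)
  | (0, none), a => (0, some a)
  | (c + 1, none), _ => (c, none)

theorem foldl_feed_some (L : List (InputSymbol CodeSymbol)) (c : ℕ) (a : InputSymbol CodeSymbol) :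
    L.foldl feed (c, some a) = (c, some a) := by
  induction L with
  | nil => rfl
  | cons d L ih => exact ih

theorem foldl_feed_none (L : List (InputSymbol CodeSymbol)) : ∀ c,
    (L.foldl feed (c, none)).2 = L[c]? ∧ (L.foldl feed (c, none)).1 ≤ c := by
  induction L with
  | nil => simp
  | cons d L ih =>
    intro c
    rcases c with _ | c
    · simp [feed, foldl_feed_some]
    · simpa [feed] using ⟨(ih c).1, (ih c).2.trans (Nat.le_succ c)⟩

/-- The left endmarker is put in front of the code so that the countdown starts exactly at the head
position, position `0` included. If the code is exhausted before anything is fetched, the head is at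
the right endmarker. -/
theorem getD_foldl_feed (y : List CodeSymbol) (h : ℕ) :
    ((InputSymbol.leftEnd :: y.map .symbol).foldl feed (h, none)).2.getD .rightEnd =
      MultiTapeTM.readInput y h := by
  rw [(foldl_feed_none _ h).1]
  rcases h with _ | h
  · rfl
  · simp only [List.getElem?_cons_succ, List.getElem?_map, MultiTapeTM.readInput]
    rcases y[h]? with _ | a <;> rfl

section Fetch

open MultiTapeTM

variable {Q Γ : Type} {k : ℕ} {x : List CodeSymbol} {b N : ℕ} {σ : SatStore Q Γ k}

/-- The effect of the output of a list of symbols during the countdown. -/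
def CounterStore.feedAll (σ : SatStore Q Γ k) (L : List (InputSymbol CodeSymbol)) :
    SatStore Q Γ k :=
  (σ.setC .cnt (L.foldl feed (σ.ctr .cnt, σ.reg.fetched)).1).setR fun r =>
    { r with fetched := (L.foldl feed (σ.ctr .cnt, σ.reg.fetched)).2 }

theorem feedAll_append (L L' : List (InputSymbol CodeSymbol)) :
    (σ.feedAll L).feedAll L' = σ.feedAll (L ++ L') := by
  simp only [CounterStore.feedAll, CounterStore.setR_ctr, CounterStore.setC_ctr, if_true,
    CounterStore.setR_reg, List.foldl_append, CounterStore.setR_setC, CounterStore.setR_setR,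
    CounterStore.setC_setC]

theorem feedAll_nil : σ.feedAll [] = σ := by
  simp only [CounterStore.feedAll, List.foldl_nil, CounterStore.setC_self]
  rfl

theorem feedAll_setC {p : Ctr} (hp : p ≠ .cnt) (v : ℕ) (L : List (InputSymbol CodeSymbol)) :
    (σ.setC p v).feedAll L = (σ.feedAll L).setC p v := by
  ext e <;> simp [CounterStore.feedAll, hp.symm]
  grind

theorem feedAll_ctr {p : Ctr} (hp : p ≠ .cnt) (L : List (InputSymbol CodeSymbol)) :
    (σ.feedAll L).ctr p = σ.ctr p := by
  simp [CounterStore.feedAll, hp]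

theorem Idle.feedAll (h : Idle x b σ) (L : List (InputSymbol CodeSymbol)) :
    Idle x b (σ.feedAll L) :=
  ⟨h.guard, by simp [CounterStore.feedAll, h.t], by simp [CounterStore.feedAll, h.u],
    by simp [CounterStore.feedAll, h.v], h.ih, h.sym, h.sym', h.flag⟩

theorem Idle.setC (h : Idle x b σ) {p : Ctr} (hp : p.IsPtr) (v : ℕ) : Idle x b (σ.setC p v) :=
  ⟨h.guard, by simp [hp.1.symm, h.t], by simp [hp.2.1.symm, h.u],
    by simp [hp.2.2.symm, h.v], h.ih, h.sym, h.sym', h.flag⟩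

/-- Output a symbol during the countdown. -/
def emit (f : Reg Q → InputSymbol CodeSymbol) : SatProg Q Γ k :=
  .ite (fun r z => r.fetched.isNone && !z .cnt) (.act (.dec .cnt))
    (regOp fun r _ _ => if r.fetched.isNone then { r with fetched := some (f r) } else r)

theorem runs_emit (f : Reg Q → InputSymbol CodeSymbol)
    (hg : (counterSem (α := CodeSymbol) x b).guard σ := by assumption) :
    Prog.Runs (counterSem x b) N (emit f) σ (σ.feedAll [f σ.reg]) := by
  rcases hf : σ.reg.fetched with _ | a
  · rcases hc : σ.ctr .cnt with _ | c
    · refine .iteFalse (by simp [counterSem, hf, hc]) ((runs_regOp _).to_eq ?_)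
      ext e <;> simp [CounterStore.feedAll, hf, hc, feed]
      grind
    · refine .iteTrue (by simp [counterSem, hf, hc]) ((runs_dec _).to_eq ?_)
      ext e <;> simp [CounterStore.feedAll, hf, hc, feed]
  · refine .iteFalse (by simp [counterSem, hf]) ((runs_regOp _).to_eq ?_)
    ext e <;> simp [CounterStore.feedAll, hf, feed]
    grind

/-- Output the flag as a symbol and reset it. -/
def emitFlag : SatProg Q Γ k :=
  .seq (emit fun r => .symbol (.ofBool r.flag)) (regOp fun r _ _ => { r with flag := false })

theorem runs_emitFlag (hσ : Idle x b σ) (f : Bool) :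
    Prog.Runs (counterSem x b) N emitFlag (σ.setR fun r => { r with flag := f })
      (σ.feedAll [.symbol (.ofBool f)]) := by
  have hg := hσ.guard
  refine (runs_emit _).seq ((runs_regOp _).to_eq ?_)
  ext e <;> simp [CounterStore.feedAll, hσ.flag]

theorem runs_eqCtr_emitFlag (hσ : Idle x b σ) {c d : Ctr} (hc : σ.ctr c ≤ N) (hct : c ≠ .t)
    (hdt : d ≠ .t) (hcd : c ≠ d) :
    Prog.Runs (counterSem x b) N (.seq (eqCtr c d) emitFlag) σ
      (σ.feedAll [.symbol (.ofBool (decide (σ.ctr c = σ.ctr d)))]) :=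
  (runs_eqCtr hc hσ.t hct hdt hcd hσ.guard).seq (runs_emitFlag hσ _)

theorem runs_cmpLit_emitFlag (hσ : Idle x b σ) (hN : x.length + 1 ≤ N) {c d : Ctr}
    {l l' : SatLiteral} (hc : LitAt x (σ.ctr c) l) (hd : LitAt x (σ.ctr d) l') (hc' : c.IsPtr)
    (hd' : d.IsPtr) :
    Prog.Runs (counterSem x b) N (.seq (cmpLit c d) emitFlag) σ
      (σ.feedAll [.symbol (.ofBool (decide (l' = litNeg l)))]) :=
  (runs_cmpLit hσ hN hc hd hc' hd').seq (runs_emitFlag hσ _)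

/-- Although nothing is stored, the countdown treats consecutive outputs like their concatenation
(`feedAll_append`); the loop invariant is therefore just the output so far. -/
theorem runs_forOcc_feed {φ : CNFFormula} (hφ : ∀ C ∈ φ, 1 ≤ C.length ∧ C.length ≤ 2)
    (hN : φ.encode.length + 1 ≤ N) {p p' : Ctr} (hp : p.IsPtr) (hp' : p'.IsPtr) (hpp : p ≠ p')
    (hpc : p ≠ .cnt) (hpc' : p' ≠ .cnt) {body : SatProg Q Γ k}
    (f : Occ → List (InputSymbol CodeSymbol)) (hσ : Idle φ.encode b σ) (h : σ.ctr p = 0)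
    (h' : σ.ctr p' = 0)
    (hbody : ∀ o ∈ φ.occs, ∀ τ : SatStore Q Γ k, Idle φ.encode b τ → τ.ctr p = o.ptr →
      τ.ctr p' = o.ptr' → (∀ c, c ≠ .cnt → c ≠ p → c ≠ p' → τ.ctr c = σ.ctr c) →
      Prog.Runs (counterSem φ.encode b) N body τ (τ.feedAll (f o))) :
    Prog.Runs (counterSem φ.encode b) N (forOcc p p' body) σ (σ.feedAll (φ.occs.flatMap f)) := by
  obtain ⟨σ', h1, rfl⟩ := runs_forOcc (σ := σ) (b := b) (body := body) hφ hN hp hp' hpp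
    (fun L τ => τ = σ.feedAll (L.flatMap f))
    (by
      rintro L τ rfl
      exact ⟨hσ.feedAll _, by rw [feedAll_ctr hpc, h], by rw [feedAll_ctr hpc', h']⟩)
    (by
      rintro L o L' hL τ rfl
      refine ⟨_, ?_, rfl⟩
      have := hbody o (by simp [hL])
        (((σ.feedAll (L.flatMap f)).setC p o.ptr).setC p' o.ptr')
        (((hσ.feedAll _).setC hp _).setC hp' _) (by simp [hpp]) (by simp)
        (fun c h1 h2 h3 => by simp [h2, h3, feedAll_ctr h1])
      rw [feedAll_setC hpc', feedAll_setC hpc, feedAll_append] at this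
      simpa using this)
    (by simp [feedAll_nil])
  exact h1

/-- Output the code of the query for the occurrence to which the counter `s` points. -/
def genQuery : SatProg Q Γ k :=
  .seq (emit fun _ => .leftEnd) (.seq (forOcc .q .q' (emit fun _ => .symbol .one))
    (.seq (emit fun _ => .symbol .hash) (forOcc .q .q'
      (.seq (.seq (eqCtr .q .s) emitFlag) (.seq (.seq (cmpLit .s .q) emitFlag)
        (.seq (emit fun _ => .symbol .hash)
        (.seq (forOcc .w .w' (.seq (cmpLit .q' .w) emitFlag))
        (.seq (emit fun _ => .symbol .hash) (emit fun _ => .symbol .hash)))))))))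

theorem runs_genQuery {φ : CNFFormula} (hφ : ∀ C ∈ φ, 1 ≤ C.length ∧ C.length ≤ 2)
    (hN : φ.encode.length + 1 ≤ N) (hσ : Idle φ.encode b σ) (hq : σ.ctr .q = 0)
    (hq' : σ.ctr .q' = 0) (hw : σ.ctr .w = 0) (hw' : σ.ctr .w' = 0) (s : Fin φ.occs.length)
    (hs : σ.ctr .s = φ.occs[s].ptr) :
    Prog.Runs (counterSem φ.encode b) N genQuery σ
      (σ.feedAll (.leftEnd :: (queryInstance φ.occs s).encode.map .symbol)) := by
  have hg := hσ.guard
  have hptr : ∀ o ∈ φ.occs, o.ptr ≤ N := fun o ho => by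
    have := (litAt_of_mem_occs ho).1.le
    omega
  rw [encode_queryInstance _ (nodup_ptr_occs φ)]
  have h1 := (runs_emit (x := φ.encode) (N := N) (fun _ => .leftEnd) hσ.guard)
  have h2 := runs_forOcc_feed (N := N) (p := .q) (p' := .q')
    (body := emit fun _ => .symbol .one) hφ hN
    (by simp [Ctr.IsPtr]) (by simp [Ctr.IsPtr]) (by simp) (by simp) (by simp)
    (fun _ => [.symbol .one]) (hσ.feedAll [.leftEnd]) (by simp [feedAll_ctr, hq])
    (by simp [feedAll_ctr, hq']) (fun o _ τ hτ _ _ _ => runs_emit _ hτ.guard)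
  rw [feedAll_append] at h2
  have h3 := (runs_emit (x := φ.encode) (N := N) (fun _ => .symbol .hash)
    (hσ.feedAll ([.leftEnd] ++ φ.occs.flatMap fun _ => [.symbol .one])).guard)
  rw [feedAll_append] at h3
  have h4 := runs_forOcc_feed (N := N) (p := .q) (p' := .q')
    (body := (.seq (.seq (eqCtr .q .s) emitFlag) (.seq (.seq (cmpLit .s .q) emitFlag)
        (.seq (emit fun _ => .symbol .hash)
        (.seq (forOcc .w .w' (.seq (cmpLit .q' .w) emitFlag))
        (.seq (emit fun _ => .symbol .hash) (emit fun _ => .symbol .hash))))))) hφ hN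
    (by simp [Ctr.IsPtr]) (by simp [Ctr.IsPtr]) (by simp) (by simp) (by simp)
    (fun o => (encRow φ.occs φ.occs[s] o).map .symbol)
    (hσ.feedAll ([.leftEnd] ++ φ.occs.flatMap (fun _ => [.symbol .one]) ++ [.symbol .hash]))
    (by simp [feedAll_ctr, hq]) (by simp [feedAll_ctr, hq']) ?_
  · rw [feedAll_append] at h4
    refine h1.seq (h2.seq (h3.seq (h4.to_eq ?_)))
    congr 1
    simp [List.map_flatMap]
  · intro o ho τ hτ e1 e2 e3
    obtain ⟨ho1, ho2⟩ := litAt_of_mem_occs ho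
    have hs1 := (litAt_of_mem_occs (List.getElem_mem s.2)).1
    have es : τ.ctr .s = φ.occs[s].ptr := by
      rw [e3 _ (by simp) (by simp) (by simp), feedAll_ctr (by simp), hs]
    have ew : τ.ctr .w = 0 := by
      rw [e3 _ (by simp) (by simp) (by simp), feedAll_ctr (by simp), hw]
    have ew' : τ.ctr .w' = 0 := by
      rw [e3 _ (by simp) (by simp) (by simp), feedAll_ctr (by simp), hw']
    have r1 := runs_eqCtr_emitFlag (N := N) hτ (c := .q) (d := .s) (by rw [e1]; exact hptr o ho)
      (by simp) (by simp) (by simp)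
    rw [e1, es] at r1
    have r2 := runs_cmpLit_emitFlag (N := N)
      (hτ.feedAll [.symbol (.ofBool (decide (o.ptr = φ.occs[s].ptr)))]) hN (c := .s) (d := .q)
      (by rw [feedAll_ctr (by simp), es]; exact hs1)
      (by rw [feedAll_ctr (by simp), e1]; exact ho1) (by simp [Ctr.IsPtr]) (by simp [Ctr.IsPtr])
    rw [feedAll_append] at r2
    refine r1.seq (r2.seq ((runs_emit _ (hτ.feedAll _).guard).seq (Prog.Runs.seq
      (runs_forOcc_feed (p := .w) (p' := .w') hφ hN (by simp [Ctr.IsPtr]) (by simp [Ctr.IsPtr])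
        (by simp) (by simp) (by simp)
        (fun o' => [.symbol (.ofBool (decide (o'.lit = litNeg o.lit')))])
        ((hτ.feedAll _).feedAll _) (by simp [feedAll_ctr, ew]) (by simp [feedAll_ctr, ew']) ?_)
      ((runs_emit _ (((hτ.feedAll _).feedAll _).feedAll _).guard).seq
        ((runs_emit _ ((((hτ.feedAll _).feedAll _).feedAll _).feedAll _).guard).to_eq ?_)))))
    · intro o' ho' τ' hτ' d1 d2 d3
      refine runs_cmpLit_emitFlag hτ' hN ?_ ?_ (by simp [Ctr.IsPtr]) (by simp [Ctr.IsPtr])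
      · rw [d3 _ (by simp) (by simp) (by simp), feedAll_ctr (by simp), feedAll_ctr (by simp), e2]
        exact ho2
      · rw [d1]
        exact (litAt_of_mem_occs ho').1
    · simp only [feedAll_append]
      congr 1
      simp only [encRow]
      simp [List.map_eq_flatMap, List.flatMap_assoc]

/-- Determine the symbol under the virtual input head. -/
def fetch : SatProg Q Γ k :=
  .seq (addTo .cnt .h) (.seq genQuery (.seq (clear .cnt)
    (regOp fun r _ _ => { r with sym := r.fetched.getD .rightEnd, fetched := none })))

/-- Reading a single symbol costs the generation of the whole query. This is the exchange of time
for space on which the reduction rests. -/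
theorem runs_fetch {φ : CNFFormula} (hφ : ∀ C ∈ φ, 1 ≤ C.length ∧ C.length ≤ 2)
    (hN : φ.encode.length + 1 ≤ N) (hσ : Idle φ.encode b σ) (hq : σ.ctr .q = 0)
    (hq' : σ.ctr .q' = 0) (hw : σ.ctr .w = 0) (hw' : σ.ctr .w' = 0) (s : Fin φ.occs.length)
    (hs : σ.ctr .s = φ.occs[s].ptr) (hh : σ.ctr .h ≤ N) (hc : σ.ctr .cnt = 0)
    (hf : σ.reg.fetched = none) :
    Prog.Runs (counterSem φ.encode b) N fetch σ (σ.setR fun r =>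
      { r with sym := readInput (queryInstance φ.occs s).encode (σ.ctr .h) }) := by
  have hg := hσ.guard
  have h1 := runs_addTo (x := φ.encode) (b := b) (c := .h) (d := .cnt) hh hσ.t (by simp) (by simp)
    (by simp)
  rw [hc, zero_add] at h1
  have h2 := runs_genQuery hφ hN (hσ.setC (p := .cnt) (by simp [Ctr.IsPtr]) (σ.ctr .h)) (by simpa)
    (by simpa) (by simpa) (by simpa) s (by simpa)
  refine h1.seq (h2.seq ((runs_clear ?_ (by exact hg)).seq ((runs_regOp _ (by exact hg)).to_eq ?_)))
  · simp only [CounterStore.feedAll, CounterStore.setR_ctr, CounterStore.setC_ctr, if_true,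
      CounterStore.setC_reg, hf]
    exact (foldl_feed_none _ _).2.trans hh
  · have := getD_foldl_feed (queryInstance φ.occs s).encode (σ.ctr .h)
    ext e <;> simp [CounterStore.feedAll, hf]
    · simpa using this
    · have := hc
      grind

end Fetch

/-! ### Simulation of a machine on a query -/

/-! ### Scanning all work tapes in parallel -/

section Sweep

variable {Q Γ : Type} {k : ℕ} {x : List CodeSymbol} {b N : ℕ} {σ : SatStore Q Γ k}

/-- The work tapes after the cells up to distance `n` in direction `d` have been rewritten. -/
def sweptTape (wr : Γ → Γ) (d : ℤ) (tape : Fin k → ℤ → Γ) (head : Fin k → ℤ) (n : Fin k → ℕ) :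
    Fin k → ℤ → Γ :=
  fun j z => if 0 ≤ d * (z - head j) ∧ d * (z - head j) < n j then wr (tape j z) else tape j z

/-- Rewrite the cells on all work tapes and move the heads as long as the symbols satisfy `go`. -/
def sweep (go : Γ → Bool) (wr : Γ → Γ) (mv : HeadMove) : SatProg Q Γ k :=
  .seq (regOp fun r _ _ => { r with flag := true })
    (.loop (fun r _ => r.flag) (.act (.act fun r _ _ v =>
      ({ r with flag := decide (∃ j, go (v j) = true) }, .stay,
        fun j => if go (v j) then wr (v j) else v j, fun j => if go (v j) then mv else .stay))))

/-- Head `j` stops for good after `n j` steps, since it then stays on a cell at which `go` fails.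
The loop takes one round more than the slowest head needs, to notice that no head moves any more. -/
theorem runs_sweep {go : Γ → Bool} {wr : Γ → Γ} {mv : HeadMove} {d : ℤ} (hd : d = 1 ∨ d = -1)
    (hmv : ∀ z, MultiTapeTM.moveWork mv z = z + d) (n : Fin k → ℕ) (hn : ∀ j, n j + 1 ≤ N)
    (hN : 1 ≤ N)
    (hgo : ∀ j, ∀ i < n j, go (σ.tape j (σ.thead j + d * i)) = true)
    (hend : ∀ j, go (σ.tape j (σ.thead j + d * n j)) = false)
    (hb : ∀ j, ∀ i ≤ n j, |σ.thead j + d * i| ≤ b) (hf : σ.reg.flag = false) :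
    Prog.Runs (counterSem x b) N (sweep go wr mv) σ
      { σ with
        tape := sweptTape wr d σ.tape σ.thead n
        thead := fun j => σ.thead j + d * n j } := by
  have hg : (counterSem (α := CodeSymbol) x b).guard σ := fun j => by
    simpa using hb j 0 (Nat.zero_le _)
  let m := Finset.univ.sup n
  have hm : ∀ j, n j ≤ m := fun j => Finset.le_sup (Finset.mem_univ j)
  have hdd : d * d = 1 := by rcases hd with rfl | rfl <;> rfl
  -- The store after `i` rounds. The flag is set if there has been no round yet or some head moved
  -- in the latest round.
  let f : ℕ → SatStore Q Γ k := fun i =>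
    { σ with
      reg := { σ.reg with flag := decide (i = 0 ∨ ∃ j, i ≤ n j) }
      tape := sweptTape wr d σ.tape σ.thead (fun j => min i (n j))
      thead := fun j => σ.thead j + d * (min i (n j) : ℕ) }
  have h1 := Prog.Runs.loop (m := counterSem x b) (N := N) (b := fun r _ => r.flag)
    (P := .act (.act fun r _ _ v =>
      ({ r with flag := decide (∃ j, go (v j) = true) }, .stay,
        fun j => if go (v j) then wr (v j) else v j, fun j => if go (v j) then mv else .stay)))
    (f := f) (n := m + 1) ?_ (fun i hi => ⟨?_, ?_⟩) ?_
  · refine (runs_regOp _).seq ((h1.from_eq ?_).to_eq ?_)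
    · ext e <;> simp [f, sweptTape]
    · ext e <;> simp [f, sweptTape, Nat.le_succ_of_le (hm _), hf]
      grind
  · have : m ≤ N - 1 := Finset.sup_le fun j _ => by have := hn j; omega
    omega
  · rcases i with _ | i
    · simp [f, counterSem]
    · have : ∃ j, i + 1 ≤ n j := by
        by_contra! h
        have : m ≤ i := Finset.sup_le fun j _ => by have := h j; omega
        omega
      simpa [f, counterSem] using this
  · have hread : ∀ j, (f i).tape j ((f i).thead j) =
        σ.tape j (σ.thead j + d * (min i (n j) : ℕ)) := by
      intro j
      refine if_neg fun h => ?_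
      simp only [f, add_sub_cancel_left] at h
      rw [← mul_assoc, hdd, one_mul] at h
      omega
    have hgo' : ∀ j, go ((f i).tape j ((f i).thead j)) = decide (i < n j) := by
      intro j
      rw [hread]
      by_cases h : i < n j
      · rw [min_eq_left h.le, hgo j i h, decide_eq_true h]
      · rw [min_eq_right (not_lt.mp h), hend, decide_eq_false h]
    have key : (counterSem (α := CodeSymbol) x b).op (.act fun r _ _ v =>
      ({ r with flag := decide (∃ j, go (v j) = true) }, .stay,
        fun j => if go (v j) then wr (v j) else v j, fun j => if go (v j) then mv else .stay))
          (f i) = f (i + 1) := by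
      simp only [counterSem, hgo', decide_eq_true_eq]
      refine CounterStore.ext ?_ rfl rfl ?_ ?_
      · simp [f]
      · funext j z
        by_cases h : i < n j
        · simp only [h, if_true]
          rw [hread]
          by_cases hz : z = (f i).thead j
          · subst hz
            simp only [Function.update_self]
            simp only [f, sweptTape, add_sub_cancel_left, ← mul_assoc, hdd, one_mul]
            rw [if_pos (by omega)]
          · rw [Function.update_of_ne hz]
            simp only [f] at hz ⊢
            simp only [sweptTape]
            refine if_congr ?_ rfl rfl
            rcases hd with rfl | rfl <;> omega
        · simp only [h, if_false, Function.update_eq_self]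
          simp only [f, sweptTape]
          simp only [min_eq_right (not_lt.mp h), min_eq_right (show n j ≤ i + 1 by omega)]
      · funext j
        by_cases h : i < n j
        · simp only [h, if_true, hmv, f]
          rw [min_eq_left h.le, min_eq_left (by omega)]
          push_cast
          ring
        · simp only [h, if_false, MultiTapeTM.moveWork, f]
          rw [min_eq_right (not_lt.mp h), min_eq_right (by omega)]
    rw [← key]
    refine Prog.Runs.act ?_
    rw [key]
    exact fun j => hb j _ (min_le_right _ _)
  · have : ∀ j, n j < m + 1 := fun j => Nat.lt_succ_of_le (hm j)
    simpa [f, counterSem] using this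

end Sweep

/-! ### Head positions and the number of scanned cells -/

section Space

namespace MultiTapeTM

variable {α β : Type} {M : MultiTapeTM α β} {y : List α}

theorem config_succ (t : ℕ) : M.config y (t + 1) = M.next y (M.config y t) :=
  Function.iterate_succ_apply' _ _ _

theorem config_of_halted {t s : ℕ} (h : M.Halted y (M.config y t)) (hs : t ≤ s) :
    M.config y s = M.config y t := by
  induction s, hs using Nat.le_induction with
  | base => rfl
  | succ s _ ih => rw [config_succ, ih, next, show M.instruction y _ = none from h]

theorem workHead_next (c : M.Cfg) (j : Fin M.numTapes) :
    |(M.next y c).workHead j - c.workHead j| ≤ 1 := by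
  rw [next]
  split
  · rename_i a _
    simp only [applyAction]
    rcases a.workMove j <;> simp [moveWork]
  · simp

/-- A head moves by at most one cell per step, so it cannot jump over a cell on its way from the
origin. -/
theorem uIcc_subset_image_workHead (j : Fin M.numTapes) (s : ℕ) :
    Finset.uIcc 0 ((M.config y s).workHead j) ⊆
      (Finset.range (s + 1)).image fun i => (M.config y i).workHead j := by
  induction s with
  | zero => simp [config, init]
  | succ s ih =>
    intro z hz
    rw [Finset.range_add_one, Finset.image_insert, Finset.mem_insert]
    have h := abs_le.mp (workHead_next (y := y) (M.config y s) j)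
    rw [← config_succ] at h
    by_cases e : z = (M.config y (s + 1)).workHead j
    · exact .inl e
    · refine .inr (ih ?_)
      rw [Finset.mem_uIcc] at hz ⊢
      omega

/-- This converts a bound on the cells used by the simulated machine into the distance bound that
the guard of the simulating program demands. -/
theorem abs_workHead_lt_cellsUsed (j : Fin M.numTapes) {s t : ℕ} (h : s ≤ t) :
    |(M.config y s).workHead j| < M.cellsUsed y t j := by
  have : _ ≤ M.cellsUsed y t j :=
    Finset.card_le_card ((uIcc_subset_image_workHead (y := y) j s).trans
      (Finset.image_subset_image (Finset.range_subset_range.mpr (Nat.succ_le_succ h))))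
  rw [Int.card_uIcc] at this
  rw [Int.abs_eq_natAbs]
  omega

theorem abs_workHead_le (j : Fin M.numTapes) (s : ℕ) : |(M.config y s).workHead j| ≤ s := by
  have := abs_workHead_lt_cellsUsed (y := y) j (le_refl s)
  have h2 : M.cellsUsed y s j ≤ s + 1 := Finset.card_image_le.trans (Finset.card_range _).le
  omega

theorem inputHead_le (s : ℕ) : (M.config y s).inputHead ≤ y.length + 1 := by
  induction s with
  | zero => simp [config, init]
  | succ s ih =>
    rw [config_succ, next]
    split
    · rename_i a _
      simp only [applyAction]
      rcases a.inputMove <;> simp [moveInput] <;> omega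
    · exact ih

end MultiTapeTM

end Space

/-! ### Step-by-step simulation and cleaning of the tapes -/

section Simulation

open MultiTapeTM

/-- The work tapes of a simulating machine, on which the cells from `l` to `r` have been written,
with a mark on the initial position. -/
def simTape {W : Type} {k : ℕ} (work : Fin k → ℤ → W) (l r : Fin k → ℤ) :
    Fin k → ℤ → Option W × Bool :=
  fun j z => (if l j ≤ z ∧ z ≤ r j then some (work j z) else none, decide (z = 0))

/-- The parts of the work tapes from `l` to `r` contain all cells used, and they lie within
distance `A` of the initial position. -/
structure Covers {W : Type} {k : ℕ} (bl : W) (A : ℤ) (work : Fin k → ℤ → W) (head l r : Fin k → ℤ) :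
    Prop where
  le : ∀ j, -A ≤ l j
  ge : ∀ j, r j ≤ A
  lr : ∀ j, l j ≤ r j + 1
  lh : ∀ j, l j - 1 ≤ head j
  hr : ∀ j, head j ≤ r j + 1
  r0 : ∀ j, -1 ≤ r j
  blank : ∀ j z, ¬ (l j ≤ z ∧ z ≤ r j) → work j z = bl

variable {M : MultiTapeTM CodeSymbol (WithBot CodeSymbol)}

/-- The programs that simulate a machine. -/
abbrev SimProg (M : MultiTapeTM CodeSymbol (WithBot CodeSymbol)) : Type :=
  SatProg M.State (Option M.WorkSymbol × Bool) M.numTapes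

/-- The stores of a machine that simulates a machine. -/
abbrev SimStore (M : MultiTapeTM CodeSymbol (WithBot CodeSymbol)) : Type :=
  SatStore M.State (Option M.WorkSymbol × Bool) M.numTapes

/-- A store that represents a configuration of the simulated machine. -/
def simStore (σ : SimStore M) (c : M.Cfg) (hal : Bool) (l r : Fin M.numTapes → ℤ) : SimStore M :=
  { σ with
    reg := { σ.reg with state := c.state, halted := hal, bot := decide (⊥ ∈ c.output) }
    ctr := Function.update σ.ctr .h c.inputHead
    tape := simTape c.work l r
    thead := c.workHead }

/-- Carry out the instruction of the simulated machine, except for the input head. -/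
def simInstruction (M : MultiTapeTM CodeSymbol (WithBot CodeSymbol)) : SimProg M :=
  .act (.act fun r _ _ v =>
    match M.transition r.state r.sym (fun j => (v j).1.getD M.blank) with
    | none => ({ r with halted := true }, .stay, v, fun _ => .stay)
    | some a =>
      ({ r with state := a.nextState, move := a.inputMove, bot := r.bot || a.emit == some ⊥ },
        .stay, fun j => (some (a.workWrite j), (v j).2), a.workMove))

/-- Move the virtual input head. -/
def moveVirtual {Q Γ : Type} {k : ℕ} : SatProg Q Γ k :=
  .seq (.ite (fun r _ => r.move == .left) (.act (.dec .h))
      (.ite (fun r _ => r.move == .right && r.sym != .rightEnd) (.act (.inc .h))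
        (regOp fun r _ _ => r)))
    (regOp fun r _ _ => { r with sym := .leftEnd, move := .stay })

theorem readInput_eq_rightEnd {α : Type} {y : List α} {i : ℕ} :
    readInput y i = .rightEnd ↔ y.length < i := by
  rcases i with _ | i
  · simp [readInput]
  · rw [readInput]
    split
    · rename_i a h
      simp [(List.getElem?_eq_some_iff.mp h).1]
    · rename_i h
      simpa [Nat.lt_succ_iff] using h

/-- At the left endmarker, truncated subtraction keeps the counter at zero; at the right endmarker,
the symbol that has just been read forbids the increment. -/
theorem runs_moveVirtual {Q Γ : Type} {k : ℕ} {x y : List CodeSymbol} {b N : ℕ}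
    {σ : SatStore Q Γ k} (hg : (counterSem (α := CodeSymbol) x b).guard σ)
    (hs : σ.reg.sym = readInput y (σ.ctr .h)) (hh : σ.ctr .h ≤ y.length + 1) :
    Prog.Runs (counterSem x b) N moveVirtual σ
      ((σ.setC .h (moveInput y σ.reg.move (σ.ctr .h))).setR fun r =>
        { r with sym := .leftEnd, move := .stay }) := by
  suffices H : Prog.Runs (counterSem x b) N (.ite (fun r _ => r.move == .left) (.act (.dec .h))
      (.ite (fun r _ => r.move == .right && r.sym != .rightEnd) (.act (.inc .h))
        (regOp fun r _ _ => r))) σ (σ.setC .h (moveInput y σ.reg.move (σ.ctr .h))) from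
    H.seq (runs_regOp _ (by exact hg))
  rcases hm : σ.reg.move
  · exact .iteTrue (by simp [counterSem, hm]) (runs_dec _)
  · refine .iteFalse (by simp [counterSem, hm]) (.iteFalse (by simp [counterSem, hm])
      ((runs_regOp _).to_eq ?_))
    simp only [moveInput, CounterStore.setC_self]
    rfl
  · refine .iteFalse (by simp [counterSem, hm]) ?_
    by_cases h : y.length < σ.ctr .h
    · refine .iteFalse (by simp [counterSem, hs, readInput_eq_rightEnd.mpr h])
        ((runs_regOp _).to_eq ?_)
      rw [moveInput, show min (σ.ctr .h + 1) (y.length + 1) = σ.ctr .h by omega,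
        CounterStore.setC_self]
      rfl
    · refine .iteTrue ?_ ((runs_inc _).to_eq ?_)
      · have := mt readInput_eq_rightEnd.mp h
        simp [counterSem, hs, hm, this]
      · rw [moveInput, min_eq_left (by omega)]

/-- Simulate one step. -/
def simStep (M : MultiTapeTM CodeSymbol (WithBot CodeSymbol)) : SimProg M :=
  .seq fetch (.seq (simInstruction M) moveVirtual)

/-- The store is ready for queries for the occurrence to which the counter `s` points. -/
structure Ready (φ : CNFFormula) (b : ℕ) {Q Γ : Type} {k : ℕ} (σ : SatStore Q Γ k)
    (s : Fin φ.occs.length) : Prop where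
  idle : Idle φ.encode b σ
  q : σ.ctr .q = 0
  q' : σ.ctr .q' = 0
  w : σ.ctr .w = 0
  w' : σ.ctr .w' = 0
  s : σ.ctr .s = φ.occs[s].ptr
  cnt : σ.ctr .cnt = 0
  fetched : σ.reg.fetched = none
  move : σ.reg.move = .stay

variable {φ : CNFFormula} {b N : ℕ} {σ : SimStore M} {s : Fin φ.occs.length}

theorem Ready.simStore (h : Ready φ b σ s) {c : M.Cfg} {hal : Bool} {l r : Fin M.numTapes → ℤ}
    (hc : ∀ j, |c.workHead j| ≤ b) : Ready φ b (simStore σ c hal l r) s :=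
  ⟨⟨hc, by simp [_root_.simStore, h.idle.t], by simp [_root_.simStore, h.idle.u],
    by simp [_root_.simStore, h.idle.v], h.idle.ih, h.idle.sym, h.idle.sym', h.idle.flag⟩,
    by simp [_root_.simStore, h.q], by simp [_root_.simStore, h.q'],
    by simp [_root_.simStore, h.w], by simp [_root_.simStore, h.w'],
    by simp [_root_.simStore, h.s], by simp [_root_.simStore, h.cnt], h.fetched, h.move⟩

theorem getD_simTape {W : Type} {k : ℕ} {work : Fin k → ℤ → W} {bl : W} {A : ℤ}
    {head l r : Fin k → ℤ} (h : Covers bl A work head l r) (j : Fin k) (z : ℤ) :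
    (simTape work l r j z).1.getD bl = work j z := by
  rw [simTape]
  split_ifs with hz
  · rfl
  · exact (h.blank j z hz).symm

theorem runs_simInstruction_none {x y : List CodeSymbol} {c : M.Cfg} {l r : Fin M.numTapes → ℤ}
    {A : ℤ} (hcov : Covers M.blank A c.work c.workHead l r) (hh : ∀ j, |c.workHead j| ≤ b)
    (hs : σ.reg.sym = readInput y c.inputHead) (hi : M.instruction y c = none) :
    Prog.Runs (counterSem x b) N (simInstruction M) (simStore σ c false l r)
      (simStore σ c true l r) := by
  rw [instruction] at hi
  have key : ∀ a, (counterSem (α := CodeSymbol) x b).op (.act a) (simStore σ c false l r) =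
      simStore σ c true l r →
      Prog.Runs (counterSem x b) N (.act (.act a)) (simStore σ c false l r)
        (simStore σ c true l r) := by
    intro a h
    rw [← h]
    exact Prog.Runs.act (by rw [h]; exact hh)
  refine key _ ?_
  simp [counterSem, simStore, hs, getD_simTape hcov, hi, moveInput, moveWork]

theorem runs_simInstruction_some {x y : List CodeSymbol} {c : M.Cfg} {l r : Fin M.numTapes → ℤ}
    {A : ℤ} (hcov : Covers M.blank A c.work c.workHead l r)
    (hs : σ.reg.sym = readInput y c.inputHead) {a} (hi : M.instruction y c = some a)
    (hh : ∀ j, |(M.applyAction y c a).workHead j| ≤ b) :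
    Prog.Runs (counterSem x b) N (simInstruction M) (simStore σ c false l r)
      (((simStore σ (M.applyAction y c a) false (fun j => min (l j) (c.workHead j))
        (fun j => max (r j) (c.workHead j))).setC .h c.inputHead).setR fun r =>
        { r with move := a.inputMove }) := by
  rw [instruction] at hi
  have key : ∀ o τ τ', (counterSem (α := CodeSymbol) x b).op (.act o) τ = τ' →
      (∀ j, |τ'.thead j| ≤ b) →
      Prog.Runs (counterSem x b) N (.act (.act o) : SimProg M) τ τ' := by
    rintro o τ τ' rfl h
    exact Prog.Runs.act h
  refine key _ _ _ ?_ hh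
  simp only [counterSem, simStore, hs, getD_simTape hcov, hi, moveInput]
  refine CounterStore.ext ?_ ?_ rfl ?_ rfl
  · simp [applyAction]
    rcases a.emit with _ | e
    · simp
    · rw [Bool.eq_iff_iff]
      simp only [Bool.or_eq_true, decide_eq_true_eq, beq_iff_eq, Option.some_inj]
  · simp [CounterStore.setR, CounterStore.setC]
  · funext j z
    simp only [CounterStore.setR, CounterStore.setC, applyAction]
    have h1 := hcov.lr j
    have h2 := hcov.lh j
    have h3 := hcov.hr j
    by_cases hz : z = c.workHead j
    · subst hz
      simp [simTape]
    · rw [Function.update_of_ne hz]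
      simp only [simTape, Function.update_of_ne hz]
      congr 1
      -- The head is inside the written part or next to it, so the part remains an interval when the
      -- scanned cell is added.
      refine if_congr ?_ rfl rfl
      omega

theorem Covers.applyAction {y : List CodeSymbol} {c : M.Cfg} {l r : Fin M.numTapes → ℤ}
    {A : ℤ} (hcov : Covers M.blank A c.work c.workHead l r) (a)
    (hh : ∀ j, |c.workHead j| ≤ A) :
    Covers M.blank A (M.applyAction y c a).work (M.applyAction y c a).workHead
      (fun j => min (l j) (c.workHead j)) (fun j => max (r j) (c.workHead j)) := by
  have hm : ∀ j, c.workHead j - 1 ≤ (M.applyAction y c a).workHead j ∧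
      (M.applyAction y c a).workHead j ≤ c.workHead j + 1 := by
    intro j
    simp only [MultiTapeTM.applyAction]
    rcases a.workMove j <;> simp only [moveWork] <;> omega
  constructor
  · intro j
    have := hcov.le j
    have := abs_le.mp (hh j)
    omega
  · intro j
    have := hcov.ge j
    have := abs_le.mp (hh j)
    omega
  · intro j
    have := hcov.lr j
    omega
  · intro j
    have := hm j
    omega
  · intro j
    have := hm j
    omega
  · exact fun j => (hcov.r0 j).trans (le_max_left _ _)
  · intro j z hz
    simp only [MultiTapeTM.applyAction]
    rw [Function.update_of_ne (by rintro rfl; simp at hz)]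
    refine hcov.blank j z fun h => hz ⟨?_, ?_⟩
    · exact (min_le_left _ _).trans h.1
    · exact h.2.trans (le_max_left _ _)

theorem runs_simFetch (hφ : ∀ C ∈ φ, 1 ≤ C.length ∧ C.length ≤ 2)
    (hN : φ.encode.length + 1 ≤ N) (hσ : Ready φ b σ s) {c : M.Cfg} {l r : Fin M.numTapes → ℤ}
    (hh : ∀ j, |c.workHead j| ≤ b) (hc : c.inputHead ≤ N) :
    Prog.Runs (counterSem φ.encode b) N fetch (simStore σ c false l r)
      (simStore (σ.setR fun r =>
        { r with sym := readInput (queryInstance φ.occs s).encode c.inputHead }) c false l r) := by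
  have h := hσ.simStore (hal := false) (l := l) (r := r) hh
  have hc' : (simStore σ c false l r).ctr .h = c.inputHead := by simp [simStore]
  have := runs_fetch hφ hN h.idle h.q h.q' h.w h.w' s h.s (by rw [hc']; exact hc) h.cnt h.fetched
  rw [hc'] at this
  exact this

theorem runs_simStep_none (hφ : ∀ C ∈ φ, 1 ≤ C.length ∧ C.length ≤ 2)
    (hN : φ.encode.length + 1 ≤ N) (hσ : Ready φ b σ s) {c : M.Cfg} {l r : Fin M.numTapes → ℤ}
    {A : ℤ} (hcov : Covers M.blank A c.work c.workHead l r)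
    (hh : ∀ j, |c.workHead j| ≤ b) (hc : c.inputHead ≤ N)
    (hc' : c.inputHead ≤ (queryInstance φ.occs s).encode.length + 1)
    (hi : M.instruction (queryInstance φ.occs s).encode c = none) :
    Prog.Runs (counterSem φ.encode b) N (simStep M) (simStore σ c false l r)
      (simStore σ c true l r) := by
  refine (runs_simFetch hφ hN hσ hh hc).seq ((runs_simInstruction_none hcov hh rfl hi).seq
    ((runs_moveVirtual (y := (queryInstance φ.occs s).encode) (by exact hh) (by simp [simStore])
      (by simpa [simStore] using hc')).to_eq ?_))
  have h1 := hσ.idle.sym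
  have h2 := hσ.move
  ext e <;> simp [simStore, h1, h2, moveInput]
  grind

theorem runs_simStep_some (hφ : ∀ C ∈ φ, 1 ≤ C.length ∧ C.length ≤ 2)
    (hN : φ.encode.length + 1 ≤ N) (hσ : Ready φ b σ s) {c : M.Cfg} {l r : Fin M.numTapes → ℤ}
    {A : ℤ} (hcov : Covers M.blank A c.work c.workHead l r)
    (hh : ∀ j, |c.workHead j| ≤ b) (hc : c.inputHead ≤ N)
    (hc' : c.inputHead ≤ (queryInstance φ.occs s).encode.length + 1) {a}
    (hi : M.instruction (queryInstance φ.occs s).encode c = some a)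
    (hh' : ∀ j, |(M.applyAction (queryInstance φ.occs s).encode c a).workHead j| ≤ b) :
    Prog.Runs (counterSem φ.encode b) N (simStep M) (simStore σ c false l r)
      (simStore σ (M.applyAction (queryInstance φ.occs s).encode c a) false
        (fun j => min (l j) (c.workHead j)) (fun j => max (r j) (c.workHead j))) := by
  refine (runs_simFetch hφ hN hσ hh hc).seq ((runs_simInstruction_some hcov rfl hi hh').seq
    ((runs_moveVirtual (y := (queryInstance φ.occs s).encode) (by exact hh') (by simp [simStore])
      (by simpa [simStore] using hc')).to_eq ?_))
  have h1 := hσ.idle.sym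
  have h2 := hσ.move
  ext e <;> simp [simStore, h1, h2, applyAction]
  grind

/-- Simulate a computation. -/
def simLoop (M : MultiTapeTM CodeSymbol (WithBot CodeSymbol)) : SimProg M :=
  .loop (fun r _ => !r.halted) (simStep M)

/-- Before the first step the written part is empty, which is expressed by `l = 0` and `r = -1`. -/
theorem runs_simLoop (hφ : ∀ C ∈ φ, 1 ≤ C.length ∧ C.length ≤ 2)
    (hN : φ.encode.length + 1 ≤ N) (hσ : Ready φ b σ s)
    (hy : (queryInstance φ.occs s).encode.length + 1 ≤ N) {t : ℕ} (ht : t + 1 ≤ N)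
    (hhalt : M.Halted (queryInstance φ.occs s).encode (M.config (queryInstance φ.occs s).encode t))
    {A : ℤ} (hA : 0 ≤ A) (hAb : A ≤ b)
    (hh : ∀ j, ∀ i ≤ t, |(M.config (queryInstance φ.occs s).encode i).workHead j| ≤ A) :
    ∃ l r, Covers M.blank A (M.config (queryInstance φ.occs s).encode t).work
        (M.config (queryInstance φ.occs s).encode t).workHead l r ∧
      Prog.Runs (counterSem φ.encode b) N (simLoop M)
        (simStore σ M.init false (fun _ => 0) (fun _ => -1))
        (simStore σ (M.config (queryInstance φ.occs s).encode t) true l r) := by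
  classical
  generalize hyy : (queryInstance φ.occs s).encode = y at *
  -- The given `t` need not be the first time at which the machine has halted. The simulation stops
  -- at the first one, after which the configuration does not change.
  have hex : ∃ t, M.Halted y (M.config y t) := ⟨t, hhalt⟩
  have hle : Nat.find hex ≤ t := Nat.find_min' hex hhalt
  rw [config_of_halted (Nat.find_spec hex) hle]
  have hspec := Nat.find_spec hex
  have hmin : ∀ i < Nat.find hex, ¬ M.Halted y (M.config y i) := fun i => Nat.find_min hex
  generalize Nat.find hex = t₀ at *
  have hg : ∀ i ≤ t₀, ∀ j, |(M.config y i).workHead j| ≤ b :=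
    fun i hi j => (hh j i (hi.trans hle)).trans hAb
  -- There are `t₀ + 1` rounds: `t₀` genuine steps, and a last one that discovers the halt and sets
  -- `halted`.
  have H := Prog.Runs.loop_inv (m := counterSem φ.encode b) (N := N)
    (b := fun r _ => !r.halted) (P := simStep M)
    (σ := simStore σ M.init false (fun _ => 0) (fun _ => -1))
    (I := fun i τ => ∃ l r, Covers M.blank A (M.config y (min i t₀)).work
      (M.config y (min i t₀)).workHead l r ∧
      τ = simStore σ (M.config y (min i t₀)) (decide (t₀ < i)) l r) (n := t₀ + 1) (by omega)
    ⟨_, _, ?_, rfl⟩ ?_ ?_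
  · obtain ⟨σ', h1, l, r, hcov, rfl⟩ := H
    rw [min_eq_right (Nat.le_succ _)] at hcov h1
    refine ⟨l, r, hcov, ?_⟩
    unfold simLoop
    simpa using h1
  · rw [Nat.zero_min]
    exact ⟨fun _ => by simpa, fun _ => by omega, fun _ => by simp, fun _ => by simp [config, init],
      fun _ => by simp [config, init], fun _ => le_rfl, fun _ _ _ => rfl⟩
  · rintro i hi τ ⟨l, r, hcov, rfl⟩
    rw [min_eq_left (by omega)] at hcov
    rw [min_eq_left (by omega), decide_eq_false (by omega)]
    refine ⟨by simp [counterSem, simStore], ?_⟩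
    have hin := inputHead_le (M := M) (y := y) i
    rcases hinst : M.instruction y (M.config y i) with _ | a
    · have hi' : i = t₀ := by
        by_contra hne
        exact hmin i (by omega) hinst
      refine ⟨_, runs_simStep_none hφ hN hσ hcov (hg i (by omega)) (by omega)
        (by rw [hyy]; exact hin) (by rw [hyy]; exact hinst), l, r, ?_, ?_⟩
      · rw [min_eq_right (by omega), ← hi']
        exact hcov
      · rw [min_eq_right (by omega), decide_eq_true (by omega), hi']
    · have hi' : i + 1 ≤ t₀ := by
        by_contra hne
        have : i = t₀ := by omega
        rw [this] at hinst
        rw [Halted, hinst] at hspec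
        cases hspec
      have hnext : M.config y (i + 1) = M.applyAction y (M.config y i) a := by
        rw [config_succ, next, hinst]
      have hgn := hg (i + 1) hi'
      have := runs_simStep_some (N := N) hφ hN hσ hcov (hg i (by omega)) (by omega)
        (by rw [hyy]; exact hin) (by rw [hyy]; exact hinst) (by rw [hyy, ← hnext]; exact hgn)
      rw [hyy, ← hnext] at this
      refine ⟨_, this, fun j => min (l j) ((M.config y i).workHead j),
        fun j => max (r j) ((M.config y i).workHead j), ?_, ?_⟩
      rotate_left
      · rw [min_eq_left hi', decide_eq_false (by omega)]
      · rw [min_eq_left hi', hnext]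
        exact hcov.applyAction a fun j => hh j i (by omega)
  · rintro τ ⟨l, r, -, rfl⟩
    simp [counterSem, simStore]

/-- Erase the work tapes and move the heads back. -/
def cleanTapes {Q W : Type} {k : ℕ} (bl : W) : SatProg Q (Option W × Bool) k :=
  .seq (.act (.act fun r _ _ v => (r, .stay, fun j => (some bl, (v j).2), fun _ => .stay)))
    (.seq (sweep (fun a => a.1.isSome) id .left)
    (.seq (.act (.act fun r _ _ v => (r, .stay, v, fun _ => .right)))
    (.seq (sweep (fun a => a.1.isSome) (fun a => (none, a.2)) .right)
      (sweep (fun a => !a.2) id .left))))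

theorem runs_act {Q Γ : Type} {k : ℕ} {x : List CodeSymbol} {τ τ' : SatStore Q Γ k} {a}
    (h : (counterSem (α := CodeSymbol) x b).op (.act a) τ = τ') (hb : ∀ j, |τ'.thead j| ≤ b) :
    Prog.Runs (counterSem x b) N (.act (.act a) : SatProg Q Γ k) τ τ' := by
  subst h
  exact Prog.Runs.act hb

theorem sweptTape_id {Γ : Type} {k : ℕ} (d : ℤ) (tape : Fin k → ℤ → Γ) (head : Fin k → ℤ)
    (n : Fin k → ℕ) : sweptTape id d tape head n = tape := by
  funext j z
  simp [sweptTape]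

/-- The scanned cell is written first, as the head may be just outside the written part. Then the
written cells form an interval from `l'` to `r'` that contains the head. The first sweep finds its
left end, the second one erases it, and the third one returns to the mark at the origin, which is
not to the right of the head because `r' + 1 ≥ 0`. -/
theorem runs_cleanTapes {Q W : Type} {k : ℕ} {x : List CodeSymbol}
    {τ : SatStore Q (Option W × Bool) k}
    (bl : W) {A : ℤ} (hA : 0 ≤ A) (hAb : A + 1 ≤ b) (hAN : 2 * A + 3 ≤ N) {l r : Fin k → ℤ}
    {work : Fin k → ℤ → W} (hcov : Covers bl A work τ.thead l r) (hT : τ.tape = simTape work l r)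
    (hh : ∀ j, |τ.thead j| ≤ A) (hf : τ.reg.flag = false) :
    Prog.Runs (counterSem x b) N (cleanTapes bl) τ
      { τ with tape := fun _ z => (none, decide (z = 0)), thead := fun _ => 0 } := by
  let l' : Fin k → ℤ := fun j => min (l j) (τ.thead j)
  let r' : Fin k → ℤ := fun j => max (r j) (τ.thead j)
  let T : Fin k → ℤ → Option W × Bool := fun j =>
    Function.update (τ.tape j) (τ.thead j) (some bl, (τ.tape j (τ.thead j)).2)
  have hT1 : ∀ j z, (T j z).1.isSome = decide (l' j ≤ z ∧ z ≤ r' j) := by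
    intro j z
    have h2 := hcov.lh j
    have h3 := hcov.hr j
    have h4 := hcov.lr j
    simp only [T, hT, l', r']
    by_cases hz : z = τ.thead j
    · subst hz
      simp
    · rw [Function.update_of_ne hz, Bool.eq_iff_iff]
      simp only [simTape, decide_eq_true_eq]
      split_ifs <;> simp <;> omega
  have hT2 : ∀ j z, (T j z).2 = decide (z = 0) := by
    intro j z
    simp only [T, hT]
    by_cases hz : z = τ.thead j
    · subst hz
      simp [simTape]
    · rw [Function.update_of_ne hz]
      rfl
  have hl1 : ∀ j, l' j ≤ τ.thead j := fun j => min_le_right _ _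
  have hr1 : ∀ j, τ.thead j ≤ r' j := fun j => le_max_right _ _
  have hr0 : ∀ j, -1 ≤ r' j := fun j => (hcov.r0 j).trans (le_max_left _ _)
  have hl2 : ∀ j, -A ≤ l' j := fun j => le_min (hcov.le j) (abs_le.mp (hh j)).1
  have hr2 : ∀ j, r' j ≤ A := fun j => max_le (hcov.ge j) (abs_le.mp (hh j)).2
  have hN1 : 1 ≤ N := by omega
  refine Prog.Runs.seq (runs_act (τ' := { τ with tape := T }) ?_ fun j => (hh j).trans (by omega))
    ((runs_sweep (σ := { τ with tape := T }) (d := -1) (.inr rfl) (fun z => rfl)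
      (fun j => (τ.thead j - l' j + 1).toNat)
      ?_ hN1 ?_ ?_ ?_ hf).seq
    ((runs_act (τ' := { τ with tape := T, thead := l' }) ?_ ?_).seq
    ((runs_sweep (σ := { τ with tape := T, thead := l' }) (d := 1) (.inl rfl) (fun z => rfl)
      (fun j => (r' j - l' j + 1).toNat)
      ?_ hN1 ?_ ?_ ?_ hf).seq
    ((runs_sweep (σ := { τ with
        tape := sweptTape (fun a => (none, a.2)) 1 T l' (fun j => (r' j - l' j + 1).toNat)
        thead := fun j => l' j + 1 * ((r' j - l' j + 1).toNat : ℕ) })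
        (d := -1) (.inr rfl) (fun z => rfl) (fun j => (r' j + 1).toNat)
      ?_ hN1 ?_ ?_ ?_ hf).to_eq ?_))))
  · refine CounterStore.ext rfl rfl rfl rfl ?_
    simp [counterSem, moveWork]
  · intro j
    have := hl1 j; have := hr1 j; have := hl2 j; have := hr2 j
    omega
  · intro j i hi
    have := hl1 j; have := hr1 j
    simp only [hT1, decide_eq_true_eq]
    omega
  · intro j
    have := hl1 j; have := hr1 j
    simp only [hT1, decide_eq_false_iff_not]
    omega
  · intro j i hi
    have := hl1 j; have := hr1 j; have := hl2 j; have := hr2 j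
    rw [abs_le]
    dsimp only
    omega
  · refine CounterStore.ext rfl rfl rfl ?_ ?_
    · simp [counterSem, sweptTape_id]
    · funext j
      have := hl1 j
      simp [counterSem, moveWork]
      omega
  · intro j
    have := hl1 j; have := hr1 j; have := hl2 j; have := hr2 j
    rw [abs_le]
    dsimp only
    omega
  · intro j
    have := hl1 j; have := hr1 j; have := hl2 j; have := hr2 j
    omega
  · intro j i hi
    have := hl1 j; have := hr1 j
    simp only [hT1, decide_eq_true_eq]
    omega
  · intro j
    have := hl1 j; have := hr1 j
    simp only [hT1, decide_eq_false_iff_not]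
    omega
  · intro j i hi
    have := hl1 j; have := hr1 j; have := hl2 j; have := hr2 j
    rw [abs_le]
    dsimp only
    omega
  · intro j
    have := hr0 j; have := hr2 j
    omega
  · intro j i hi
    have := hl1 j; have := hr1 j; have := hr0 j
    simp only [sweptTape]
    split_ifs <;> simp only [hT2, Bool.not_eq_true', decide_eq_false_iff_not] <;> omega
  · intro j
    have := hl1 j; have := hr1 j; have := hr0 j
    simp only [sweptTape]
    split_ifs <;> simp only [hT2, Bool.not_eq_false', decide_eq_true_eq] <;> omega
  · intro j i hi
    have := hl1 j; have := hr1 j; have := hl2 j; have := hr2 j; have := hr0 j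
    rw [abs_le]
    dsimp only
    omega
  · refine CounterStore.ext rfl rfl rfl ?_ ?_
    · rw [sweptTape_id]
      funext j z
      have := hl1 j; have := hr1 j
      have h1 := hT1 j z
      have h2 := hT2 j z
      simp only [sweptTape]
      split_ifs with h
      · rw [h2]
      · rw [decide_eq_false (by omega)] at h1
        exact Prod.ext (by simpa using h1) h2
    · funext j
      have := hl1 j; have := hr1 j; have := hr0 j
      dsimp only
      omega

/-- Determine whether the simulated machine reports that a query has no solution. -/
def runQuery (M : MultiTapeTM CodeSymbol (WithBot CodeSymbol)) : SimProg M :=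
  .seq (simLoop M) (.seq (cleanTapes M.blank) (.seq (clear .h) (regOp fun r _ _ =>
    { r with res := r.bot, bot := false, halted := false, state := M.start })))

/-- The simulated machine is in its initial configuration. -/
structure Pristine (σ : SimStore M) : Prop where
  state : σ.reg.state = M.start
  halted : σ.reg.halted = false
  bot : σ.reg.bot = false
  h : σ.ctr .h = 0
  tape : σ.tape = fun _ z => (none, decide (z = 0))
  thead : σ.thead = fun _ => 0

theorem runs_runQuery (hφ : ∀ C ∈ φ, 1 ≤ C.length ∧ C.length ≤ 2)
    (hN : φ.encode.length + 1 ≤ N) (hσ : Ready φ b σ s) (hp : Pristine σ)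
    (hy : (queryInstance φ.occs s).encode.length + 1 ≤ N) {t : ℕ} (ht : 2 * t + 3 ≤ N)
    (hhalt : M.Halted (queryInstance φ.occs s).encode (M.config (queryInstance φ.occs s).encode t))
    (hb : ∀ j, M.cellsUsed (queryInstance φ.occs s).encode t j ≤ b) (hb0 : 1 ≤ b) :
    Prog.Runs (counterSem φ.encode b) N (runQuery M) σ (σ.setR fun r =>
      { r with res := decide (⊥ ∈ (M.config (queryInstance φ.occs s).encode t).output) }) := by
  classical
  -- Two bounds for the distance of the heads: `b - 1` leaves room for the cell next to the written
  -- part that cleaning visits, and `t` keeps the sweeps within `N` rounds.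
  let A : ℤ := min (b - 1) t
  have hh : ∀ j, ∀ i ≤ t, |(M.config (queryInstance φ.occs s).encode i).workHead j| ≤ A := by
    intro j i hi
    refine le_min ?_ ?_
    · have := abs_workHead_lt_cellsUsed (M := M) (y := (queryInstance φ.occs s).encode) j hi
      have := hb j
      omega
    · exact (abs_workHead_le j i).trans (by exact_mod_cast hi)
  have hin := inputHead_le (M := M) (y := (queryInstance φ.occs s).encode) t
  obtain ⟨l, r, hcov, h1⟩ := runs_simLoop (A := A) hφ hN hσ hy (by omega) hhalt
    (by omega) (by omega) hh
  have h2 := runs_cleanTapes (x := φ.encode) (b := b) (N := N)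
    (τ := simStore σ (M.config (queryInstance φ.occs s).encode t) true l r) M.blank (A := A)
    (by omega) (by omega) (by omega) hcov rfl (fun j => hh j t le_rfl) hσ.idle.flag
  refine (h1.from_eq ?_).seq (h2.seq ((runs_clear ?_ ?_).seq ((runs_regOp _ ?_).to_eq ?_)))
  · obtain ⟨e1, e2, e3, e4, e5, e6⟩ := hp
    refine CounterStore.ext ?_ ?_ rfl ?_ ?_
    · ext <;> simp [simStore, init, e1, e2, e3]
    · simp [simStore, init, ← e4]
    · rw [e5]
      funext j z
      simp [simStore, simTape]
      omega
    · rw [e6]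
      rfl
  · simp [simStore]
    omega
  · exact fun j => by simp
  · exact fun j => by simp
  · obtain ⟨e1, e2, e3, e4, e5, e6⟩ := hp
    refine CounterStore.ext ?_ ?_ rfl ?_ ?_
    · ext <;> simp [simStore, e1, e2, e3]
    · funext e
      simp [simStore]
      grind
    · exact e5.symm
    · exact e6.symm

end Simulation

/-! ### Satisfiability and queries -/

section TwoSat

theorem litNeg_litNeg (l : SatLiteral) : litNeg (litNeg l) = l := by simp [litNeg]

theorem litNeg_ne (l : SatLiteral) : litNeg l ≠ l := by
  intro h
  have := congrArg Prod.snd h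
  simp [litNeg] at this

/-- A skew-symmetric implication relation without contradictory cycles has a model. -/
theorem exists_model_of_skew {r : SatLiteral → SatLiteral → Prop}
    (hr : ∀ a b, r a b → r (litNeg b) (litNeg a))
    (hc : ∀ a, ¬ (Relation.ReflTransGen r a (litNeg a) ∧ Relation.ReflTransGen r (litNeg a) a)) :
    ∃ ν : ℕ → Bool, ∀ a b, r a b → ν a.1 = a.2 → ν b.1 = b.2 := by
  classical
  have hskew : ∀ a b, Relation.ReflTransGen r a b →
      Relation.ReflTransGen r (litNeg b) (litNeg a) := by
    intro a b h
    induction h with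
    | refl => exact .refl
    | tail _ h ih => exact .head (hr _ _ h) ih
  -- The sets of literals that are closed under implication and consistent. A maximal one turns out
  -- to contain a literal of each complementary pair and so defines an assignment.
  let 𝒮 : Set (Set SatLiteral) :=
    {S | (∀ a b, r a b → a ∈ S → b ∈ S) ∧ ∀ a ∈ S, litNeg a ∉ S}
  obtain ⟨S, hS⟩ := zorn_subset 𝒮 (by
    intro c hc hchain
    refine ⟨⋃₀ c, ⟨?_, ?_⟩, fun s hs => Set.subset_sUnion_of_mem hs⟩
    · rintro a b h ⟨s, hs, ha⟩
      exact ⟨s, hs, (hc hs).1 a b h ha⟩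
    · rintro a ⟨s, hs, ha⟩ ⟨s', hs', ha'⟩
      rcases hchain.total hs hs' with h | h
      · exact (hc hs').2 a (h ha) ha'
      · exact (hc hs).2 a ha (h ha'))
  obtain ⟨hS1, hS2⟩ := hS.prop
  have hS1' : ∀ a b, Relation.ReflTransGen r a b → a ∈ S → b ∈ S := by
    intro a b h ha
    induction h with
    | refl => exact ha
    | tail _ h ih => exact hS1 _ _ h ih
  -- All consequences of `a` can be added to `S`: by skew symmetry, a clash with `S` would put
  -- `litNeg a` into `S`, and a clash between two consequences would give a chain from `a` to
  -- `litNeg a`.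
  have key : ∀ a, ¬ Relation.ReflTransGen r a (litNeg a) → litNeg a ∉ S → a ∈ S := by
    intro a ha ha'
    have hmem : S ∪ {b | Relation.ReflTransGen r a b} ∈ 𝒮 := by
      refine ⟨?_, ?_⟩
      · rintro b d h (hb | hb)
        · exact .inl (hS1 b d h hb)
        · exact .inr (Relation.ReflTransGen.tail hb h)
      · rintro b (hb | hb) (hb' | hb')
        · exact hS2 b hb hb'
        · have := hskew _ _ hb'
          rw [litNeg_litNeg] at this
          exact ha' (hS1' _ _ this hb)
        · exact ha' (hS1' _ _ (hskew _ _ hb) hb')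
        · have := hskew _ _ hb'
          rw [litNeg_litNeg] at this
          exact ha (Relation.ReflTransGen.trans hb this)
    exact hS.le_of_ge hmem Set.subset_union_left (.inr .refl)
  have htotal : ∀ a, a ∈ S ∨ litNeg a ∈ S := by
    intro a
    by_contra! h
    refine hc a ⟨?_, ?_⟩ <;> by_contra h'
    · exact h.1 (key a h' h.2)
    · exact h.2 (key (litNeg a) (by rwa [litNeg_litNeg]) (by rw [litNeg_litNeg]; exact h.1))
  have hν : ∀ a : SatLiteral, decide ((a.1, true) ∈ S) = a.2 ↔ a ∈ S := by
    rintro ⟨v, _ | _⟩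
    · rw [decide_eq_false_iff_not]
      exact ⟨fun h => (htotal (v, true)).resolve_left h, hS2 (v, false)⟩
    · rw [decide_eq_true_iff]
  exact ⟨fun v => decide ((v, true) ∈ S), fun a b h ha => (hν b).mpr (hS1 a b h ((hν a).mp ha))⟩

/-- From the assumption that the literal at `o` is false it follows that the literal at `o'` is
false. -/
def OccStep (L : List Occ) (o o' : Occ) : Prop := o' ∈ L ∧ o'.lit = litNeg o.lit'

/-- The literal at `s` is true in all models, by a chain of implications. -/
def Forced (L : List Occ) (s : Occ) : Prop :=
  ∃ o, Relation.ReflTransGen (OccStep L) s o ∧ o.lit = litNeg s.lit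

theorem mem_occsFrom {φ : CNFFormula} {o : Occ} : ∀ {p : ℕ}, o ∈ occsFrom p φ →
    ∃ C ∈ φ, ∃ p, o ∈ clauseOccs p C := by
  induction φ with
  | nil => simp [occsFrom]
  | cons C φ ih =>
    intro p h
    rw [occsFrom, List.mem_append] at h
    rcases h with h | h
    · exact ⟨C, by simp, p, h⟩
    · obtain ⟨C', h1, h2⟩ := ih h
      exact ⟨C', by simp [h1], h2⟩

theorem exists_clauseOccs_subset {φ : CNFFormula} {C : List SatLiteral} (h : C ∈ φ) :
    ∀ p, ∃ q, clauseOccs q C ⊆ occsFrom p φ := by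
  induction φ with
  | nil => simp at h
  | cons C' φ ih =>
    intro p
    rw [occsFrom]
    rcases List.mem_cons.mp h with rfl | h
    · exact ⟨p, List.subset_append_left _ _⟩
    · obtain ⟨q, hq⟩ := ih h (p + (encClause C').length)
      exact ⟨q, List.Subset.trans hq (List.subset_append_right _ _)⟩

/-- The literals of an occurrence form a clause. -/
theorem exists_clause_of_mem_occs {φ : CNFFormula} {o : Occ} (h : o ∈ φ.occs) :
    ∃ C ∈ φ, ∀ l ∈ C, l = o.lit ∨ l = o.lit' := by
  obtain ⟨C, hC, p, h⟩ := mem_occsFrom h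
  refine ⟨C, hC, ?_⟩
  match C with
  | [] => simp
  | [l] =>
    simp only [clauseOccs, List.mem_singleton] at h
    subst h
    simp
  | [l, l'] =>
    simp only [clauseOccs, List.mem_cons, List.not_mem_nil, or_false] at h
    rcases h with rfl | rfl <;> simp
  | _ :: _ :: _ :: _ => simp [clauseOccs] at h

theorem exists_occ_of_mem {φ : CNFFormula} (hφ : ∀ C ∈ φ, 1 ≤ C.length ∧ C.length ≤ 2)
    {C : List SatLiteral} (h : C ∈ φ) : ∃ o ∈ φ.occs, o.lit ∈ C ∧ o.lit' ∈ C := by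
  obtain ⟨q, hq⟩ := exists_clauseOccs_subset h 1
  have := hφ C h
  match C with
  | [] => simp at this
  | [l] => exact ⟨⟨q, q, l, l⟩, hq (by simp [clauseOccs]), by simp, by simp⟩
  | [l, l'] =>
    exact ⟨⟨q, q + (encLit l).length, l, l'⟩, hq (by simp [clauseOccs]), by simp, by simp⟩
  | _ :: _ :: _ :: _ => simp at this

/-- The two orders of the literals in a clause are the source of the skew symmetry of implication.
-/
theorem exists_partner {φ : CNFFormula} {o : Occ} (h : o ∈ φ.occs) :
    ∃ o' ∈ φ.occs, o'.lit = o.lit' ∧ o'.lit' = o.lit := by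
  obtain ⟨C, hC, p, h⟩ := mem_occsFrom h
  obtain ⟨q, hq⟩ := exists_clauseOccs_subset hC 1
  match C with
  | [] => simp [clauseOccs] at h
  | [l] =>
    simp only [clauseOccs, List.mem_singleton] at h
    subst h
    exact ⟨⟨q, q, l, l⟩, hq (by simp [clauseOccs]), rfl, rfl⟩
  | [l, l'] =>
    simp only [clauseOccs, List.mem_cons, List.not_mem_nil, or_false] at h
    rcases h with rfl | rfl
    · exact ⟨⟨q + (encLit l).length, q, l', l⟩, hq (by simp [clauseOccs]), rfl, rfl⟩
    · exact ⟨⟨q, q + (encLit l).length, l, l'⟩, hq (by simp [clauseOccs]), rfl, rfl⟩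
  | _ :: _ :: _ :: _ => simp [clauseOccs] at h

/-- A formula is satisfiable if and only if there are no complementary literals that are both
forced. -/
theorem satisfiable_iff {φ : CNFFormula} (hφ : ∀ C ∈ φ, 1 ≤ C.length ∧ C.length ≤ 2) :
    φ.Satisfiable ↔ ¬ ∃ o ∈ φ.occs, ∃ i ∈ φ.occs, i.lit = litNeg o.lit ∧
      Forced φ.occs o ∧ Forced φ.occs i := by
  constructor
  · rintro ⟨ν, hν⟩ ⟨o, ho, i, hi, hio, hfo, hfi⟩
    -- If the literal at `s` were false in the model, falsity would be handed on along the steps up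
    -- to an occurrence of the complement of this literal.
    have key : ∀ s ∈ φ.occs, Forced φ.occs s → ν s.lit.1 = s.lit.2 := by
      rintro s hs ⟨e, hse, he⟩
      by_contra hne
      have : e ∈ φ.occs ∧ ν e.lit.1 ≠ e.lit.2 := by
        clear he
        induction hse with
        | refl => exact ⟨hs, hne⟩
        | @tail e f _ h ih =>
          obtain ⟨hf, hf'⟩ := h
          refine ⟨hf, ?_⟩
          obtain ⟨C, hC, hCl⟩ := exists_clause_of_mem_occs ih.1
          obtain ⟨l, hl, hl'⟩ := hν C hC
          rcases hCl l hl with rfl | rfl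
          · exact absurd hl' ih.2
          · rw [hf']
            simp [litNeg, hl']
      apply this.2
      rw [he]
      simpa [litNeg, Bool.eq_not] using hne
    have h1 := key o ho hfo
    have h2 := key i hi hfi
    rw [hio] at h2
    simp [litNeg, h1] at h2
  · intro h
    -- The implication graph: a clause with literals `l` and `l'` contributes the edge from the
    -- complement of `l` to `l'`, and likewise with the roles exchanged.
    let r : SatLiteral → SatLiteral → Prop :=
      fun a b => ∃ o ∈ φ.occs, a = litNeg o.lit ∧ b = o.lit'
    -- A chain of implications from `a` to `b` yields an occurrence of the complement of `a` from
    -- which all occurrences of the complement of `b` are reached. The first edge supplies this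
    -- occurrence, so the chain must not be empty; between complementary literals it never is.
    have path : ∀ a b, Relation.TransGen r a b → ∃ o ∈ φ.occs, a = litNeg o.lit ∧
        ∀ i ∈ φ.occs, i.lit = litNeg b → Relation.ReflTransGen (OccStep φ.occs) o i := by
      intro a b hab
      induction hab with
      | single hab =>
        obtain ⟨o, ho, rfl, rfl⟩ := hab
        exact ⟨o, ho, rfl, fun i hi h => .single ⟨hi, h⟩⟩
      | tail _ hdb ih =>
        obtain ⟨o, ho, ha, ih⟩ := ih
        obtain ⟨e, he, rfl, rfl⟩ := hdb
        exact ⟨o, ho, ha, fun i hi h => (ih e he (litNeg_litNeg _).symm).tail ⟨hi, h⟩⟩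
    have hne : ∀ a b, a ≠ b → Relation.ReflTransGen r a b → Relation.TransGen r a b := by
      intro a b hab h
      exact (Relation.reflTransGen_iff_eq_or_transGen.mp h).resolve_left hab.symm
    obtain ⟨ν, hν⟩ := exists_model_of_skew (r := r) (by
      rintro a b ⟨o, ho, rfl, rfl⟩
      obtain ⟨o', ho', e1, e2⟩ := exists_partner ho
      exact ⟨o', ho', by rw [e1], by rw [e2, litNeg_litNeg]⟩) (by
      rintro a ⟨h1, h2⟩
      -- A contradictory cycle gives an occurrence `o` of `litNeg a` and an occurrence `i` of `a`.
      -- Each is reached from the other, so both are forced.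
      obtain ⟨o, ho, e1, p1⟩ := path _ _ (hne _ _ (litNeg_ne a).symm h1)
      obtain ⟨i, hi, e2, p2⟩ := path _ _ (hne _ _ (litNeg_ne a) h2)
      have e3 : i.lit = a := by rw [← litNeg_litNeg i.lit, ← e2, litNeg_litNeg]
      have e4 : o.lit = litNeg a := by rw [e1, litNeg_litNeg]
      refine h ⟨o, ho, i, hi, by rw [e3, e1], ⟨i, p1 i hi (by rw [e3, litNeg_litNeg]), ?_⟩,
        ⟨o, p2 o ho e4, by rw [e4, e3]⟩⟩
      rw [e3, e1])
    refine ⟨ν, fun C hC => ?_⟩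
    obtain ⟨o, ho, h1, h2⟩ := exists_occ_of_mem hφ hC
    by_cases hl : ν o.lit.1 = o.lit.2
    · exact ⟨_, h1, hl⟩
    · exact ⟨_, h2, hν (litNeg o.lit) _ ⟨o, ho, rfl, rfl⟩ (by simpa [litNeg, Bool.eq_not] using hl)⟩

end TwoSat

/-! ### Accepted words and reachable occurrences -/

section Words

/-- The query automaton as an automaton on the list positions. -/
def occNFA (L : List Occ) (s : Fin L.length) : NFA (Fin 1) (Fin L.length) where
  step o _ := {o' | L[o'].lit = litNeg L[o].lit'}
  start := {s}
  accept := {o | L[o].lit = litNeg L[s].lit}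

theorem toNFA_queryNFA (L : List Occ) (s : Fin L.length) :
    (queryNFA L s).toNFA = occNFA L s := by
  have h1 : (queryNFA L s).toNFA.step = (occNFA L s).step := by
    funext o _
    exact Finset.coe_filter_univ _
  have h2 : (queryNFA L s).toNFA.accept = (occNFA L s).accept := Finset.coe_filter_univ _
  change (⟨(queryNFA L s).toNFA.step, {s}, (queryNFA L s).toNFA.accept⟩ :
    NFA (Fin 1) (Fin L.length)) = _
  rw [h1, h2]
  rfl

variable {L : List Occ} {s : Fin L.length}

theorem reflTransGen_of_mem_eval (w : List (Fin 1)) (x : Fin L.length)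
    (h : x ∈ (occNFA L s).eval w) : Relation.ReflTransGen (OccStep L) L[s] L[x] := by
  induction w using List.reverseRecOn generalizing x with
  | nil =>
    rw [NFA.eval_nil] at h
    rw [show x = s from h]
  | append_singleton w a ih =>
    rw [NFA.eval_append_singleton, NFA.mem_stepSet] at h
    obtain ⟨t, ht, h⟩ := h
    exact (ih t ht).tail ⟨List.getElem_mem _, h⟩

theorem exists_mem_eval {o : Occ} (h : Relation.ReflTransGen (OccStep L) L[s] o) :
    ∃ j, ∃ x ∈ (occNFA L s).eval (List.replicate j 0), L[x] = o := by
  induction h with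
  | refl => exact ⟨0, s, Set.mem_singleton _, rfl⟩
  | @tail o o' _ h ih =>
    obtain ⟨j, x, hx, rfl⟩ := ih
    obtain ⟨n, hn, rfl⟩ := List.getElem_of_mem h.1
    refine ⟨j + 1, ⟨n, hn⟩, ?_, rfl⟩
    rw [List.replicate_succ', NFA.eval_append_singleton, NFA.mem_stepSet]
    exact ⟨x, hx, h.2⟩

/-- Each state that is reached by a power of a letter is reached by a power with an exponent that
is at most the number of states. -/
theorem exists_le_card_mem_eval {α σ : Type} [Fintype σ] (M : NFA α σ) (a : α)
    {j : ℕ} {x : σ} (h : x ∈ M.eval (List.replicate j a)) :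
    ∃ i ≤ Fintype.card σ, x ∈ M.eval (List.replicate i a) := by
  classical
  -- The states reached in at most `j` steps. These sets increase, and once two consecutive ones
  -- agree they are constant; hence they do not change after `Fintype.card σ`.
  let f : ℕ → Finset σ :=
    fun j => Finset.univ.filter fun x => ∃ i ≤ j, x ∈ M.eval (List.replicate i a)
  have hf : ∀ j x, x ∈ f j ↔ ∃ i ≤ j, x ∈ M.eval (List.replicate i a) := by
    simp [f]
  have hmono : Monotone f := fun j j' h x hx => by
    rw [hf] at hx ⊢
    obtain ⟨i, hi, hx⟩ := hx
    exact ⟨i, hi.trans h, hx⟩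
  have hstab : ∀ m, (f m).card = (f (m + 1)).card → (f (m + 1)).card = (f (m + 2)).card := by
    intro m hm
    have e : f m = f (m + 1) := Finset.eq_of_subset_of_card_le (hmono (Nat.le_succ m)) hm.ge
    congr 1
    refine Finset.Subset.antisymm (hmono (Nat.le_succ _)) fun x hx => ?_
    rw [hf] at hx ⊢
    obtain ⟨i, hi, hx⟩ := hx
    rcases Nat.lt_or_ge i (m + 2) with h | h
    · exact ⟨i, by omega, hx⟩
    · obtain rfl : i = (m + 1) + 1 := by omega
      rw [List.replicate_succ', NFA.eval_append_singleton, NFA.mem_stepSet] at hx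
      obtain ⟨t, ht, hx⟩ := hx
      have : t ∈ f (m + 1) := (hf _ _).mpr ⟨_, le_rfl, ht⟩
      rw [← e, hf] at this
      obtain ⟨i, hi, ht⟩ := this
      refine ⟨i + 1, by omega, ?_⟩
      rw [List.replicate_succ', NFA.eval_append_singleton, NFA.mem_stepSet]
      exact ⟨t, ht, hx⟩
  rcases le_total j (Fintype.card σ) with hj | hj
  · exact ⟨j, hj, h⟩
  · have hcard := Nat.stabilises_of_monotone (f := fun m => (f m).card) (b := Fintype.card σ)
      (n := j) (fun _ _ h => Finset.card_le_card (hmono h)) (fun m => Finset.card_le_univ _)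
      hstab hj
    have e : f (Fintype.card σ) = f j := Finset.eq_of_subset_of_card_le (hmono hj) hcard.le
    have : x ∈ f j := (hf _ _).mpr ⟨j, le_rfl, h⟩
    rwa [← e, hf] at this

theorem accepts_queryNFA (w : List (Fin 1)) :
    (queryNFA L s).Accepts w ↔ ∃ u, u <+: w ∧ u ∈ (occNFA L s).accepts := by
  rw [← toNFA_queryNFA]
  rfl

/-- As any prefix may be accepted, a single word of length `L.length` covers all exponents up to the
number of states, and by `exists_le_card_mem_eval` larger ones are not needed. -/
theorem solutions_queryInstance_nonempty_iff :
    (queryInstance L s).solutions.Nonempty ↔ Forced L L[s] := by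
  constructor
  · rintro ⟨z, w, hw, h, rfl⟩
    obtain ⟨u, -, x, hx, hxu⟩ := (accepts_queryNFA w).mp h
    exact ⟨L[x], reflTransGen_of_mem_eval u x hxu, hx⟩
  · rintro ⟨o, ho, he⟩
    obtain ⟨j, x, hx, rfl⟩ := exists_mem_eval ho
    obtain ⟨i, hi, hx⟩ := exists_le_card_mem_eval _ _ hx
    rw [Fintype.card_fin] at hi
    have : (queryNFA L s).Accepts (List.replicate L.length (0 : Fin 1)) :=
      (accepts_queryNFA _).mpr
        ⟨List.replicate i 0, List.prefix_replicate_iff.mpr ⟨by simpa using hi, by simp⟩, x, he, hx⟩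
    exact ⟨_, List.replicate L.length (0 : Fin 1), List.length_replicate, this, rfl⟩

end Words

/-! ### Sizes of formulas and queries -/

section Counting

theorem length_occsFrom {φ : CNFFormula} (hφ : ∀ C ∈ φ, 1 ≤ C.length ∧ C.length ≤ 2) :
    ∀ p, (occsFrom p φ).length = φ.flatten.length := by
  induction φ with
  | nil => simp [occsFrom]
  | cons C φ ih =>
    intro p
    rw [occsFrom, List.length_append, length_clauseOccs (hφ C (by simp)),
      ih (fun D hD => hφ D (by simp [hD])), List.flatten_cons, List.length_append]

theorem length_occs (x : TwoSat3Instance) :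
    x.formula.occs.length = x.formula.varOccurrences.length := by
  rw [CNFFormula.occs, length_occsFrom x.clause_length, CNFFormula.varOccurrences, List.length_map]

/-- Here the restriction to three occurrences of each variable enters: the number of states of a
query is linear in the number of variables. -/
theorem length_occs_le (x : TwoSat3Instance) :
    x.formula.occs.length ≤ 3 * x.formula.numVars := by
  rw [length_occs, CNFFormula.numVars, ← List.sum_toFinset_count_eq_length, mul_comm]
  exact Finset.sum_le_card_nsmul _ _ 3 fun v _ => x.occurrences v

theorem length_occs_pos (x : TwoSat3Instance) : 0 < x.formula.occs.length := by
  obtain ⟨C, hC⟩ := List.exists_mem_of_ne_nil _ x.formula_ne_nil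
  obtain ⟨o, ho, -⟩ := exists_occ_of_mem x.clause_length hC
  exact List.length_pos_of_mem ho

theorem numVars_pos (x : TwoSat3Instance) : 0 < x.formula.numVars := by
  have := length_occs_le x
  have := length_occs_pos x
  omega

theorem length_flatten_le_length_encode (φ : CNFFormula) :
    φ.flatten.length ≤ φ.encode.length := by
  induction φ with
  | nil => simp
  | cons C φ ih =>
    have h : C.length ≤ (encClause C).length := by
      rw [encClause, List.length_append]
      refine le_trans ?_ (Nat.le_add_right _ _)
      clear ih
      induction C with
      | nil => simp
      | cons l C ih => simp [length_encLit] at *; omega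
    rw [CNFFormula.encode_eq, List.flatMap_cons, ← CNFFormula.encode_eq, List.flatten_cons,
      List.length_append, List.length_append]
    omega

theorem length_occs_le_length_encode (x : TwoSat3Instance) :
    x.formula.occs.length ≤ x.formula.encode.length := by
  rw [CNFFormula.occs, length_occsFrom x.clause_length]
  exact length_flatten_le_length_encode _

theorem length_encode_queryInstance {φ : CNFFormula} (s : Fin φ.occs.length) :
    (queryInstance φ.occs s).encode.length =
      φ.occs.length + 1 + φ.occs.length * (φ.occs.length + 5) := by
  rw [encode_queryInstance _ (nodup_ptr_occs φ)]
  simp [List.length_flatMap, encRow]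
  ring

/-- The square compensates the exponent `1/2` in the space bound of the theorem. -/
theorem size_queryInstance (L : List Occ) (s : Fin L.length) :
    (queryInstance L s).size = L.length * L.length := by
  simp [Search1NFAInstance.size, queryInstance, queryNFA]

end Counting

/-! ### Deciding satisfiability by queries -/

section Decider

variable {M : MultiTapeTM CodeSymbol (WithBot CodeSymbol)} {φ : CNFFormula} {b N : ℕ}
  {σ : SimStore M}

/-- The store is ready for a pair of queries. -/
structure Resting (φ : CNFFormula) (b : ℕ) (σ : SimStore M) : Prop where
  idle : Idle φ.encode b σ
  pristine : Pristine σ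
  zero : ∀ c, c ≠ .o → c ≠ .o' → c ≠ .i → c ≠ .i' → σ.ctr c = 0
  fetched : σ.reg.fetched = none
  move : σ.reg.move = .stay
  res : σ.reg.res = false
  res' : σ.reg.res' = false

theorem Idle.setR {Q Γ : Type} {k : ℕ} {x : List CodeSymbol} {σ : SatStore Q Γ k}
    (h : Idle x b σ) (f : Reg Q → Reg Q) (h1 : (f σ.reg).sym = σ.reg.sym)
    (h2 : (f σ.reg).sym' = σ.reg.sym') (h3 : (f σ.reg).flag = σ.reg.flag) : Idle x b (σ.setR f) :=
  ⟨h.guard, h.t, h.u, h.v, h.ih, h1.trans h.sym, h2.trans h.sym', h3.trans h.flag⟩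

theorem Resting.setC (h : Resting φ b σ) {c : Ctr} (hc : c = .o ∨ c = .o' ∨ c = .i ∨ c = .i')
    (v : ℕ) : Resting φ b (σ.setC c v) := by
  obtain ⟨h1, ⟨e1, e2, e3, e4, e5, e6⟩, h2, h3, h4, h5, h6⟩ := h
  refine ⟨h1.setC ?_ v, ⟨e1, e2, e3, ?_, e5, e6⟩, ?_, h3, h4, h5, h6⟩
  · rcases hc with rfl | rfl | rfl | rfl <;> simp [Ctr.IsPtr]
  · rcases hc with rfl | rfl | rfl | rfl <;> simpa
  · intro d d1 d2 d3 d4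
    rw [CounterStore.setC_ctr, if_neg, h2 d d1 d2 d3 d4]
    rcases hc with rfl | rfl | rfl | rfl <;> assumption

theorem Resting.setUnsat (h : Resting φ b σ) (u : Bool) :
    Resting φ b (σ.setR fun r => { r with unsat := u }) := by
  obtain ⟨h1, ⟨e1, e2, e3, e4, e5, e6⟩, h2, h3, h4, h5, h6⟩ := h
  exact ⟨h1.setR _ rfl rfl rfl, ⟨e1, e2, e3, e4, e5, e6⟩, h2, h3, h4, h5, h6⟩

/-- Query for the occurrence to which the counter `c` points. -/
def queryFor (M : MultiTapeTM CodeSymbol (WithBot CodeSymbol)) (c : Ctr) : SimProg M :=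
  .seq (addTo .s c) (.seq (runQuery M) (clear .s))

/-- Check whether complementary literals are both forced. -/
def checkPair (M : MultiTapeTM CodeSymbol (WithBot CodeSymbol)) : SimProg M :=
  .seq (queryFor M .o) (.seq (regOp fun r _ _ => { r with res' := r.res })
    (.seq (queryFor M .i) (.seq (cmpLit .o .i) (regOp fun r _ _ =>
      { r with
        unsat := r.unsat || (r.flag && !r.res && !r.res')
        flag := false
        res := false
        res' := false }))))

/-- Queries are answered according to `ans`. -/
def Answers (M : MultiTapeTM CodeSymbol (WithBot CodeSymbol)) (φ : CNFFormula) (b N : ℕ)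
    (ans : Occ → Bool) : Prop :=
  ∀ (s : Fin φ.occs.length) (σ : SimStore M), Ready φ b σ s → Pristine σ →
    Prog.Runs (counterSem φ.encode b) N (runQuery M) σ
      (σ.setR fun r => { r with res := !ans φ.occs[s] })

theorem runs_queryFor {ans : Occ → Bool} (hN : φ.encode.length + 1 ≤ N)
    (hans : Answers M φ b N ans) (hi : Idle φ.encode b σ) (hp : Pristine σ)
    (hz : ∀ c, c ≠ .o → c ≠ .o' → c ≠ .i → c ≠ .i' → σ.ctr c = 0) (hf : σ.reg.fetched = none)
    (hm : σ.reg.move = .stay) {c : Ctr} (hc : c = .o ∨ c = .i) {o : Occ} (ho : o ∈ φ.occs)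
    (hco : σ.ctr c = o.ptr) :
    Prog.Runs (counterSem φ.encode b) N (queryFor M c) σ
      (σ.setR fun r => { r with res := !ans o }) := by
  have hle := (litAt_of_mem_occs ho).1.le
  obtain ⟨n, hn, rfl⟩ := List.getElem_of_mem ho
  have hs : σ.ctr .s = 0 := hz _ (by simp) (by simp) (by simp) (by simp)
  have hg := hi.guard
  have h1 := runs_addTo (x := φ.encode) (b := b) (N := N) (c := c) (d := .s) (σ := σ)
    (by rw [hco]; omega) hi.t (by rcases hc with rfl | rfl <;> simp) (by simp)
    (by rcases hc with rfl | rfl <;> simp)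
  rw [hs, zero_add, hco] at h1
  refine h1.seq ((hans ⟨n, hn⟩ (σ.setC .s φ.occs[n].ptr) ⟨hi.setC (by simp [Ctr.IsPtr]) _, ?_, ?_,
    ?_, ?_, ?_, ?_, hf, hm⟩ ⟨hp.state, hp.halted, hp.bot, ?_, hp.tape, hp.thead⟩).seq
    ((runs_clear ?_ (by exact hg)).to_eq ?_))
  · simp [hz]
  · simp [hz]
  · simp [hz]
  · simp [hz]
  · simp
  · simp [hz]
  · simpa using hp.h
  · simp
    omega
  · ext e <;> simp
    grind

/-- The occurrences contradict satisfiability. -/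
def conflict (ans : Occ → Bool) (o i : Occ) : Bool :=
  decide (i.lit = litNeg o.lit) && ans i && ans o

/-- The first answer is saved in `res'` because the second query overwrites `res`. Both bits report
the absence of a solution, hence the negations in the update of `unsat`. -/
theorem runs_checkPair {ans : Occ → Bool} (hN : φ.encode.length + 1 ≤ N)
    (hans : Answers M φ b N ans) (hσ : Resting φ b σ) {o i : Occ} (ho : o ∈ φ.occs)
    (hi : i ∈ φ.occs) (hco : σ.ctr .o = o.ptr) (hci : σ.ctr .i = i.ptr) :
    Prog.Runs (counterSem φ.encode b) N (checkPair M) σ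
      (σ.setR fun r => { r with unsat := r.unsat || conflict ans o i }) := by
  obtain ⟨h1, ⟨e1, e2, e3, e4, e5, e6⟩, h2, h3, h4, h5, h6⟩ := hσ
  have hg := h1.guard
  refine (runs_queryFor hN hans h1 ⟨e1, e2, e3, e4, e5, e6⟩ h2 h3 h4 (.inl rfl) ho hco).seq
    ((runs_regOp _ (by exact hg)).seq
    ((runs_queryFor hN hans (by exact (h1.setR _ rfl rfl rfl).setR _ rfl rfl rfl)
      (by exact ⟨e1, e2, e3, e4, e5, e6⟩) (by exact h2) (by exact h3) (by exact h4) (.inr rfl) hi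
      (by exact hci)).seq
    ((runs_cmpLit (c := .o) (d := .i) (l := o.lit) (l' := i.lit)
      (by exact ((h1.setR _ rfl rfl rfl).setR _ rfl rfl rfl).setR _ rfl rfl rfl) hN ?_ ?_
      (by simp [Ctr.IsPtr]) (by simp [Ctr.IsPtr])).seq
    ((runs_regOp _ (by exact hg)).to_eq ?_))))
  · simpa [hco] using (litAt_of_mem_occs ho).1
  · simpa [hci] using (litAt_of_mem_occs hi).1
  · have h7 := h1.flag
    ext e <;> simp [h5, h6, h7, conflict, litNeg]
    congr

/-- Check all pairs of occurrences. -/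
def checkAll (M : MultiTapeTM CodeSymbol (WithBot CodeSymbol)) : SimProg M :=
  .seq (.act (.act fun r _ _ _ => (r, .stay, fun _ => (none, true), fun _ => .stay)))
    (forOcc .o .o' (forOcc .i .i' (checkPair M)))

/-- The initial register. -/
def initialReg (M : MultiTapeTM CodeSymbol (WithBot CodeSymbol)) : Reg M.State where
  sym := .leftEnd
  sym' := .leftEnd
  fetched := none
  flag := false
  state := M.start
  move := .stay
  halted := false
  bot := false
  res := false
  res' := false
  unsat := false

theorem runs_checkAll (hφ : ∀ C ∈ φ, 1 ≤ C.length ∧ C.length ≤ 2) {ans : Occ → Bool}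
    (hN : φ.encode.length + 1 ≤ N) (hans : Answers M φ b N ans) :
    ∃ σ', Prog.Runs (counterSem φ.encode b) N (checkAll M)
      (CounterStore.init M.numTapes ((none, false) : Option M.WorkSymbol × Bool) (initialReg M))
        σ' ∧
      σ'.reg.unsat = φ.occs.any fun o => φ.occs.any (conflict ans o) := by
  -- The store after the first action, which puts the mark on the initial cell of each work tape.
  let σ₁ : SimStore M :=
    { CounterStore.init M.numTapes ((none, false) : Option M.WorkSymbol × Bool) (initialReg M) with
      tape := fun _ z => (none, decide (z = 0)) }
  have hσ₁ : Resting φ b σ₁ :=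
    ⟨⟨by intro j; simp [σ₁, CounterStore.init], rfl, rfl, rfl, rfl, rfl, rfl, rfl⟩,
      ⟨rfl, rfl, rfl, rfl, rfl, rfl⟩, fun _ _ _ _ _ => rfl, rfl, rfl, rfl, rfl⟩
  obtain ⟨σ', h1, rfl⟩ := runs_forOcc (σ := σ₁) (b := b) (p := .o) (p' := .o')
    (body := forOcc .i .i' (checkPair M)) hφ hN
    (by simp [Ctr.IsPtr]) (by simp [Ctr.IsPtr]) (by simp)
    (fun L τ => τ = σ₁.setR fun r =>
      { r with unsat := L.any fun o => φ.occs.any (conflict ans o) })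
    (by
      rintro L τ rfl
      exact ⟨(hσ₁.setUnsat _).idle, rfl, rfl⟩)
    (by
      rintro L o L' hL τ rfl
      refine ⟨_, ?_, rfl⟩
      have ho : o ∈ φ.occs := by simp [hL]
      let τ₀ : SimStore M := ((σ₁.setR fun r =>
        { r with unsat := L.any fun o => φ.occs.any (conflict ans o) }).setC .o o.ptr).setC
          .o' o.ptr'
      have hτ₀ : Resting φ b τ₀ := ((hσ₁.setUnsat _).setC (by simp) _).setC (by simp) _
      obtain ⟨τ', h2, rfl⟩ := runs_forOcc (σ := τ₀) (b := b) (p := .i) (p' := .i')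
        (body := checkPair M) hφ hN
        (by simp [Ctr.IsPtr]) (by simp [Ctr.IsPtr]) (by simp)
        (fun L' τ => τ = τ₀.setR fun r =>
          { r with unsat := τ₀.reg.unsat || L'.any (conflict ans o) })
        (by
          rintro L τ rfl
          exact ⟨(hτ₀.setUnsat _).idle, rfl, rfl⟩)
        (by
          rintro L' i L'' hL' τ rfl
          have hi : i ∈ φ.occs := by simp [hL']
          refine ⟨_, (runs_checkPair hN hans
            (((hτ₀.setUnsat _).setC (c := .i) (by simp) i.ptr).setC (c := .i') (by simp) i.ptr')
            ho hi (by simp [τ₀]) (by simp)).to_eq ?_, rfl⟩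
          ext e <;> simp [Bool.or_assoc])
        (by ext e <;> simp)
      refine h2.to_eq ?_
      ext e <;> simp [τ₀])
    (by ext e <;> simp [σ₁, CounterStore.init, initialReg])
  refine ⟨_, Prog.Runs.seq (runs_act (τ' := σ₁) ?_ fun j => by simp [σ₁, CounterStore.init]) h1,
    by simp⟩
  refine CounterStore.ext rfl rfl rfl ?_ rfl
  funext j z
  simp [counterSem, CounterStore.init, σ₁, Function.update_apply]
  split_ifs with h <;> simp [h]

/-- If queries are answered by a machine with bounded time and space, then satisfiability is
decided with little more space. -/
theorem exists_decider (M : MultiTapeTM CodeSymbol (WithBot CodeSymbol)) :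
    ∃ (D : MultiTapeTM CodeSymbol Empty) (P : Polynomial ℕ),
      ∀ (φ : CNFFormula) (b N : ℕ), (∀ C ∈ φ, 1 ≤ C.length ∧ C.length ≤ 2) →
      φ.encode.length + 1 ≤ N →
      (∀ s, (queryInstance φ.occs s).encode.length + 1 ≤ N ∧ ∃ t, 2 * t + 3 ≤ N ∧
        M.Halted (queryInstance φ.occs s).encode (M.config (queryInstance φ.occs s).encode t) ∧
        ((⊥ ∈ (M.config (queryInstance φ.occs s).encode t).output) ↔
          (queryInstance φ.occs s).solutions = ∅) ∧
        ∀ j, M.cellsUsed (queryInstance φ.occs s).encode t j ≤ b) →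
      Nat.log 2 (P.eval N + 1) + 1 ≤ b →
      D.HaltsWithin φ.encode (P.eval N * (4 * P.eval N + 13)) (2 * b + 1 : ℕ)
        (fun c => c.state ∈ D.accepting ↔ φ.Satisfiable) := by
  classical
  have := M.finite_state
  have := M.finite_workSymbol
  obtain ⟨D, hD⟩ := exists_turingMachine (checkAll M)
    ((none, false) : Option M.WorkSymbol × Bool) (initialReg M)
    {r | r.unsat = false}
  refine ⟨D, (checkAll M).cost, fun φ b N hφ hN hM hb => ?_⟩
  have hans : Answers M φ b N (fun o => decide (Forced φ.occs o)) := by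
    intro s σ hσ hp
    obtain ⟨hy, t, ht, hhalt, hbot, hcells⟩ := hM s
    have := runs_runQuery hφ hN hσ hp hy ht hhalt hcells (by omega)
    refine this.to_eq ?_
    have hiff : (⊥ ∈ (M.config (queryInstance φ.occs s).encode t).output) ↔
        ¬ Forced φ.occs φ.occs[s] := by
      rw [← solutions_queryInstance_nonempty_iff, Set.nonempty_iff_ne_empty, ne_eq, not_not, hbot]
    simp only [hiff, decide_not]
  obtain ⟨σ', h, hun⟩ := runs_checkAll hφ hN hans
  have := hD φ.encode b N σ' h hb
  refine this.imp fun t ht => ⟨ht.1, ht.2.1, Iff.trans ht.2.2.1 ?_, ht.2.2.2⟩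
  rw [satisfiable_iff hφ, Set.mem_ofPred_eq, hun]
  simp [conflict]
  grind

end Decider

/-! ### Bounds for time and space -/

section Bounds

theorem eval_mono_nat (p : Polynomial ℕ) : Monotone fun n : ℕ => p.eval n := by
  intro m n h
  simp only [Polynomial.eval_eq_sum_range]
  gcongr

theorem eval_le_eval_one_mul_pow (p : Polynomial ℕ) {n : ℕ} (hn : 1 ≤ n) :
    p.eval n ≤ p.eval 1 * n ^ p.natDegree := by
  simp only [Polynomial.eval_eq_sum_range, one_pow, mul_one, Finset.sum_mul]
  refine Finset.sum_le_sum fun i hi => Nat.mul_le_mul_left _ (Nat.pow_le_pow_right hn ?_)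
  exact Nat.lt_succ_iff.mp (Finset.mem_range.mp hi)

/-- From `p n + 1 ≤ 2 ^ (p 1 + 1) * n ^ d`. The space for the counters is thus affine in `log₂ n`,
hence polylogarithmic. -/
theorem natLog_eval_le (p : Polynomial ℕ) {n : ℕ} (hn : 1 ≤ n) :
    (Nat.log 2 (p.eval n + 1) : ℝ) ≤
      p.eval 1 + 1 + (p + 1 : Polynomial ℕ).natDegree * Real.logb 2 n := by
  have hn' : (0 : ℝ) < n := by exact_mod_cast hn
  have h1 := eval_le_eval_one_mul_pow (p + 1) hn
  simp only [Polynomial.eval_add, Polynomial.eval_one] at h1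
  have h2 : ((p.eval n + 1 : ℕ) : ℝ) ≤
      2 ^ (p.eval 1 + 1) * (n : ℝ) ^ (p + 1 : Polynomial ℕ).natDegree := by
    refine le_trans (Nat.cast_le.mpr h1) ?_
    push_cast
    gcongr
    exact_mod_cast (Nat.lt_two_pow_self (n := p.eval 1 + 1)).le
  refine (Real.natLog_le_logb _ _).trans ?_
  refine (Real.logb_le_logb_of_le (by norm_num) (by positivity) h2).trans (le_of_eq ?_)
  rw [Nat.cast_ofNat, Real.logb_mul (by positivity) (by positivity), Real.logb_pow, Real.logb_pow,
    Real.logb_self_eq_one (by norm_num)]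
  push_cast
  ring

end Bounds

/-! ### The contradiction to the linear space hypothesis -/

theorem theorem6 (hLSH : LinearSpaceHypothesis) (ε : ℝ) (hε_pos : 0 < ε) (hε_lt : ε < 1 / 2) :
    ¬ ∃ s : ℕ → ℝ,
        Asymptotics.IsBigO Filter.atTop s (fun m : ℕ => (m : ℝ) ^ (1 / 2 - ε)) ∧
        SearchableInPolyTimeSpace Search1NFAInstance.encode Search1NFAInstance.solutions
          (fun y => s y.size) := by
  rintro ⟨s, hs, M, p, hM⟩
  -- This constant works wherever the comparison function does not vanish, not only for large
  -- arguments.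
  obtain ⟨C, hC0, hC⟩ := Asymptotics.bound_of_isBigO_nat_atTop hs
  obtain ⟨D, P, hD⟩ := exists_decider M
  -- `q n` bounds the iterations of all loops: a query has length `K ^ 2 + 6 * K + 1` with `K ≤ n`,
  -- and there must be room for `2 * t + 3`, for the length of a query plus one, and for `n + 1`.
  let q : Polynomial ℕ := 2 * p.comp (Polynomial.X ^ 2 + 6 * Polynomial.X + 1) +
    Polynomial.X ^ 2 + 6 * Polynomial.X + 5
  have hq : ∀ n : ℕ, q.eval n = 2 * p.eval (n ^ 2 + 6 * n + 1) + n ^ 2 + 6 * n + 5 := by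
    intro n
    simp [q, Polynomial.eval_comp]
  -- `A` and `2 * d` collect the constants of `2 * b + 1`, where `b` is at most `3 * C` times the
  -- power of `m_vbl`, plus `(P.comp q).eval 1 + 2 + d * log₂ n`.
  let A : ℕ := ⌈6 * C⌉₊ + 2 * (P.comp q).eval 1 + 5
  let d : ℕ := (P.comp q + 1 : Polynomial ℕ).natDegree
  refine hLSH (1 - 2 * ε) (by linarith) (by linarith)
    (fun n => A + (2 * d : ℕ) * Real.logb 2 n)
    ⟨Polynomial.C A + Polynomial.C (2 * d) * Polynomial.X, fun n => by
      rw [Polynomial.aeval_add, Polynomial.aeval_mul, Polynomial.aeval_C, Polynomial.aeval_C,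
        Polynomial.aeval_X]
      simp⟩
    ⟨D, (P * (4 * P + 13)).comp q, fun x => ?_⟩
  let n := x.formula.encode.length
  let K := x.formula.occs.length
  -- Space for the simulated work tapes and for the counters. Rounding down is harmless, as numbers
  -- of cells are integers.
  let b := max ⌊s (K * K)⌋₊ (Nat.log 2 (P.eval (q.eval n) + 1) + 1)
  have hKn : K ≤ n := length_occs_le_length_encode x
  have hK : 0 < K := length_occs_pos x
  have hlen : K + 1 + K * (K + 5) ≤ n ^ 2 + 6 * n + 1 := by nlinarith
  obtain ⟨t, ht, h1, h2, h3⟩ := hD x.formula b (q.eval n) x.clause_length (by rw [hq]; omega)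
    (by
      intro i
      have hy : (queryInstance x.formula.occs i).encode.length = K + 1 + K * (K + 5) :=
        length_encode_queryInstance i
      refine ⟨by rw [hy, hq]; omega, ?_⟩
      obtain ⟨t, ht, h1, h2, h3⟩ := hM (queryInstance x.formula.occs i)
      refine ⟨t, ?_, h1, ?_, fun j => ?_⟩
      · have := eval_mono_nat p (hy.le.trans hlen)
        dsimp only at this
        rw [hq]
        omega
      -- The code of a solution contains no `⊥`, so a single bit about the output tells whether
      -- there is a solution.
      · rcases h2 with ⟨w, hw, h⟩ | ⟨h, h'⟩
        · rw [h]
          simpa using (Set.nonempty_of_mem hw).ne_empty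
        · simp [h, h']
      · have := h3 j
        dsimp only at this
        rw [size_queryInstance] at this
        exact (Nat.le_floor this).trans (le_max_left _ _))
    (le_max_right _ _)
  refine ⟨t, ht.trans (by simp [n]), h1, h2, fun j => (h3 j).trans ?_⟩
  have hn : 1 ≤ n := by omega
  have hm : (1 : ℝ) ≤ x.formula.numVars := by exact_mod_cast numVars_pos x
  have hm' : (1 : ℝ) ≤ (x.formula.numVars : ℝ) ^ (1 - 2 * ε) :=
    Real.one_le_rpow hm (by linarith)
  have hKm : (K : ℝ) ≤ 3 * x.formula.numVars := by exact_mod_cast length_occs_le x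
  have hK' : (0 : ℝ) < K := by exact_mod_cast hK
  have hL : 0 ≤ Real.logb 2 n := Real.logb_nonneg (by norm_num) (by exact_mod_cast hn)
  have hspace : (⌊s (K * K)⌋₊ : ℝ) ≤ 3 * C * (x.formula.numVars : ℝ) ^ (1 - 2 * ε) := by
    have e1 : (((K * K : ℕ) : ℝ) ^ (1 / 2 - ε)) = (K : ℝ) ^ (1 - 2 * ε) := by
      rw [Nat.cast_mul, ← pow_two, ← Real.rpow_natCast, ← Real.rpow_mul hK'.le]
      congr 1
      push_cast
      ring
    have e2 := hC (x := K * K) (by rw [e1]; positivity)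
    rw [e1, Real.norm_eq_abs, Real.norm_eq_abs,
      abs_of_pos (a := (K : ℝ) ^ (1 - 2 * ε)) (Real.rpow_pos_of_pos hK' _)] at e2
    -- `s` may take negative values, for which the floor is zero.
    have e3 : (⌊s (K * K)⌋₊ : ℝ) ≤ |s (K * K)| := by
      rcases le_total 0 (s (K * K)) with h | h
      · exact (Nat.floor_le h).trans (le_abs_self _)
      · rw [Nat.floor_of_nonpos h]
        simp
    -- Uses `K ≤ 3 * m_vbl` and `3 ^ (1 - 2 * ε) ≤ 3`.
    have e4 : (K : ℝ) ^ (1 - 2 * ε) ≤ 3 * (x.formula.numVars : ℝ) ^ (1 - 2 * ε) := by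
      refine (Real.rpow_le_rpow hK'.le hKm (by linarith)).trans ?_
      rw [Real.mul_rpow (by norm_num) (by positivity)]
      gcongr
      exact Real.rpow_le_self_of_one_le (by norm_num) (by linarith)
    have e5 := mul_le_mul_of_nonneg_left e4 hC0.le
    linarith
  have hlog := natLog_eval_le (P.comp q) hn
  rw [Polynomial.eval_comp] at hlog
  have hceil := Nat.le_ceil (6 * C)
  have hb : (b : ℝ) ≤ 3 * C * (x.formula.numVars : ℝ) ^ (1 - 2 * ε) +
      ((P.comp q).eval 1 + 2 + d * Real.logb 2 n) := by
    have := mul_nonneg (Nat.cast_nonneg (α := ℝ) d) hL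
    rw [Nat.cast_max]
    refine max_le (hspace.trans ?_) ?_
    · have : (0 : ℝ) ≤ ((P.comp q).eval 1 : ℕ) := Nat.cast_nonneg _
      linarith
    · have : 0 ≤ 3 * C * (x.formula.numVars : ℝ) ^ (1 - 2 * ε) := by positivity
      push_cast
      linarith
  -- The power of `m_vbl` is at least one and absorbs the terms in which it does not occur.
  have hrest : (2 * (P.comp q).eval 1 + 5 : ℝ) + 2 * d * Real.logb 2 n ≤
      (x.formula.numVars : ℝ) ^ (1 - 2 * ε) *
        ((2 * (P.comp q).eval 1 + 5 : ℝ) + 2 * d * Real.logb 2 n) :=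
    le_mul_of_one_le_left (by positivity) hm'
  have hmain : 6 * C * (x.formula.numVars : ℝ) ^ (1 - 2 * ε) ≤
      (x.formula.numVars : ℝ) ^ (1 - 2 * ε) * ⌈6 * C⌉₊ := by
    rw [mul_comm]
    gcongr
  simp only [A]
  push_cast
  nlinarith
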